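/- **Setting.** Let $G$ be a simply connected Lie group and $K\subset G$ a connected closed subgroup, so that $G/K$ is simply connected, with a reductive decomposition $\mathfrak g=\mathfrak k\oplus\mathfrak p$ ($\mathfrak k$ the Lie algebra of $K$, $[\mathfrak k,\mathfrak p]\subset\mathfrak p$, and $Z\in\mathfrak k$, $[Z,\mathfrak p]=0$ imply $Z=0$); identify $T_o(G/K)$ with $\mathfrak p$ and write $[\cdot,\cdot]$ for the Lie bracket of $\mathfrak g$. Let $\gamma$ be a $G$-invariant smooth tensor field of type $(r,s)$ ($r$ times covariant, $s$ times contravariant) on $G/K$, and denote also by $\gamma$ its value on $\mathfrak p$. A *structure modelled on $\gamma$* on a manifold is a smooth tensor field which at each point corresponds to $\gamma\in T^{r,s}\mathfrak p$ in some linear frame. For $h\in \mathrm{GL}(\mathfrak p)$ let $h\cdot$ be the natural action on tensors, $\theta(A)\gamma=\frac{d}{dt}|_0e^{tA}\cdot\gamma$, $\mathfrak g_\gamma=\{A\in\mathfrak{gl}(\mathfrak p):\theta(A)\gamma=0\}$, and let $\mathfrak q_\gamma$ be an $\mathrm{Ad}(G_\gamma)$-invariant complement of $\mathfrak g_\gamma$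 in $\mathfrak{gl}(\mathfrak p)$, where $G_\gamma\subset\mathrm{GL}(\mathfrak p)$ is the stabilizer of $\gamma$. Consider a geometric flow $\frac{\partial}{\partial t}\delta=q(\delta)$ of structures modelled on $\gamma$: $q$ assigns to each such structure $\delta$ a smooth tensor field $q(\delta)$ of type $(r,s)$, is equivariant under diffeomorphisms, $q(\delta)$ is at each point tangent to the $\mathrm{GL}$-orbit of $\delta$, and $q(c\,\delta)=c^\alpha q(\delta)$ for all $c>0$ such that $c\,\delta$ is again modelled on $\gamma$, where $\alpha\in\mathbb R$ is fixed. Then there is a unique operator $Q(\gamma)\in\mathfrak q_\gamma$ with $\theta(Q(\gamma))\gamma=q(\gamma)$ on $\mathfrak p$. In the same way, if $\mu$ is a Lie bracket on the vector space $\mathfrak k\oplus\mathfrak p$ which defines such a homogeneous space $G_\mu/K_\mu$ carrying an invariant structure $\gamma_\mu$ whose value at the origin is $\gamma$, let $Q_\mu\in\mathfrak q_\gamma$ be the operator with $\theta(Q_\mu)\gamma=q(\gamma_\mu)$ on $\mathfrak p$. The *bracket flow* is the equation $\mu'(t)=\delta_{\mu(t)}(\mathrm{diag}(0,Q_{\mu(t)}))$,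 where $\delta_\mu(A)=\mu(A\cdot,\cdot)+\mu(\cdot,A\cdot)-A\mu(\cdot,\cdot)$. For $c\neq0$ put $c\cdot\mu=\mathrm{diag}(I,c^{-1}I)\cdot\mu$, i.e. $(c\cdot\mu)(X,Y)=h\mu(h^{-1}X,h^{-1}Y)$ with $h=\mathrm{diag}(I,c^{-1}I)$ on $\mathfrak k\oplus\mathfrak p$. **Theorem.** The following conditions are equivalent: (i) The bracket flow solution starting at $[\cdot,\cdot]$ is given, on some open interval around $0$, by $\mu(t)=c(t)\cdot[\cdot,\cdot]$ for some $c(t)>0$, $c(0)=1$. (i$'$) The same holds with the form of $\mu(t)$ written in components: $\mu(t)|_{\mathfrak k\times\mathfrak g}\equiv[\cdot,\cdot]$ and, on $\mathfrak p\times\mathfrak p$, $\mu_{\mathfrak k}(t)=c(t)^2[\cdot,\cdot]_{\mathfrak k}$, $\mu_{\mathfrak p}(t)=c(t)[\cdot,\cdot]_{\mathfrak p}$. (ii) (algebraic soliton) $Q(\gamma)=cI+D_{\mathfrak p}$ for some $c\in\mathbb R$ and some $D_{\mathfrak p}\in\mathrm{End}(\mathfrak p)$ such that $D=\mathrm{diag}(0,D_{\mathfrak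 p})$ is a derivation of $\mathfrak g$. Let $c$, $D_{\mathfrak p}$ be as in (ii), put $a=(s-r)(1-\alpha)$, $$b(t)=(act+1)^{1/(1-\alpha)},\qquad s(t)=\tfrac1{ac}\log(act+1),$$ where for $\alpha=1$ one reads $b(t)$ as its limit $e^{(s-r)ct}$ and for $ac=0$ one reads $s(t)$ as its limit $t$. Then, on the interval $\{t: act+1>0\}$: (a) $\mu(t)=e^{c\,s(t)}\cdot[\cdot,\cdot]$ solves the bracket flow, with $\mu(0)=[\cdot,\cdot]$; (b) the $G$-invariant structures $\gamma(t)$ on $G/K$ with value $\gamma(t)=b(t)\,e^{s(t)D_{\mathfrak p}}\cdot\gamma$ at the origin solve the geometric flow $\frac{\partial}{\partial t}\gamma(t)=q(\gamma(t))$, with $\gamma(0)=\gamma$. Moreover, (c) $(G/K,\gamma)$ is a soliton geometric structure, i.e. $q(\gamma)=c'\gamma+\mathcal L_X\gamma$ for some $c'\in\mathbb R$ and some complete vector field $X$; in fact $$q(\gamma)=(s-r)c\,\gamma-\mathcal L_{X_D}\gamma,$$ where $X_D$ is the vector field on $G/K$ defined by the one-parameter group of automorphisms $\tilde\varphi_t\in\mathrm{Aut}(G)$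 with $d\tilde\varphi_t|_e=e^{tD}$: one has $\tilde\varphi_t(K)=K$, and $X_D$ is the complete vector field with flow $\varphi_t(uK)=\tilde\varphi_t(u)K$. -/

import Mathlib

open Set Function
open scoped Manifold ContDiff

universe u v w

noncomputable section

namespace BracketFlow

/-! ### Tensors on a vector space -/

section Tensors

variable {r s : ℕ}

/-- Tensors of type `(r, s)` on `V`: `r` times covariant and `s` times contravariant, that is,
multilinear in `r` vectors and `s` covectors. -/
abbrev Tensor (r s : ℕ) (V : Type*) [AddCommGroup V] [Module ℝ V] [TopologicalSpace V]
    [IsTopologicalAddGroup V] [ContinuousSMul ℝ V] : Type _ :=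
  MultilinearMap ℝ (fun _ : Fin r => V) (MultilinearMap ℝ (fun _ : Fin s => V →L[ℝ] ℝ) ℝ)

variable {V : Type*} [AddCommGroup V] [Module ℝ V] [TopologicalSpace V]
  [IsTopologicalAddGroup V] [ContinuousSMul ℝ V]
  {W : Type*} [AddCommGroup W] [Module ℝ W] [TopologicalSpace W]
  [IsTopologicalAddGroup W] [ContinuousSMul ℝ W]

/-- Pull-back `e^* T` of a tensor by a linear isomorphism:
`(e^* T)(x; ξ) = T (e x₁, …, e xᵣ; ξ₁ ∘ e⁻¹, …, ξₛ ∘ e⁻¹)`. -/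
def Tensor.pull (e : V ≃L[ℝ] W) (T : Tensor r s W) : Tensor r s V :=
  (MultilinearMap.compLinearMapₗ (fun _ : Fin s =>
      (ContinuousLinearMap.precomp ℝ (e.symm : W →L[ℝ] V) :
        (V →L[ℝ] ℝ) →L[ℝ] (W →L[ℝ] ℝ)).toLinearMap)).compMultilinearMap
    (T.compLinearMap (fun _ : Fin r => ((e : V →L[ℝ] W) : V →ₗ[ℝ] W)))

theorem Tensor.pull_apply (e : V ≃L[ℝ] W) (T : Tensor r s W)
    (x : Fin r → V) (ξ : Fin s → V →L[ℝ] ℝ) :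
    Tensor.pull e T x ξ
      = T (fun i => e (x i)) (fun j => (ξ j).comp (e.symm : W →L[ℝ] V)) := rfl

/-- The natural left action of `GL(V)` on tensors, `h · T = (h⁻¹)^* T`. -/
def Tensor.act (h : V ≃L[ℝ] V) (T : Tensor r s V) : Tensor r s V :=
  Tensor.pull h.symm T

end Tensors

section LinearAlgebra

variable {r s : ℕ} {𝔭 : Type v} [NormedAddCommGroup 𝔭] [NormedSpace ℝ 𝔭]

/-- The infinitesimal action `θ(A) γ` of `gl(𝔭)` on tensors, see `theta_apply` for the formula and
`hasDerivAt_act_exp` for the proof that `θ(A) γ = d/dt|₀ e^{tA} · γ`. -/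
def theta (A : 𝔭 →L[ℝ] 𝔭) (γ : Tensor r s 𝔭) : Tensor r s 𝔭 :=
  ∑ j : Fin s, (MultilinearMap.compLinearMapₗ (fun j' : Fin s =>
      if j' = j then (ContinuousLinearMap.precomp ℝ A : (𝔭 →L[ℝ] ℝ) →L[ℝ] (𝔭 →L[ℝ] ℝ)).toLinearMap
      else LinearMap.id)).compMultilinearMap γ
  - ∑ i : Fin r, γ.compLinearMap
      (fun i' : Fin r => if i' = i then (A : 𝔭 →ₗ[ℝ] 𝔭) else LinearMap.id)

theorem theta_apply (A : 𝔭 →L[ℝ] 𝔭) (γ : Tensor r s 𝔭) (x : Fin r → 𝔭)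
    (ξ : Fin s → 𝔭 →L[ℝ] ℝ) :
    theta A γ x ξ = ∑ j, γ x (update ξ j ((ξ j).comp A)) - ∑ i, γ (update x i (A (x i))) ξ := by
  have h1 : ∀ j : Fin s, (fun j' : Fin s => (if j' = j then
      (ContinuousLinearMap.precomp ℝ A : (𝔭 →L[ℝ] ℝ) →L[ℝ] (𝔭 →L[ℝ] ℝ)).toLinearMap
      else LinearMap.id) (ξ j')) = update ξ j ((ξ j).comp A) := by
    intro j; ext j' : 1
    by_cases h : j' = j
    · subst h; simp
    · simp [h]
  have h2 : ∀ i : Fin r, (fun i' : Fin r => (if i' = i then (A : 𝔭 →ₗ[ℝ] 𝔭) else LinearMap.id)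
      (x i')) = update x i (A (x i)) := by
    intro i; ext i' : 1
    by_cases h : i' = i
    · subst h; simp
    · simp [h]
  simp [theta, h1, h2]

theorem theta_add (A B : 𝔭 →L[ℝ] 𝔭) (γ : Tensor r s 𝔭) :
    theta (A + B) γ = theta A γ + theta B γ := by
  ext x ξ
  simp only [theta_apply, add_apply, ContinuousLinearMap.comp_add,
    MultilinearMap.map_update_add, Finset.sum_add_distrib]
  ring

theorem theta_smul (c : ℝ) (A : 𝔭 →L[ℝ] 𝔭) (γ : Tensor r s 𝔭) :
    theta (c • A) γ = c • theta A γ := by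
  ext x ξ
  simp only [theta_apply, smul_apply, ContinuousLinearMap.comp_smul,
    MultilinearMap.map_update_smul, smul_eq_mul, mul_sub,
    Finset.mul_sum]

variable [FiniteDimensional ℝ 𝔭]

theorem continuous_multilinear {n : ℕ} {E : Type*} [NormedAddCommGroup E] [NormedSpace ℝ E]
    [FiniteDimensional ℝ E] (m : MultilinearMap ℝ (fun _ : Fin n => E) ℝ) : Continuous m := by
  let b := Module.finBasis ℝ E
  have h : ∀ y : Fin n → E, m y = ∑ k : Fin n → Fin (Module.finrank ℝ E),
      (∏ i, b.repr (y i) (k i)) * m (fun i => b (k i)) := by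
    intro y
    conv_lhs => rw [show y = fun i => ∑ j, b.repr (y i) j • b j from
      funext fun i => (b.sum_repr (y i)).symm]
    rw [MultilinearMap.map_sum]
    refine Finset.sum_congr rfl fun k _ => ?_
    rw [MultilinearMap.map_smul_univ, smul_eq_mul]
  have hc : ∀ j, Continuous fun z : E => b.repr z j := fun j =>
    (b.coord j).continuous_of_finiteDimensional
  rw [show (m : (Fin n → E) → ℝ) = _ from funext h]
  exact continuous_finsetSum _ fun k _ =>
    (continuous_finsetProd _ fun i _ => (hc (k i)).comp (continuous_apply i)).mul continuous_const

theorem hasDerivAt_multilinear {n : ℕ} {E : Type*} [NormedAddCommGroup E] [NormedSpace ℝ E]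
    [FiniteDimensional ℝ E] (m : MultilinearMap ℝ (fun _ : Fin n => E) ℝ) {y : ℝ → Fin n → E}
    {y' : Fin n → E} {t : ℝ} (hy : ∀ i, HasDerivAt (fun τ => y τ i) (y' i) t) :
    HasDerivAt (fun τ => m (y τ)) (∑ i, m (update (y t) i (y' i))) t := by
  let M : ContinuousMultilinearMap ℝ (fun _ : Fin n => E) ℝ :=
    { m with cont := continuous_multilinear m }
  have h := (M.hasFDerivAt (y t)).comp_hasDerivAt t (hasDerivAt_pi.2 hy)
  rw [ContinuousMultilinearMap.linearDeriv_apply] at h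
  exact h

theorem hasDerivAt_tensor (γ : Tensor r s 𝔭) {x : ℝ → Fin r → 𝔭}
    {x' : Fin r → 𝔭}
    {ξ : ℝ → Fin s → 𝔭 →L[ℝ] ℝ} {ξ' : Fin s → 𝔭 →L[ℝ] ℝ} {t : ℝ}
    (hx : ∀ i, HasDerivAt (fun τ => x τ i) (x' i) t)
    (hξ : ∀ j, HasDerivAt (fun τ => ξ τ j) (ξ' j) t) :
    HasDerivAt (fun τ => γ (x τ) (ξ τ))
      (∑ i, γ (update (x t) i (x' i)) (ξ t) + ∑ j, γ (x t) (update (ξ t) j (ξ' j))) t := by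
  let b := Module.finBasis ℝ (MultilinearMap ℝ (fun _ : Fin s => 𝔭 →L[ℝ] ℝ) ℝ)
  have key : ∀ (v : Fin r → 𝔭) (w : Fin s → 𝔭 →L[ℝ] ℝ),
      γ v w = ∑ k, (b.coord k).compMultilinearMap γ v * b k w := by
    intro v w
    conv_lhs => rw [← b.sum_repr (γ v)]
    simp only [sum_apply, smul_apply, smul_eq_mul]
    rfl
  have h1 := fun k => (hasDerivAt_multilinear ((b.coord k).compMultilinearMap γ) hx).mul
    (hasDerivAt_multilinear (b k) hξ)
  have h2 := HasDerivAt.fun_sum (u := Finset.univ) fun k _ => h1 k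
  simp only [key]
  refine h2.congr_deriv ?_
  simp only [Finset.sum_add_distrib, Finset.sum_mul, Finset.mul_sum]
  rw [Finset.sum_comm]
  congr 1
  rw [Finset.sum_comm]

theorem exp_mul_exp_neg (A : 𝔭 →L[ℝ] 𝔭) :
    NormedSpace.exp A * NormedSpace.exp (-A) = 1 := by
  have : CompleteSpace 𝔭 := FiniteDimensional.complete ℝ 𝔭
  let _ : NormedAlgebra ℚ (𝔭 →L[ℝ] 𝔭) := NormedAlgebra.restrictScalars ℚ ℝ _
  rw [← NormedSpace.exp_add_of_commute (Commute.neg_right (Commute.refl A)), add_neg_cancel,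
    NormedSpace.exp_zero]

/-- The exponential `e^A` of an endomorphism, as an element of `GL(𝔭)`. -/
def expEquiv (A : 𝔭 →L[ℝ] 𝔭) : 𝔭 ≃L[ℝ] 𝔭 :=
  ContinuousLinearEquiv.equivOfInverse (NormedSpace.exp A) (NormedSpace.exp (-A))
    (fun x => by
      have h := exp_mul_exp_neg (-A)
      rw [neg_neg] at h
      exact DFunLike.congr_fun h x)
    (fun x => DFunLike.congr_fun (exp_mul_exp_neg A) x)

theorem hasDerivAt_act_exp (A : 𝔭 →L[ℝ] 𝔭) (γ : Tensor r s 𝔭)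
    (x : Fin r → 𝔭) (ξ : Fin s → 𝔭 →L[ℝ] ℝ) :
    HasDerivAt (fun t : ℝ => Tensor.act (expEquiv (t • A)) γ x ξ) (theta A γ x ξ) 0 := by
  have : CompleteSpace 𝔭 := FiniteDimensional.complete ℝ 𝔭
  have e1 : HasDerivAt (fun t : ℝ => NormedSpace.exp (t • A)) A 0 := by
    simpa using hasDerivAt_exp_smul_const (𝕂 := ℝ) A (0 : ℝ)
  have e2 : HasDerivAt (fun t : ℝ => NormedSpace.exp (-(t • A))) (-A) 0 := by
    simpa using hasDerivAt_exp_smul_const (𝕂 := ℝ) (-A) (0 : ℝ)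
  have hx : ∀ i, HasDerivAt (fun t : ℝ => (NormedSpace.exp (-(t • A)) : 𝔭 →L[ℝ] 𝔭) (x i))
      (-(A (x i))) 0 := fun i => by simpa using e2.clm_apply (hasDerivAt_const (0 : ℝ) (x i))
  have hξ : ∀ j, HasDerivAt (fun t : ℝ => (ξ j).comp (NormedSpace.exp (t • A) : 𝔭 →L[ℝ] 𝔭))
      ((ξ j).comp A) 0 := fun j => by simpa using (hasDerivAt_const (0 : ℝ) (ξ j)).clm_comp e1
  have h := hasDerivAt_tensor γ (x := fun t i => (NormedSpace.exp (-(t • A)) : 𝔭 →L[ℝ] 𝔭) (x i))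
    (ξ := fun t j => (ξ j).comp (NormedSpace.exp (t • A) : 𝔭 →L[ℝ] 𝔭)) hx hξ
  refine HasDerivAt.congr_deriv (f := fun t : ℝ => Tensor.act (expEquiv (t • A)) γ x ξ) h ?_
  have z1 : (fun i => (NormedSpace.exp (-((0 : ℝ) • A)) : 𝔭 →L[ℝ] 𝔭) (x i)) = x := by simp
  have z2 : (fun j => (ξ j).comp (NormedSpace.exp ((0 : ℝ) • A) : 𝔭 →L[ℝ] 𝔭)) = ξ := by
    funext j; ext; simp
  have hn : ∀ i, γ (update x i (-(A (x i)))) = - γ (update x i (A (x i))) := by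
    intro i; rw [← neg_one_smul ℝ, MultilinearMap.map_update_smul, neg_one_smul]
  rw [z1, z2, theta_apply]
  simp only [hn, neg_apply, Finset.sum_neg_distrib]
  ring

/-- The Lie algebra `g_γ = {A : θ(A) γ = 0}` of the stabilizer of `γ`. -/
def stabAlgebra (γ : Tensor r s 𝔭) : Submodule ℝ (𝔭 →L[ℝ] 𝔭) where
  carrier := {A | theta A γ = 0}
  add_mem' {A B} hA hB := by
    have hA' : theta A γ = 0 := hA
    have hB' : theta B γ = 0 := hB
    change theta (A + B) γ = 0
    rw [theta_add, hA', hB', add_zero]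
  zero_mem' := by
    have h := theta_smul (0 : ℝ) (0 : 𝔭 →L[ℝ] 𝔭) γ
    rw [zero_smul, zero_smul] at h
    exact h
  smul_mem' c A hA := by
    have hA' : theta A γ = 0 := hA
    change theta (c • A) γ = 0
    rw [theta_smul, hA', smul_zero]

/-- `𝔮` is an `Ad(G_γ)`-invariant complement of `g_γ` in `gl(𝔭)`, where `G_γ ⊂ GL(𝔭)` is the
stabilizer of `γ`. -/
structure IsInvariantComplement (γ : Tensor r s 𝔭) (𝔮 : Submodule ℝ (𝔭 →L[ℝ] 𝔭)) : Prop where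
  isCompl : IsCompl (stabAlgebra γ) 𝔮
  conj_mem : ∀ h : 𝔭 ≃L[ℝ] 𝔭, Tensor.act h γ = γ → ∀ A ∈ 𝔮,
    (h : 𝔭 →L[ℝ] 𝔭) ∘L A ∘L (h.symm : 𝔭 →L[ℝ] 𝔭) ∈ 𝔮

end LinearAlgebra

/-! ### Tensor fields and geometric structures on manifolds -/

section Manifolds

variable {𝔭 : Type v} [NormedAddCommGroup 𝔭] [NormedSpace ℝ 𝔭]

/-- A (not necessarily continuous) tensor field of type `(r, s)` on `M`. -/
abbrev TensorField (𝔭 : Type v) [NormedAddCommGroup 𝔭] [NormedSpace ℝ 𝔭] (r s : ℕ) (M : Type u)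
    [TopologicalSpace M] [ChartedSpace 𝔭 M] : Type _ :=
  ∀ p : M, Tensor r s (TangentSpace 𝓘(ℝ, 𝔭) p)

variable {r s : ℕ} {M : Type u} [TopologicalSpace M] [ChartedSpace 𝔭 M]
  [IsManifold 𝓘(ℝ, 𝔭) ∞ M] {N : Type w} [TopologicalSpace N] [ChartedSpace 𝔭 N]
  [IsManifold 𝓘(ℝ, 𝔭) ∞ N]

/-- A tensor field is smooth if its components in the coordinate frames of the charts are. -/
def TensorField.IsSmooth (T : TensorField 𝔭 r s M) : Prop :=
  ∀ (p₀ : M) (x : Fin r → 𝔭) (ξ : Fin s → 𝔭 →L[ℝ] ℝ),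
    ContMDiffAt 𝓘(ℝ, 𝔭) 𝓘(ℝ, ℝ) ∞
      (fun p => T p
        (fun i => (trivializationAt 𝔭 (TangentSpace 𝓘(ℝ, 𝔭)) p₀).symmL ℝ p (x i))
        (fun j => (ξ j).comp
          ((trivializationAt 𝔭 (TangentSpace 𝓘(ℝ, 𝔭)) p₀).continuousLinearMapAt ℝ p))) p₀

/-- The differential of a diffeomorphism, as an isomorphism between tangent spaces. -/
def diffEquiv (φ : M ≃ₘ^∞⟮𝓘(ℝ, 𝔭), 𝓘(ℝ, 𝔭)⟯ N) (p : M) :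
    TangentSpace 𝓘(ℝ, 𝔭) p ≃L[ℝ] TangentSpace 𝓘(ℝ, 𝔭) (φ p) :=
  φ.mfderivToContinuousLinearEquiv (by simp) p

/-- Pull-back `φ^* T` of a tensor field by a diffeomorphism. -/
def TensorField.pullback (φ : M ≃ₘ^∞⟮𝓘(ℝ, 𝔭), 𝓘(ℝ, 𝔭)⟯ N) (T : TensorField 𝔭 r s N) :
    TensorField 𝔭 r s M :=
  fun p => Tensor.pull (diffEquiv φ p) (T (φ p))

/-- `δ` is a geometric structure modelled on the tensor `γ`: a smooth tensor field whose value at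
each point corresponds to `γ` in a suitable linear frame, i.e. it lies pointwise in the
`GL`-orbit of `γ`. -/
structure IsGeometricStructure (γ : Tensor r s 𝔭) (δ : TensorField 𝔭 r s M) : Prop where
  smooth : δ.IsSmooth
  frame : ∀ p : M, ∃ e : 𝔭 ≃L[ℝ] TangentSpace 𝓘(ℝ, 𝔭) p, Tensor.pull e (δ p) = γ

/-- `φ` is the global flow of the vector field `X`. -/
def IsFlow (X : ∀ p : M, TangentSpace 𝓘(ℝ, 𝔭) p)
    (φ : ℝ → M ≃ₘ^∞⟮𝓘(ℝ, 𝔭), 𝓘(ℝ, 𝔭)⟯ M) : Prop :=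
  ∀ p : M, φ 0 p = p ∧ IsMIntegralCurve (I := 𝓘(ℝ, 𝔭)) (fun t => φ t p) X

/-- `X` is a smooth complete vector field and `L = ℒ_X T` is the Lie derivative of the tensor field
`T` along `X`, i.e. `L = d/dt|₀ φ_t^* T` where `φ` is the flow of `X`. -/
def IsLieDerivative (X : ∀ p : M, TangentSpace 𝓘(ℝ, 𝔭) p) (T L : TensorField 𝔭 r s M) : Prop :=
  ContMDiff 𝓘(ℝ, 𝔭) 𝓘(ℝ, 𝔭).tangent ∞ (fun p => (⟨p, X p⟩ : TangentBundle 𝓘(ℝ, 𝔭) M)) ∧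
  ∃ φ : ℝ → M ≃ₘ^∞⟮𝓘(ℝ, 𝔭), 𝓘(ℝ, 𝔭)⟯ M, IsFlow X φ ∧
    ∀ (p : M) (x : Fin r → TangentSpace 𝓘(ℝ, 𝔭) p) (ξ : Fin s → TangentSpace 𝓘(ℝ, 𝔭) p →L[ℝ] ℝ),
      HasDerivAt (fun t => T.pullback (φ t) p x ξ) (L p x ξ) 0

/-- The right-hand side `δ ↦ q(δ)` of a diffeomorphism invariant geometric flow `∂δ/∂t = q(δ)` of
structures modelled on `γ`: it assigns to each such structure `δ` on a manifold a smooth tensor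
field `q(δ)`, equivariantly with respect to diffeomorphisms, and at each point `q(δ)` is tangent
to the `GL`-orbit of `δ`, i.e. of the form `θ(A) δ` in a frame. (If that orbit is open in the space
of all tensors of a given symmetry type, this just says that `q(δ)` has this type.) -/
structure GeometricFlow [FiniteDimensional ℝ 𝔭] (γ : Tensor r s 𝔭) where
  q : ∀ (M : Type u) [TopologicalSpace M] [ChartedSpace 𝔭 M] [IsManifold 𝓘(ℝ, 𝔭) ∞ M],
    TensorField 𝔭 r s M → TensorField 𝔭 r s M
  smooth : ∀ (M : Type u) [TopologicalSpace M] [ChartedSpace 𝔭 M] [IsManifold 𝓘(ℝ, 𝔭) ∞ M]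
    (δ : TensorField 𝔭 r s M), IsGeometricStructure γ δ → (q M δ).IsSmooth
  tangent : ∀ (M : Type u) [TopologicalSpace M] [ChartedSpace 𝔭 M] [IsManifold 𝓘(ℝ, 𝔭) ∞ M]
    (δ : TensorField 𝔭 r s M), IsGeometricStructure γ δ →
    ∀ (p : M) (e : 𝔭 ≃L[ℝ] TangentSpace 𝓘(ℝ, 𝔭) p), Tensor.pull e (δ p) = γ →
      ∃ A : 𝔭 →L[ℝ] 𝔭, Tensor.pull e (q M δ p) = theta A γ
  natural : ∀ (M : Type u) [TopologicalSpace M] [ChartedSpace 𝔭 M] [IsManifold 𝓘(ℝ, 𝔭) ∞ M]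
    (N : Type u) [TopologicalSpace N] [ChartedSpace 𝔭 N] [IsManifold 𝓘(ℝ, 𝔭) ∞ N]
    (φ : M ≃ₘ^∞⟮𝓘(ℝ, 𝔭), 𝓘(ℝ, 𝔭)⟯ N) (δ : TensorField 𝔭 r s N), IsGeometricStructure γ δ →
    q M (δ.pullback φ) = (q N δ).pullback φ

variable [FiniteDimensional ℝ 𝔭] {γ : Tensor r s 𝔭}

/-- The scaling property `q(cδ) = c^α q(δ)`, `c > 0`. -/
def GeometricFlow.HasScaling (F : GeometricFlow.{u} γ) (α : ℝ) : Prop :=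
  ∀ (M : Type u) [TopologicalSpace M] [ChartedSpace 𝔭 M] [IsManifold 𝓘(ℝ, 𝔭) ∞ M]
    (δ : TensorField 𝔭 r s M) (c : ℝ), 0 < c → IsGeometricStructure γ δ →
    IsGeometricStructure γ (c • δ) → F.q M (c • δ) = (c ^ α) • F.q M δ

/-- `δ(t)`, `t ∈ J`, is a solution of the geometric flow `∂δ/∂t = q(δ)`. -/
def GeometricFlow.IsSolution (F : GeometricFlow.{u} γ) (J : Set ℝ)
    (δ : ℝ → TensorField 𝔭 r s M) : Prop :=
  ∀ t ∈ J, IsGeometricStructure γ (δ t) ∧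
    ∀ (p : M) (x : Fin r → TangentSpace 𝓘(ℝ, 𝔭) p) (ξ : Fin s → TangentSpace 𝓘(ℝ, 𝔭) p →L[ℝ] ℝ),
      HasDerivAt (fun τ => δ τ p x ξ) (F.q M (δ t) p x ξ) t

/-- Soliton geometric structures: `q(δ) = c δ + ℒ_X δ` for some `c ∈ ℝ` and some complete vector
field `X`. -/
def GeometricFlow.IsSoliton (F : GeometricFlow.{u} γ) (δ : TensorField 𝔭 r s M) : Prop :=
  ∃ (c : ℝ) (X : ∀ p : M, TangentSpace 𝓘(ℝ, 𝔭) p) (L : TensorField 𝔭 r s M),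
    IsLieDerivative X δ L ∧ ∀ p, F.q M δ p = c • δ p + L p

end Manifolds

/-! ### Brackets on `𝔤 = 𝔨 ⊕ 𝔭` -/

section Brackets

variable {V : Type*} [AddCommGroup V] [Module ℝ V]

/-- `δ_μ(A) = μ(A·, ·) + μ(·, A·) - A μ(·, ·)`. -/
def deltaBracket (μ : V →ₗ[ℝ] V →ₗ[ℝ] V) (A : V →ₗ[ℝ] V) : V →ₗ[ℝ] V →ₗ[ℝ] V :=
  μ.comp A + μ.compl₂ A - μ.compr₂ A

/-- `A` is a derivation of the algebra `(V, μ)`. -/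
def IsDerivation (μ : V →ₗ[ℝ] V →ₗ[ℝ] V) (A : V →ₗ[ℝ] V) : Prop :=
  ∀ X Y, A (μ X Y) = μ (A X) Y + μ X (A Y)

variable {𝔨 : Type w} [NormedAddCommGroup 𝔨] [NormedSpace ℝ 𝔨]
  {𝔭 : Type v} [NormedAddCommGroup 𝔭] [NormedSpace ℝ 𝔭]

/-- The block operator `diag(0, A)` on `𝔨 ⊕ 𝔭`. -/
def blockP (𝔨 : Type w) [NormedAddCommGroup 𝔨] [NormedSpace ℝ 𝔨] (A : 𝔭 →L[ℝ] 𝔭) :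
    (𝔨 × 𝔭) →L[ℝ] (𝔨 × 𝔭) :=
  (0 : 𝔨 →L[ℝ] 𝔨).prodMap A

/-- The operator `diag(I, c I)` on `𝔨 ⊕ 𝔭`. -/
def diagScalar (c : ℝ) : (𝔨 × 𝔭) →ₗ[ℝ] (𝔨 × 𝔭) :=
  (LinearMap.id : 𝔨 →ₗ[ℝ] 𝔨).prodMap (c • (LinearMap.id : 𝔭 →ₗ[ℝ] 𝔭))

/-- The geometric scaling `c · μ = diag(I, c⁻¹ I) · μ` of brackets on `𝔨 ⊕ 𝔭` for `c ≠ 0`, where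
`(h · μ)(X, Y) = h μ(h⁻¹ X, h⁻¹ Y)`. -/
def scaleBracket (c : ℝ) (μ : (𝔨 × 𝔭) →ₗ[ℝ] (𝔨 × 𝔭) →ₗ[ℝ] (𝔨 × 𝔭)) :
    (𝔨 × 𝔭) →ₗ[ℝ] (𝔨 × 𝔭) →ₗ[ℝ] (𝔨 × 𝔭) :=
  (μ.compl₁₂ (diagScalar c) (diagScalar c)).compr₂ (diagScalar c⁻¹)

end Brackets

/-! ### Homogeneous spaces -/

section Homogeneous

/-- A simply connected, almost-effective homogeneous space `G/K` with a reductive decomposition of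
the Lie algebra of `G`, which is identified by `ι` with the vector space `𝔤 = 𝔨 ⊕ 𝔭`. Here `G` is a
simply connected Lie group and `K` a connected closed subgroup with Lie algebra `𝔨`. The smooth
structure of `G/K` is the usual one: `G` acts smoothly, and the differential at the identity of the
projection `π : G → G/K` is surjective with kernel `𝔨`; thus it restricts to the canonical
identification `ψ : 𝔭 ≃ T_o(G/K)`. -/
structure HomogeneousSpace (𝔨 : Type w) [NormedAddCommGroup 𝔨] [NormedSpace ℝ 𝔨]
    [FiniteDimensional ℝ 𝔨] (𝔭 : Type v) [NormedAddCommGroup 𝔭] [NormedSpace ℝ 𝔭]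
    [FiniteDimensional ℝ 𝔭] where
  G : Type u
  [group : Group G]
  [topology : TopologicalSpace G]
  [charted : ChartedSpace (𝔨 × 𝔭) G]
  [lieGroup : LieGroup 𝓘(ℝ, 𝔨 × 𝔭) ∞ G]
  [t2 : T2Space G]
  [simplyConnected : SimplyConnectedSpace G]
  K : Subgroup G
  isClosed : IsClosed (K : Set G)
  isConnected : IsConnected (K : Set G)
  [chartedQuotient : ChartedSpace 𝔭 (G ⧸ K)]
  [manifoldQuotient : IsManifold 𝓘(ℝ, 𝔭) ∞ (G ⧸ K)]
  smooth_smul : ContMDiff (𝓘(ℝ, 𝔨 × 𝔭).prod 𝓘(ℝ, 𝔭)) 𝓘(ℝ, 𝔭) ∞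
    (fun z : G × (G ⧸ K) => z.1 • z.2)
  ι : (𝔨 × 𝔭) ≃L[ℝ] GroupLieAlgebra 𝓘(ℝ, 𝔨 × 𝔭) G
  ψ : 𝔭 ≃L[ℝ] TangentSpace 𝓘(ℝ, 𝔭) ((1 : G) : G ⧸ K)
  mfderiv_proj : ∀ (Z : 𝔨) (X : 𝔭),
    mfderiv 𝓘(ℝ, 𝔨 × 𝔭) 𝓘(ℝ, 𝔭) (fun g : G => (g : G ⧸ K)) 1 (ι (Z, X)) = ψ X
  /-- `[𝔨, 𝔨] ⊂ 𝔨` -/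
  bracket_kk : ∀ Z Z' : 𝔨, (ι.symm ⁅ι (Z, 0), ι (Z', 0)⁆).2 = 0
  /-- `[𝔨, 𝔭] ⊂ 𝔭`, i.e. `𝔭` is `Ad(K)`-invariant (`K` is connected) -/
  bracket_kp : ∀ (Z : 𝔨) (X : 𝔭), (ι.symm ⁅ι (Z, 0), ι (0, X)⁆).1 = 0
  /-- almost-effectiveness -/
  effective : ∀ Z : 𝔨, (∀ X : 𝔭, ⁅ι (Z, 0), ι (0, X)⁆ = 0) → Z = 0

attribute [instance] HomogeneousSpace.group HomogeneousSpace.topology HomogeneousSpace.charted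
  HomogeneousSpace.lieGroup HomogeneousSpace.t2 HomogeneousSpace.simplyConnected
  HomogeneousSpace.chartedQuotient HomogeneousSpace.manifoldQuotient

variable {𝔨 : Type w} [NormedAddCommGroup 𝔨] [NormedSpace ℝ 𝔨] [FiniteDimensional ℝ 𝔨]
  {𝔭 : Type v} [NormedAddCommGroup 𝔭] [NormedSpace ℝ 𝔭] [FiniteDimensional ℝ 𝔭] {r s : ℕ}

namespace HomogeneousSpace

/-- The manifold `G/K`. -/
abbrev Space (H : HomogeneousSpace.{u} 𝔨 𝔭) : Type u := H.G ⧸ H.K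

/-- The origin `o = eK`. -/
abbrev origin (H : HomogeneousSpace.{u} 𝔨 𝔭) : H.Space := ((1 : H.G) : H.G ⧸ H.K)

/-- The Lie bracket of `G`, as a bracket on the vector space `𝔤 = 𝔨 ⊕ 𝔭`. -/
def bracket (H : HomogeneousSpace.{u} 𝔨 𝔭) : (𝔨 × 𝔭) →ₗ[ℝ] (𝔨 × 𝔭) →ₗ[ℝ] (𝔨 × 𝔭) :=
  have : CompleteSpace (𝔨 × 𝔭) := FiniteDimensional.complete ℝ (𝔨 × 𝔭)
  have : LieGroup 𝓘(ℝ, 𝔨 × 𝔭) (minSmoothness ℝ 3) H.G := by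
    rw [minSmoothness_of_isRCLikeNormedField]
    exact LieGroup.of_le (n := ∞) (WithTop.coe_le_coe.2 (le_top : (3 : ℕ∞) ≤ ⊤))
  LinearMap.mk₂ ℝ (fun X Y => H.ι.symm ⁅H.ι X, H.ι Y⁆)
    (fun X X' Y => by rw [map_add, add_lie, map_add])
    (fun c X Y => by rw [map_smul, smul_lie, map_smul])
    (fun X Y Y' => by rw [map_add, lie_add, map_add])
    (fun c X Y => by rw [map_smul, lie_smul, map_smul])

theorem bracket_apply (H : HomogeneousSpace.{u} 𝔨 𝔭) (X Y : 𝔨 × 𝔭) :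
    H.bracket X Y = H.ι.symm ⁅H.ι X, H.ι Y⁆ := rfl

theorem contMDiff_translation (H : HomogeneousSpace.{u} 𝔨 𝔭) (g : H.G) :
    ContMDiff 𝓘(ℝ, 𝔭) 𝓘(ℝ, 𝔭) ∞ (fun p : H.Space => g • p) :=
  H.smooth_smul.comp (contMDiff_const.prodMk contMDiff_id)

/-- Left translation `p ↦ g · p` of `G/K`. -/
def translation (H : HomogeneousSpace.{u} 𝔨 𝔭) (g : H.G) :
    H.Space ≃ₘ^∞⟮𝓘(ℝ, 𝔭), 𝓘(ℝ, 𝔭)⟯ H.Space where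
  toEquiv := MulAction.toPerm g
  contMDiff_toFun := H.contMDiff_translation g
  contMDiff_invFun := H.contMDiff_translation g⁻¹

/-- A tensor field on `G/K` is `G`-invariant. -/
def IsInvariant (H : HomogeneousSpace.{u} 𝔨 𝔭) (δ : TensorField 𝔭 r s H.Space) : Prop :=
  ∀ g : H.G, δ.pullback (H.translation g) = δ

/-- The value at the origin of a tensor field on `G/K`, as a tensor on `𝔭 ≡ T_o(G/K)`. -/
def atOrigin (H : HomogeneousSpace.{u} 𝔨 𝔭) (δ : TensorField 𝔭 r s H.Space) : Tensor r s 𝔭 :=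
  Tensor.pull H.ψ (δ H.origin)

/-- `δ` is the `G`-invariant geometric structure on `G/K` determined by the tensor `γ` on `𝔭`. -/
structure IsInvariantStructure (H : HomogeneousSpace.{u} 𝔨 𝔭) (γ : Tensor r s 𝔭)
    (δ : TensorField 𝔭 r s H.Space) : Prop where
  smooth : δ.IsSmooth
  invariant : H.IsInvariant δ
  atOrigin_eq : H.atOrigin δ = γ

end HomogeneousSpace

variable {γ : Tensor r s 𝔭}

/-- `Q ∈ 𝔮` is the operator of the geometric structure `δ` on `G/K` determined by `γ`, that is,
`θ(Q) γ = q(δ)` on `𝔭 ≡ T_o(G/K)`. -/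
def GeometricFlow.IsOperator (F : GeometricFlow.{u} γ) (𝔮 : Submodule ℝ (𝔭 →L[ℝ] 𝔭))
    (H : HomogeneousSpace.{u} 𝔨 𝔭) (δ : TensorField 𝔭 r s H.Space) (Q : 𝔭 →L[ℝ] 𝔭) : Prop :=
  Q ∈ 𝔮 ∧ theta Q γ = H.atOrigin (F.q H.Space δ)

/-- `μ` belongs to the space of brackets on `𝔤 = 𝔨 ⊕ 𝔭` that define a homogeneous space `G_μ/K_μ`
with an invariant geometric structure `γ_μ` whose value at the origin is `γ`, and `Q = Q_μ`, that
is, `Q ∈ 𝔮` and `θ(Q) γ = q(G_μ/K_μ, γ_μ)`. -/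
def GeometricFlow.IsBracketOperator (F : GeometricFlow.{u} γ) (𝔮 : Submodule ℝ (𝔭 →L[ℝ] 𝔭))
    (μ : (𝔨 × 𝔭) →ₗ[ℝ] (𝔨 × 𝔭) →ₗ[ℝ] (𝔨 × 𝔭)) (Q : 𝔭 →L[ℝ] 𝔭) : Prop :=
  ∃ (H : HomogeneousSpace.{u} 𝔨 𝔭) (δ : TensorField 𝔭 r s H.Space),
    H.bracket = μ ∧ H.IsInvariantStructure γ δ ∧ F.IsOperator 𝔮 H δ Q

/-- `μ(t)`, `t ∈ J`, is a solution of the bracket flow `dμ/dt = δ_μ(diag(0, Q_μ))`. -/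
def GeometricFlow.IsBracketFlow (F : GeometricFlow.{u} γ) (𝔮 : Submodule ℝ (𝔭 →L[ℝ] 𝔭))
    (J : Set ℝ) (μ : ℝ → (𝔨 × 𝔭) →ₗ[ℝ] (𝔨 × 𝔭) →ₗ[ℝ] (𝔨 × 𝔭)) : Prop :=
  ∀ t ∈ J, ∃ Q : 𝔭 →L[ℝ] 𝔭, F.IsBracketOperator 𝔮 (μ t) Q ∧
    ∀ X Y : 𝔨 × 𝔭, HasDerivAt (fun τ => μ τ X Y) (deltaBracket (μ t) (blockP 𝔨 Q) X Y) t

/-- `Φ` is the one-parameter group of automorphisms of the Lie group `G` attached to the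
derivation `D` of its Lie algebra: `d(Φ_t)_e = e^{tD}`. -/
structure IsOneParameterGroup (H : HomogeneousSpace.{u} 𝔨 𝔭) (D : (𝔨 × 𝔭) →L[ℝ] (𝔨 × 𝔭))
    (Φ : ℝ → H.G ≃* H.G) : Prop where
  smooth : ∀ t, ContMDiff 𝓘(ℝ, 𝔨 × 𝔭) 𝓘(ℝ, 𝔨 × 𝔭) ∞ (Φ t)
  add : ∀ t t' g, Φ (t + t') g = Φ t (Φ t' g)
  mfderiv_one : ∀ t X, mfderiv 𝓘(ℝ, 𝔨 × 𝔭) 𝓘(ℝ, 𝔨 × 𝔭) (Φ t) 1 (H.ι X)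
    = H.ι (NormedSpace.exp (t • D) X)

/-- `X` is the vector field `p ↦ d/dt|₀ φ_t(p)` on `G/K`, where `φ_t(gK) = Φ_t(g)K` are the
diffeomorphisms defined by the automorphisms `Φ_t` of `G`, which preserve `K`; moreover, `φ` is
the flow of `X`. -/
def IsAutomorphismField (H : HomogeneousSpace.{u} 𝔨 𝔭) (Φ : ℝ → H.G ≃* H.G)
    (X : ∀ p : H.Space, TangentSpace 𝓘(ℝ, 𝔭) p) : Prop :=
  (∀ t, H.K.map (Φ t).toMonoidHom = H.K) ∧
  ∃ φ : ℝ → H.Space ≃ₘ^∞⟮𝓘(ℝ, 𝔭), 𝓘(ℝ, 𝔭)⟯ H.Space,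
    (∀ t (g : H.G), φ t (g : H.G ⧸ H.K) = (Φ t g : H.G ⧸ H.K)) ∧ IsFlow X φ

/-! ### The explicit solutions -/

/-- `a_{r,s,α} = (s - r)(1 - α)`. -/
def flowConst (r s : ℕ) (α : ℝ) : ℝ := ((s : ℝ) - r) * (1 - α)

/-- `b(t) = (a_{r,s,α} c t + 1)^{1/(1-α)}`, to be read as its limit `e^{(s-r)ct}` for `α = 1`. -/
def scaleFactor (r s : ℕ) (α c t : ℝ) : ℝ :=
  if α = 1 then Real.exp (((s : ℝ) - r) * c * t)
  else (flowConst r s α * c * t + 1) ^ (1 / (1 - α))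

/-- `s(t) = log(a_{r,s,α} c t + 1) / (a_{r,s,α} c)`, to be read as its limit `t` for
`a_{r,s,α} c = 0`. -/
def timeChange (r s : ℕ) (α c t : ℝ) : ℝ :=
  if flowConst r s α * c = 0 then t
  else Real.log (flowConst r s α * c * t + 1) / (flowConst r s α * c)

/-- The time interval `{t : a_{r,s,α} c t + 1 > 0}`, which contains `0`. -/
def flowInterval (r s : ℕ) (α c : ℝ) : Set ℝ := {t | 0 < flowConst r s α * c * t + 1}

end Homogeneous

end BracketFlow

end

/-!
The argument has three ingredients: Lie's second theorem, the effect of rescaling `𝔭`, and the fact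
that an invariant tensor field on `G/K` is determined by its value at the origin.

*The operator `Q_μ`.* Since `q(γ)` is tangent to the `GL(𝔭)`-orbit of `γ`, it has the form `θ(A) γ`,
and the component of `A` in the complement `𝔮` of `g_γ` is the only possible `Q`
(`GeometricFlow.exists_isOperator`, `IsInvariantComplement.theta_injOn`). It depends only on the
bracket `μ` (`GeometricFlow.IsOperator.eq_of_bracket_eq`), because an isomorphism of the brackets of
two homogeneous spaces which respects `𝔨` is induced by a diffeomorphism of the spaces
(`exists_isomorphism`) and `q` is natural. The isomorphism of the groups comes from Lie's second
theorem `exists_monoidHom_mfderiv_eq`: a homomorphism of Lie algebras defines a completely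
integrable system for a map of groups, which has local solutions by the theorem of Frobenius
(`exists_frame_solution`); two solutions differ by a left translation, so the local ones glue over
the simply connected group (`exists_global_section`). The isomorphism preserves the isotropy groups,
since these are connected (`map_mem_of_hasLogDerivAt`).

*The bracket flow.* If `𝔭` is rescaled by `e^τ`, then `[·,·]` becomes `e^τ · [·,·]`, the structure
with value `γ` at the origin is `e^{(s-r)τ}` times the former one, and `Q` is multiplied by
`e^{-aτ}` (`rescale`, `GeometricFlow.IsOperator.rescale`). On the other hand, `c · [·,·]` moves in
the direction of `δ(diag(0, I))` when `c` varies (`hasDerivAt_scaleBracket`). Hence, if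
`Q = cI + D` with a derivation `diag(0, D)`, the curve `e^{c s(t)} · [·,·]` solves the bracket flow
as soon as `s' = e^{-acs}` (`GeometricFlow.IsOperator.isBracketFlow`, `hasDerivAt_timeChange`).
Conversely, differentiating a solution `c(t) · [·,·]` at `t = 0` gives
`δ(diag(0, Q)) = c'(0) δ(diag(0, I))`, so that `diag(0, Q - c'(0) I)` is a derivation
(`GeometricFlow.IsOperator.exists_isDerivation`).

*The geometric flow.* A derivation `diag(0, D)` integrates to automorphisms `Φ_t` of `G` which
preserve `K`, and these induce diffeomorphisms `φ_t` of `G/K` with differential `e^{tD}` at the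
origin (`exists_automorphism_flow`). Smoothness of `φ_t p` in `(t, p)` follows from the theorem of
Frobenius with the parameter `t` included (`exists_local_flow`, `contMDiff_flow`). Pull-backs of
invariant tensor fields by `φ_t` are again invariant, so that all equations between them reduce to
equations on `𝔭` (`exists_frame`, `atOrigin_pullback_flow`). Thus `b(t) φ_{-s(t)}^* γ` has the value
`b(t) e^{s(t)D} · γ` at the origin, and it solves the geometric flow because `b = e^{(s-r)cs}`
(`scaleFactor_eq_exp`, `isSolution_of_flow`); and `ℒ_{X_D} γ` has the value `-θ(D) γ`, which gives
the soliton equation (`isLieDerivative_of_flow`).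
-/

set_option linter.unusedSectionVars false

noncomputable section

namespace BracketFlow

/-! ### Total differential equations -/

section TotalDifferential

open Metric Filter Topology
open scoped NNReal

variable {E : Type*} [NormedAddCommGroup E] [NormedSpace ℝ E]
  {F : Type*} [NormedAddCommGroup F] [NormedSpace ℝ F]

/-- A form of Grönwall's inequality on `[0, 1]` with vanishing initial value. -/
theorem norm_le_of_deriv_le {g g' : ℝ → F} {K ε : ℝ} (hK : 0 < K) (hε : 0 ≤ ε)
    (hg : ∀ t ∈ Icc (0 : ℝ) 1, HasDerivWithinAt g (g' t) (Icc 0 1) t) (h0 : g 0 = 0)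
    (hb : ∀ t ∈ Icc (0 : ℝ) 1, ‖g' t‖ ≤ K * ‖g t‖ + ε) :
    ∀ t ∈ Icc (0 : ℝ) 1, ‖g t‖ ≤ Real.exp K / K * ε := by
  intro t ht
  have h1 := norm_le_gronwallBound_of_norm_deriv_right_le (f := g) (f' := g') (δ := 0) (K := K)
    (ε := ε) (a := 0) (b := 1) (fun t ht => (hg t ht).continuousWithinAt)
    (fun t ht => (hg t ⟨ht.1, ht.2.le⟩).mono_of_mem_nhdsWithin
      (mem_of_superset (Icc_mem_nhdsGE ht.2) (Icc_subset_Icc_left ht.1)))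
    (by simp [h0]) (fun t ht => hb t ⟨ht.1, ht.2.le⟩) t ht
  refine h1.trans ?_
  rw [gronwallBound_of_K_ne_0 hK.ne']
  have h2 : Real.exp (K * (t - 0)) ≤ Real.exp K :=
    Real.exp_le_exp.2 (by nlinarith [ht.1, ht.2])
  calc 0 * Real.exp (K * (t - 0)) + ε / K * (Real.exp (K * (t - 0)) - 1)
      = ε / K * (Real.exp (K * (t - 0)) - 1) := by ring
    _ ≤ ε / K * Real.exp K := by
        apply mul_le_mul_of_nonneg_left _ (by positivity); linarith
    _ = Real.exp K / K * ε := by ring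

/-- First order Taylor estimate for a map with Lipschitz derivative; the constant is not optimal. -/
theorem norm_taylor_le {s : Set E} (hs : Convex ℝ s) {f : E → F} {f' : E → E →L[ℝ] F} {C : ℝ}
    (hf : ∀ z ∈ s, HasFDerivAt f (f' z) z) (hC : 0 ≤ C)
    (hlip : ∀ z ∈ s, ∀ z' ∈ s, ‖f' z - f' z'‖ ≤ C * ‖z - z'‖) {x y : E} (hx : x ∈ s)
    (hy : y ∈ s) : ‖f y - f x - f' x (y - x)‖ ≤ C * ‖y - x‖ ^ 2 := by
  have hseg : segment ℝ x y ⊆ s := hs.segment_subset hx hy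
  have h := (convex_segment x y).norm_image_sub_le_of_norm_hasFDerivWithin_le' (f := f)
    (f' := f') (φ := f' x) (C := C * ‖y - x‖) (fun z hz => (hf z (hseg hz)).hasFDerivWithinAt)
    (fun z hz => ?_) (left_mem_segment ℝ x y) (right_mem_segment ℝ x y)
  · calc _ ≤ _ := h
      _ = _ := by ring
  · refine (hlip z (hseg hz) x hx).trans (mul_le_mul_of_nonneg_left ?_ hC)
    obtain ⟨a, b, ha, hb, hab, rfl⟩ := hz
    have : a • x + b • y - x = b • (y - x) := by
      rw [show a = 1 - b by linarith]; module
    rw [this, norm_smul, Real.norm_of_nonneg hb]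
    exact mul_le_of_le_one_left (norm_nonneg _) (by linarith)

/-- Solutions of a smooth total differential equation are smooth. -/
theorem contDiffAt_of_total_solution {A : E × F → E →L[ℝ] F} {f : E → F} {x₀ : E}
    (hA : ∀ᶠ z in 𝓝 (x₀, f x₀), ContDiffAt ℝ ∞ A z)
    (hf : ∀ᶠ x in 𝓝 x₀, HasFDerivAt f (A (x, f x)) x) :
    ∀ᶠ x in 𝓝 x₀, ContDiffAt ℝ ∞ f x := by
  have hc : ContinuousAt (fun x => (x, f x)) x₀ :=
    continuousAt_id.prodMk hf.self_of_nhds.continuousAt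
  obtain ⟨U, hU, hUo, hxU⟩ := _root_.eventually_nhds_iff.1 ((hc.eventually hA).and hf)
  have hd : DifferentiableOn ℝ f U := fun x hx => (hU x hx).2.differentiableAt.differentiableWithinAt
  have key : ∀ n : ℕ, ContDiffOn ℝ n f U := by
    intro n
    induction n with
    | zero => exact contDiffOn_zero.2 hd.continuousOn
    | succ n ih =>
      rw [Nat.cast_succ, contDiffOn_succ_iff_fderiv_of_isOpen hUo]
      refine ⟨hd, by simp, ?_⟩
      have : ContDiffOn ℝ n (fun x => A (x, f x)) U := by
        intro x hx
        have := ((hU x hx).1.of_le (m := n) (by exact_mod_cast le_top)).comp_contDiffWithinAt x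
          (contDiffWithinAt_id.prodMk (ih x hx))
        exact this
      exact this.congr fun x hx => (hU x hx).2.fderiv
  filter_upwards [hUo.mem_nhds hxU] with x hx
  exact (contDiffOn_infty.2 key).contDiffAt (hUo.mem_nhds hx)

/-- A frame `B` of `E` and a linear family `R` of vector fields on `F` with the same structure
constants `c` give an integrable total differential equation `df (B X) = R X (f)`. -/
theorem integrable_of_frames {S : Type*} [NormedAddCommGroup S] [NormedSpace ℝ S]
    {B : E → S →L[ℝ] E} {ϖ : E → E →L[ℝ] S} {R : F → S →L[ℝ] F} {c : S → S → S} {x : E} {y : F}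
    (hB : DifferentiableAt ℝ B x) (hϖ : DifferentiableAt ℝ ϖ x) (hR : DifferentiableAt ℝ R y)
    (h1 : ∀ᶠ x' in 𝓝 x, ϖ x' ∘L B x' = .id ℝ S) (h2 : B x ∘L ϖ x = .id ℝ E)
    (hcB : ∀ X Y, fderiv ℝ B x (B x X) Y - fderiv ℝ B x (B x Y) X = B x (c X Y))
    (hcR : ∀ X Y, fderiv ℝ R y (R y X) Y - fderiv ℝ R y (R y Y) X = R y (c X Y)) (v w : E) :
    fderiv ℝ (fun z : E × F => R z.2 ∘L ϖ z.1) (x, y) (v, R y (ϖ x v)) w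
      = fderiv ℝ (fun z : E × F => R z.2 ∘L ϖ z.1) (x, y) (w, R y (ϖ x w)) v := by
  have d1 : HasFDerivAt (fun z : E × F => R z.2) (fderiv ℝ R y ∘L .snd ℝ E F) (x, y) :=
    HasFDerivAt.comp (x, y) (g := R) hR.hasFDerivAt hasFDerivAt_snd
  have d2 : HasFDerivAt (fun z : E × F => ϖ z.1) (fderiv ℝ ϖ x ∘L .fst ℝ E F) (x, y) :=
    HasFDerivAt.comp (x, y) (g := ϖ) hϖ.hasFDerivAt hasFDerivAt_fst
  have dA := d1.clm_comp d2
  have fA : ∀ u u' w, fderiv ℝ (fun z : E × F => R z.2 ∘L ϖ z.1) (x, y) (u, u') w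
      = R y (fderiv ℝ ϖ x u w) + fderiv ℝ R y u' (ϖ x w) := by
    intro u u' w
    rw [dA.fderiv]
    simp
  have hϖB : ∀ u Y, fderiv ℝ ϖ x u (B x Y) = - ϖ x (fderiv ℝ B x u Y) := by
    intro u Y
    have d : HasFDerivAt (fun x' => ϖ x' ∘L B x') _ x := hϖ.hasFDerivAt.clm_comp hB.hasFDerivAt
    have d0 : HasFDerivAt (fun x' => ϖ x' ∘L B x') (0 : E →L[ℝ] S →L[ℝ] S) x :=
      (hasFDerivAt_const (ContinuousLinearMap.id ℝ S) x).congr_of_eventuallyEq h1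
    have := congrArg (fun T => T u Y) (d.unique d0)
    simp at this
    exact eq_neg_of_add_eq_zero_right this
  have hs : ∀ u, B x (ϖ x u) = u := fun u => DFunLike.congr_fun h2 u
  have hs' : ∀ X, ϖ x (B x X) = X := fun X => DFunLike.congr_fun h1.self_of_nhds X
  rw [← hs v, ← hs w, fA, fA, hs', hs', hϖB, hϖB, ← sub_eq_zero]
  generalize ϖ x v = X
  generalize ϖ x w = Y
  have e1 := hcR X Y
  have e2 := congrArg (fun u => R y (ϖ x u)) (hcB X Y)
  simp only [map_sub, hs'] at e2
  rw [← e1] at e2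
  simp only [map_neg]
  rw [← sub_eq_zero] at e2
  rw [← neg_eq_zero, ← e2]
  abel

variable [CompleteSpace F]

/-- Solutions of the total differential equation along the rays through `x₀`. -/
theorem exists_radial_solution {A : E × F → E →L[ℝ] F} {x₀ : E} {y₀ : F} {r C : ℝ}
    (hC : 1 ≤ C) (hr : 0 < r)
    (hb : ∀ z ∈ closedBall (x₀, y₀) r, ‖A z‖ ≤ C)
    (hl : ∀ z ∈ closedBall (x₀, y₀) r, ∀ z' ∈ closedBall (x₀, y₀) r,
      ‖A z - A z'‖ ≤ C * ‖z - z'‖)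
    {h : E} (hh : ‖h‖ ≤ r) (hh1 : ‖h‖ ≤ 1) (hh' : C * ‖h‖ ≤ r) :
    ∃ β : ℝ → F, β 0 = y₀ ∧ ∀ t ∈ Icc (0 : ℝ) 1, β t ∈ closedBall y₀ r ∧
      HasDerivWithinAt β (A (x₀ + t • h, β t) h) (Icc 0 1) t := by
  have hmem : ∀ t ∈ Icc (0 : ℝ) 1, ∀ y ∈ closedBall y₀ r,
      (x₀ + t • h, y) ∈ closedBall (x₀, y₀) r := by
    intro t ht y hy
    rw [mem_closedBall, Prod.dist_eq, max_le_iff]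
    refine ⟨?_, hy⟩
    simp only [dist_eq_norm, add_sub_cancel_left, norm_smul, Real.norm_of_nonneg ht.1]
    exact (mul_le_of_le_one_left (norm_nonneg _) ht.2).trans hh
  have hC0 : 0 ≤ C := by linarith
  have hf : IsPicardLindelof (fun (t : ℝ) y => A (x₀ + t • h, y) h)
      (⟨0, by simp⟩ : Icc (0 : ℝ) 1) y₀ r.toNNReal 0 r.toNNReal C.toNNReal := by
    constructor
    · intro t ht
      rw [Real.coe_toNNReal _ hr.le]
      refine LipschitzOnWith.of_dist_le_mul fun y hy y' hy' => ?_
      rw [Real.coe_toNNReal _ hC0, dist_eq_norm, dist_eq_norm, ← sub_apply]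
      refine (ContinuousLinearMap.le_opNorm _ _).trans ?_
      refine (mul_le_mul_of_nonneg_right (hl _ (hmem t ht y hy) _ (hmem t ht y' hy'))
        (norm_nonneg _)).trans ?_
      have : ‖((x₀ + t • h, y) : E × F) - (x₀ + t • h, y')‖ = ‖y - y'‖ := by simp [Prod.norm_def]
      rw [this]
      exact mul_le_of_le_one_right (by positivity) hh1
    · intro y hy
      rw [Real.coe_toNNReal _ hr.le] at hy
      have hcA : ContinuousOn A (closedBall (x₀, y₀) r) := by
        refine LipschitzOnWith.continuousOn (K := C.toNNReal) ?_
        refine LipschitzOnWith.of_dist_le_mul fun z hz z' hz' => ?_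
        rw [Real.coe_toNNReal _ hC0, dist_eq_norm, dist_eq_norm]
        exact hl z hz z' hz'
      have : ContinuousOn (fun t : ℝ => A (x₀ + t • h, y)) (Icc 0 1) :=
        hcA.comp (by fun_prop) (fun t ht => hmem t ht y hy)
      exact this.clm_apply continuousOn_const
    · intro t ht y hy
      rw [Real.coe_toNNReal _ hr.le] at hy ⊢
      refine (ContinuousLinearMap.le_opNorm _ _).trans (le_trans ?_ hh')
      exact mul_le_mul_of_nonneg_right (hb _ (hmem t ht y hy)) (norm_nonneg _)
    · simp
  have hy₀ : y₀ ∈ closedBall y₀ ((0 : ℝ≥0) : ℝ) := by simp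
  obtain ⟨α, hα⟩ := ODE.FunSpace.exists_isFixedPt_next hf hy₀
  refine ⟨α.compProj, ?_, fun t ht => ⟨?_, ?_⟩⟩
  · have := ODE.FunSpace.next_apply₀ hf hy₀ α
    rw [hα] at this
    exact ODE.FunSpace.compProj_val.trans this
  · have := α.compProj_mem_closedBall hf.mul_max_le (t := t)
    rwa [Real.coe_toNNReal _ hr.le] at this
  · apply ODE.hasDerivWithinAt_picard_Icc (by simp : (0 : ℝ) ∈ Icc (0 : ℝ) 1)
      hf.continuousOn_uncurry
      α.continuous_compProj.continuousOn (fun _ ht' ↦ α.compProj_mem_closedBall hf.mul_max_le)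
      y₀ ht |>.congr_of_mem _ ht
    intro t' ht'
    nth_rw 1 [← hα]
    rw [ODE.FunSpace.compProj_of_mem ht', ODE.FunSpace.next_apply]

/-- The Frobenius theorem for a total differential equation `df = A(x, f(x))`, with explicit
bounds. The value `f(x)` is found by solving the equation along the ray from `x₀` to `x`. For two
neighbouring rays with solutions `β` and `β'`, integrability makes
`g(t) = β'(t) - β(t) - t A(·, β(t)) k` satisfy a linear differential inequality whose inhomogeneous
term is quadratic in `k`, so that `f` is differentiable with the required derivative. -/
theorem exists_total_solution_of_bounds {A : E × F → E →L[ℝ] F}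
    {A' : E × F → E × F →L[ℝ] E →L[ℝ] F} {x₀ : E} {y₀ : F} {r C : ℝ}
    (hC : 1 ≤ C) (hr : 0 < r)
    (hb : ∀ z ∈ closedBall (x₀, y₀) r, ‖A z‖ ≤ C)
    (hA : ∀ z ∈ closedBall (x₀, y₀) r, HasFDerivAt A (A' z) z)
    (hb' : ∀ z ∈ closedBall (x₀, y₀) r, ‖A' z‖ ≤ C)
    (hl' : ∀ z ∈ closedBall (x₀, y₀) r, ∀ z' ∈ closedBall (x₀, y₀) r,
      ‖A' z - A' z'‖ ≤ C * ‖z - z'‖)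
    (hint : ∀ z ∈ closedBall (x₀, y₀) r, ∀ v w, A' z (v, A z v) w = A' z (w, A z w) v) :
    ∃ f : E → F, f x₀ = y₀ ∧ ∀ᶠ x in 𝓝 x₀, HasFDerivAt f (A (x, f x)) x := by
  have hC0 : 0 < C := by linarith
  have hconv : Convex ℝ (closedBall (x₀, y₀) r) := convex_closedBall _ _
  have hl : ∀ z ∈ closedBall (x₀, y₀) r, ∀ z' ∈ closedBall (x₀, y₀) r,
      ‖A z - A z'‖ ≤ C * ‖z - z'‖ := fun z hz z' hz' =>
    hconv.norm_image_sub_le_of_norm_hasFDerivWithin_le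
      (fun x hx => (hA x hx).hasFDerivWithinAt) hb' hz' hz
  obtain ⟨ρ, hρ, hρ1, hρr, hρC⟩ : ∃ ρ : ℝ, 0 < ρ ∧ ρ ≤ 1 ∧ ρ ≤ r ∧ C * ρ ≤ r := by
    refine ⟨min 1 (r / C), by positivity, min_le_left _ _, ?_, ?_⟩
    · exact (min_le_right _ _).trans (div_le_self hr.le hC)
    · calc C * min 1 (r / C) ≤ C * (r / C) :=
            mul_le_mul_of_nonneg_left (min_le_right _ _) hC0.le
        _ = r := by field_simp
  have key : ∀ h : E, ∃ β : ℝ → F, ‖h‖ ≤ ρ → (β 0 = y₀ ∧ ∀ t ∈ Icc (0 : ℝ) 1,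
      β t ∈ closedBall y₀ r ∧ HasDerivWithinAt β (A (x₀ + t • h, β t) h) (Icc 0 1) t) := by
    intro h
    by_cases hh : ‖h‖ ≤ ρ
    · obtain ⟨β, hβ⟩ := exists_radial_solution hC hr hb hl (h := h) (hh.trans hρr)
        (hh.trans hρ1) ((mul_le_mul_of_nonneg_left hh hC0.le).trans hρC)
      exact ⟨β, fun _ => hβ⟩
    · exact ⟨0, fun h' => absurd h' hh⟩
  choose β hβ using key
  have hmem : ∀ h : E, ‖h‖ ≤ ρ → ∀ t ∈ Icc (0 : ℝ) 1,
      (x₀ + t • h, β h t) ∈ closedBall (x₀, y₀) r := by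
    intro h hh t ht
    rw [mem_closedBall, Prod.dist_eq, max_le_iff]
    refine ⟨?_, ((hβ h hh).2 t ht).1⟩
    simp only [dist_eq_norm, add_sub_cancel_left, norm_smul, Real.norm_of_nonneg ht.1]
    exact (mul_le_of_le_one_left (norm_nonneg _) ht.2).trans (hh.trans hρr)
  set M : ℝ := Real.exp C / C with hM
  have hM0 : 0 < M := by positivity
  set N : ℝ := 1 + M * (2 * C) with hN
  have hN0 : 0 < N := by positivity
  have est1 : ∀ h k : E, ‖h‖ ≤ ρ → ‖h + k‖ ≤ ρ → ∀ t ∈ Icc (0 : ℝ) 1,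
      ‖((x₀ + t • (h + k), β (h + k) t) : E × F) - (x₀ + t • h, β h t)‖ ≤ N * ‖k‖ := by
    intro h k hh hk
    have hz : ∀ t ∈ Icc (0 : ℝ) 1,
        ‖((x₀ + t • (h + k), β (h + k) t) : E × F) - (x₀ + t • h, β h t)‖
          ≤ ‖k‖ + ‖β (h + k) t - β h t‖ := by
      intro t ht
      have : x₀ + t • (h + k) - (x₀ + t • h) = t • k := by module
      rw [Prod.mk_sub_mk, this, Prod.norm_mk, norm_smul, Real.norm_of_nonneg ht.1]
      have h1 : t * ‖k‖ ≤ ‖k‖ := mul_le_of_le_one_left (norm_nonneg _) ht.2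
      exact max_le (by linarith [norm_nonneg (β (h + k) t - β h t)])
        (by linarith [norm_nonneg k])
    have hu := norm_le_of_deriv_le (g := fun t => β (h + k) t - β h t)
      (g' := fun t => A (x₀ + t • (h + k), β (h + k) t) (h + k) - A (x₀ + t • h, β h t) h)
      (K := C) (ε := 2 * C * ‖k‖) hC0 (by positivity)
      (fun t ht => ((hβ _ hk).2 t ht).2.sub ((hβ _ hh).2 t ht).2)
      (by simp [(hβ _ hk).1, (hβ _ hh).1]) (by
        intro t ht
        set z₁ : E × F := (x₀ + t • h, β h t)
        set z₂ : E × F := (x₀ + t • (h + k), β (h + k) t)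
        have e : A z₂ (h + k) - A z₁ h = (A z₂ - A z₁) (h + k) + A z₁ k := by
          simp only [map_add, sub_apply]; abel
        rw [e]
        have n1 : ‖(A z₂ - A z₁) (h + k)‖ ≤ C * (‖k‖ + ‖β (h + k) t - β h t‖) := by
          refine (ContinuousLinearMap.le_opNorm _ _).trans ?_
          refine (mul_le_of_le_one_right (norm_nonneg _) (hk.trans hρ1)).trans ?_
          refine (hl _ (hmem _ hk t ht) _ (hmem _ hh t ht)).trans ?_
          exact mul_le_mul_of_nonneg_left (hz t ht) hC0.le
        have n2 : ‖A z₁ k‖ ≤ C * ‖k‖ := (ContinuousLinearMap.le_opNorm _ _).trans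
          (mul_le_mul_of_nonneg_right (hb _ (hmem _ hh t ht)) (norm_nonneg _))
        refine (norm_add_le _ _).trans ?_
        linarith)
    intro t ht
    have hu' : ‖β (h + k) t - β h t‖ ≤ M * (2 * C * ‖k‖) := hu t ht
    have := hz t ht
    rw [hN]
    calc _ ≤ _ := this
      _ ≤ ‖k‖ + M * (2 * C * ‖k‖) := by gcongr
      _ = _ := by ring
  have est2 : ∀ h k : E, ‖h‖ ≤ ρ → ‖h + k‖ ≤ ρ →
      ‖β (h + k) 1 - β h 1 - A (x₀ + h, β h 1) k‖
        ≤ M * (C * N ^ 2 + C * N) * ‖k‖ ^ 2 := by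
    intro h k hh hk
    have hg := norm_le_of_deriv_le
      (g := fun t => β (h + k) t - β h t - t • A (x₀ + t • h, β h t) k)
      (g' := fun t => A (x₀ + t • (h + k), β (h + k) t) (h + k) - A (x₀ + t • h, β h t) h
        - (t • A' (x₀ + t • h, β h t) (h, A (x₀ + t • h, β h t) h) k
          + (1 : ℝ) • A (x₀ + t • h, β h t) k))
      (K := C) (ε := (C * N ^ 2 + C * N) * ‖k‖ ^ 2) hC0 (by positivity)
      (fun t ht => by
        refine (((hβ _ hk).2 t ht).2.sub ((hβ _ hh).2 t ht).2).sub ?_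
        refine (hasDerivWithinAt_id t _).smul ?_
        have d1 : HasDerivWithinAt (fun t : ℝ => (x₀ + t • h, β h t))
            (h, A (x₀ + t • h, β h t) h) (Icc 0 1) t := by
          refine HasDerivWithinAt.prodMk ?_ ((hβ _ hh).2 t ht).2
          simpa using ((hasDerivWithinAt_id t (Icc (0 : ℝ) 1)).smul_const h).const_add x₀
        have d2 := (hA _ (hmem _ hh t ht)).comp_hasDerivWithinAt t d1
        simpa using d2.clm_apply (hasDerivWithinAt_const t (Icc (0 : ℝ) 1) k))
      (by simp [(hβ _ hk).1, (hβ _ hh).1]) (by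
        intro t ht
        have e1 := est1 h k hh hk t ht
        have m1 := hmem _ hh t ht
        have m2 := hmem _ hk t ht
        set y₁ := β h t
        set y₂ := β (h + k) t
        set z₁ : E × F := (x₀ + t • h, y₁)
        set z₂ : E × F := (x₀ + t • (h + k), y₂)
        have hdz : z₂ - z₁ = (t • k, y₂ - y₁) := by
          simp only [z₁, z₂, Prod.mk_sub_mk]; congr 1; module
        have split : A z₂ (h + k) - A z₁ h - (t • A' z₁ (h, A z₁ h) k + (1 : ℝ) • A z₁ k)
            = (A z₂ - A z₁ - A' z₁ (z₂ - z₁)) (h + k) + A' z₁ (z₂ - z₁) k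
              + A' z₁ (0, y₂ - y₁ - t • A z₁ k) h := by
          have s1 : A' z₁ (0, y₂ - y₁ - t • A z₁ k) = A' z₁ (z₂ - z₁) - t • A' z₁ (k, A z₁ k) := by
            rw [← (A' z₁).map_smul, ← (A' z₁).map_sub, hdz]
            congr 1
            ext <;> simp
          rw [s1, hint z₁ m1 h k]
          simp only [map_add, sub_apply, smul_apply, one_smul]
          abel
        rw [split]
        have n1 : ‖(A z₂ - A z₁ - A' z₁ (z₂ - z₁)) (h + k)‖ ≤ C * N ^ 2 * ‖k‖ ^ 2 := by
          refine (ContinuousLinearMap.le_opNorm _ _).trans ?_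
          refine (mul_le_of_le_one_right (norm_nonneg _) (hk.trans hρ1)).trans ?_
          refine (norm_taylor_le hconv hA hC0.le hl' m1 m2).trans ?_
          calc C * ‖z₂ - z₁‖ ^ 2 ≤ C * (N * ‖k‖) ^ 2 := by gcongr
            _ = C * N ^ 2 * ‖k‖ ^ 2 := by ring
        have n2 : ‖A' z₁ (z₂ - z₁) k‖ ≤ C * N * ‖k‖ ^ 2 := by
          refine (ContinuousLinearMap.le_opNorm₂ _ _ _).trans ?_
          calc ‖A' z₁‖ * ‖z₂ - z₁‖ * ‖k‖ ≤ C * (N * ‖k‖) * ‖k‖ := by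
                gcongr; exact hb' _ m1
            _ = C * N * ‖k‖ ^ 2 := by ring
        have n3 : ‖A' z₁ (0, y₂ - y₁ - t • A z₁ k) h‖ ≤ C * ‖y₂ - y₁ - t • A z₁ k‖ := by
          refine (ContinuousLinearMap.le_opNorm₂ _ _ _).trans ?_
          refine (mul_le_of_le_one_right (by positivity) (hh.trans hρ1)).trans ?_
          have : ‖((0, y₂ - y₁ - t • A z₁ k) : E × F)‖ = ‖y₂ - y₁ - t • A z₁ k‖ := by
            simp [Prod.norm_mk]
          rw [this]
          exact mul_le_mul_of_nonneg_right (hb' _ m1) (norm_nonneg _)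
        refine (norm_add₃_le).trans ?_
        linarith)
    have := hg 1 (by simp)
    simp only [one_smul] at this
    rw [hM]
    linarith
  refine ⟨fun x => β (x - x₀) 1, ?_, ?_⟩
  · have e := norm_le_of_deriv_le (g := fun t => β 0 t - y₀)
      (g' := fun t => A (x₀ + t • (0 : E), β 0 t) 0) (K := 1) (ε := 0) one_pos le_rfl
      (fun t ht => ((hβ 0 (by simpa using hρ.le)).2 t ht).2.sub_const y₀)
      (by simp [(hβ 0 (by simpa using hρ.le)).1]) (by simp) 1 (by simp)
    simpa [sub_eq_zero] using e
  · filter_upwards [ball_mem_nhds x₀ hρ] with x hx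
    have hxρ : ‖x - x₀‖ < ρ := by rwa [mem_ball, dist_eq_norm] at hx
    rw [hasFDerivAt_iff_isLittleO_nhds_zero]
    refine Asymptotics.IsBigO.trans_isLittleO (g := fun k : E => ‖k‖ ^ 2) ?_ ?_
    · refine Asymptotics.IsBigO.of_bound (M * (C * N ^ 2 + C * N)) ?_
      have : ∀ᶠ k in 𝓝 (0 : E), ‖x - x₀ + k‖ < ρ := by
        have hc : Continuous fun k : E => ‖x - x₀ + k‖ := by fun_prop
        exact hc.continuousAt.eventually_lt continuousAt_const (by simpa using hxρ)
      filter_upwards [this] with k hk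
      have := est2 (x - x₀) k hxρ.le hk.le
      rw [show x - x₀ + k = x + k - x₀ by abel, add_sub_cancel] at this
      simpa using this
    · have : (fun k : E => ‖k‖ ^ 2) =o[𝓝 0] fun k : E => ‖k‖ ^ 1 :=
        Asymptotics.isLittleO_norm_pow_norm_pow one_lt_two
      simp only [pow_one] at this
      exact this.of_norm_right

/-- The Frobenius theorem for a total differential equation `df = A(x, f(x))`. -/
theorem exists_total_solution {A : E × F → E →L[ℝ] F} {x₀ : E} {y₀ : F}
    (hA : ContDiffAt ℝ 2 A (x₀, y₀))
    (hint : ∀ᶠ z in 𝓝 (x₀, y₀), ∀ v w, fderiv ℝ A z (v, A z v) w = fderiv ℝ A z (w, A z w) v) :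
    ∃ f : E → F, f x₀ = y₀ ∧ ∀ᶠ x in 𝓝 x₀, HasFDerivAt f (A (x, f x)) x := by
  have h1 : ContDiffAt ℝ 1 (fderiv ℝ A) (x₀, y₀) := hA.fderiv_right (by norm_num)
  obtain ⟨K, t, ht, hK⟩ := h1.exists_lipschitzOnWith
  have hd : ∀ᶠ z in 𝓝 (x₀, y₀), HasFDerivAt A (fderiv ℝ A z) z := by
    filter_upwards [hA.eventually (by norm_num)] with z hz
    exact (hz.differentiableAt (by norm_num)).hasFDerivAt
  have hb : ∀ᶠ z in 𝓝 (x₀, y₀), ‖A z‖ < ‖A (x₀, y₀)‖ + 1 :=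
    hA.continuousAt.norm.eventually_lt continuousAt_const (lt_add_one _)
  have hcn : ContinuousAt (fun z => ‖fderiv ℝ A z‖) (x₀, y₀) :=
    (continuous_norm (E := E × F →L[ℝ] E →L[ℝ] F)).continuousAt.comp h1.continuousAt
  have hb' : ∀ᶠ z in 𝓝 (x₀, y₀), ‖fderiv ℝ A z‖ < ‖fderiv ℝ A (x₀, y₀)‖ + 1 :=
    hcn.eventually_lt continuousAt_const (lt_add_one _)
  obtain ⟨r, hr, H⟩ := Metric.nhds_basis_closedBall.mem_iff.1
    ((((hint.and hd).and hb).and hb').and (show ∀ᶠ z in 𝓝 (x₀, y₀), z ∈ t from ht))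
  set C : ℝ := 1 + (‖A (x₀, y₀)‖ + 1) + (‖fderiv ℝ A (x₀, y₀)‖ + 1) + K with hC
  have hK0 : (0 : ℝ) ≤ K := K.2
  have p1 := norm_nonneg (A (x₀, y₀))
  have p2 := norm_nonneg (fderiv ℝ A (x₀, y₀))
  refine exists_total_solution_of_bounds (C := C) (r := r) (A' := fderiv ℝ A) (by linarith) hr
    (fun z hz => ?_) (fun z hz => (H hz).1.1.1.2) (fun z hz => ?_) (fun z hz z' hz' => ?_)
    (fun z hz => (H hz).1.1.1.1)
  · linarith [(H hz).1.1.2]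
  · linarith [(H hz).1.2]
  · have := hK.dist_le_mul z (H hz).2 z' (H hz').2
    rw [dist_eq_norm, dist_eq_norm] at this
    exact this.trans (mul_le_mul_of_nonneg_right (by linarith) (norm_nonneg _))

/-- The Frobenius theorem in the form used here: a frame `B` of `E` and a linear family `R` of
vector fields on `F` with the same structure constants. -/
theorem exists_frame_solution [CompleteSpace E]
    {S : Type*} [NormedAddCommGroup S] [NormedSpace ℝ S] [CompleteSpace S]
    {B : E → S →L[ℝ] E} {R : F → S →L[ℝ] F} {c : S → S → S} {x₀ : E} {y₀ : F}
    (hB : ∀ᶠ x in 𝓝 x₀, ContDiffAt ℝ ∞ B x) (hR : ∀ᶠ y in 𝓝 y₀, ContDiffAt ℝ ∞ R y)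
    (hi : (B x₀).IsInvertible)
    (hcB : ∀ᶠ x in 𝓝 x₀, ∀ X Y,
      fderiv ℝ B x (B x X) Y - fderiv ℝ B x (B x Y) X = B x (c X Y))
    (hcR : ∀ᶠ y in 𝓝 y₀, ∀ X Y,
      fderiv ℝ R y (R y X) Y - fderiv ℝ R y (R y Y) X = R y (c X Y)) :
    ∃ f : E → F, f x₀ = y₀ ∧ ∀ᶠ x in 𝓝 x₀, ContDiffAt ℝ ∞ f x ∧ (B x).IsInvertible ∧
      ∀ X, fderiv ℝ f x (B x X) = R (f x) X := by
  have hinv : ∀ᶠ x in 𝓝 x₀, (B x).IsInvertible := by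
    obtain ⟨e, he⟩ := hi
    have : Set.range ((↑) : (S ≃L[ℝ] E) → S →L[ℝ] E) ∈ 𝓝 (B x₀) := by
      rw [← he]; exact ContinuousLinearEquiv.nhds e
    filter_upwards [hB.self_of_nhds.continuousAt this] with x hx
    obtain ⟨e, he⟩ := hx
    exact ⟨e, he⟩
  set ϖ : E → E →L[ℝ] S := fun x => (B x).inverse with hϖ
  have hϖB : ∀ x, (B x).IsInvertible → ϖ x ∘L B x = .id ℝ S := fun x hx => hx.inverse_comp_self
  have hBϖ : ∀ x, (B x).IsInvertible → B x ∘L ϖ x = .id ℝ E := fun x hx => hx.self_comp_inverse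
  have hϖd : ∀ᶠ x in 𝓝 x₀, ContDiffAt ℝ ∞ ϖ x := by
    filter_upwards [hinv, hB] with x hx hBx
    obtain ⟨e, he⟩ := hx
    have h := contDiffAt_map_inverse (𝕜 := ℝ) (n := ∞) e
    rw [he] at h
    exact h.comp x hBx
  set A : E × F → E →L[ℝ] F := fun z => R z.2 ∘L ϖ z.1 with hA
  have hAd : ∀ᶠ z in 𝓝 (x₀, y₀), ContDiffAt ℝ ∞ A z := by
    rw [nhds_prod_eq]
    filter_upwards [hϖd.prod_mk hR] with z hz
    exact (hz.2.comp z contDiffAt_snd).clm_comp (hz.1.comp z contDiffAt_fst)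
  have hint : ∀ᶠ z in 𝓝 (x₀, y₀), ∀ v w,
      fderiv ℝ A z (v, A z v) w = fderiv ℝ A z (w, A z w) v := by
    rw [nhds_prod_eq]
    filter_upwards [(((hB.and hϖd).and (hinv.eventually_nhds.and hcB))).prod_mk (hR.and hcR)]
      with z hz v w
    exact integrable_of_frames (c := c) (hz.1.1.1.differentiableAt (by simp))
      (hz.1.1.2.differentiableAt (by simp)) (hz.2.1.differentiableAt (by simp))
      (hz.1.2.1.mono fun x hx => hϖB x hx) (hBϖ _ hz.1.2.1.self_of_nhds) hz.1.2.2 hz.2.2 v w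
  obtain ⟨f, hf0, hf⟩ := exists_total_solution
    (hAd.self_of_nhds.of_le (WithTop.coe_le_coe.2 (le_top : (2 : ℕ∞) ≤ ⊤))) hint
  have hfs := contDiffAt_of_total_solution (by rwa [hf0]) hf
  refine ⟨f, hf0, ?_⟩
  filter_upwards [hf, hfs, hinv] with x h1 h2 h3
  refine ⟨h2, h3, fun X => ?_⟩
  rw [h1.fderiv]
  exact congrArg (R (f x)) (DFunLike.congr_fun (hϖB x h3) X)

end TotalDifferential

/-! ### Lie groups in the chart at the identity -/

section ChartFrame

open Filter Topology VectorField

variable {E : Type*} [NormedAddCommGroup E] [NormedSpace ℝ E]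
  {G : Type*} [TopologicalSpace G] [ChartedSpace E G] [Group G]
  {S : Type*} [NormedAddCommGroup S] [NormedSpace ℝ S]

variable (E G) in
/-- The preferred chart of a Lie group at the identity. -/
abbrev idChart : PartialEquiv G E := extChartAt 𝓘(ℝ, E) (1 : G)

/-- The multiplication of a Lie group in the preferred chart at the identity. -/
def chartMul (G : Type*) [TopologicalSpace G] [ChartedSpace E G] [Group G] (z : E × E) : E :=
  idChart E G ((idChart E G).symm z.1 * (idChart E G).symm z.2)

/-- The left invariant vector fields in the preferred chart at the identity. The Lie algebra is
parametrized by a linear isomorphism `ι`. -/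
def chartFrame (ι : S ≃L[ℝ] GroupLieAlgebra 𝓘(ℝ, E) G) (x : E) : S →L[ℝ] E :=
  (fderiv ℝ (chartMul G) (x, idChart E G 1) ∘L .inr ℝ E E) ∘L
    (show S →L[ℝ] E from (ι : S →L[ℝ] GroupLieAlgebra 𝓘(ℝ, E) G))

variable [LieGroup 𝓘(ℝ, E) ∞ G] (ι : S ≃L[ℝ] GroupLieAlgebra 𝓘(ℝ, E) G)

theorem contMDiffAt_idChart {g : G} (hg : g ∈ (idChart E G).source) :
    ContMDiffAt 𝓘(ℝ, E) 𝓘(ℝ, E) ∞ (idChart E G) g :=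
  contMDiffAt_extChartAt' (by simpa using hg)

theorem contMDiffAt_idChart_symm {x : E} (hx : x ∈ (idChart E G).target) :
    ContMDiffAt 𝓘(ℝ, E) 𝓘(ℝ, E) ∞ (idChart E G).symm x :=
  (contMDiffOn_extChartAt_symm (1 : G)).contMDiffAt ((isOpen_extChartAt_target (1 : G)).mem_nhds hx)

theorem contDiffAt_chartMul {x : E} (hx : x ∈ (idChart E G).target) :
    ContDiffAt ℝ ∞ (chartMul G) (x, idChart E G 1) := by
  rw [← contMDiffAt_iff_contDiffAt]
  have h1 : (idChart E G).symm (idChart E G 1) = 1 := extChartAt_to_inv (I := 𝓘(ℝ, E)) (1 : G)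
  have hm : ContMDiffAt 𝓘(ℝ, E × E) 𝓘(ℝ, E) ∞
      (fun z : E × E => (idChart E G).symm z.1 * (idChart E G).symm z.2) (x, idChart E G 1) := by
    refine ContMDiffAt.mul ?_ ?_
    · exact ContMDiffAt.comp (x, idChart E G 1) (contMDiffAt_idChart_symm hx)
        contDiffAt_fst.contMDiffAt
    · exact ContMDiffAt.comp (x, idChart E G 1)
        (contMDiffAt_idChart_symm (mem_extChartAt_target (1 : G))) contDiffAt_snd.contMDiffAt
  refine ContMDiffAt.comp (x, idChart E G 1) (contMDiffAt_idChart ?_) hm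
  simp only [h1, mul_one]
  exact (idChart E G).map_target hx

theorem contDiffAt_chartFrame {x : E} (hx : x ∈ (idChart E G).target) :
    ContDiffAt ℝ ∞ (chartFrame ι) x := by
  have h1 : ContDiffAt ℝ ∞ (fderiv ℝ (chartMul G)) (x, idChart E G 1) :=
    (contDiffAt_chartMul hx).fderiv_right (by simp)
  have h2 : ContDiffAt ℝ ∞ (fun x : E => fderiv ℝ (chartMul G) (x, idChart E G 1)) x :=
    ContDiffAt.comp x h1 (contDiffAt_id.prodMk contDiffAt_const)
  exact (h2.clm_comp contDiffAt_const).clm_comp contDiffAt_const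

theorem mfderiv_idChart_mulInvariantVectorField {x : E} (hx : x ∈ (idChart E G).target) (X : S) :
    mfderiv 𝓘(ℝ, E) 𝓘(ℝ, E) (idChart E G) ((idChart E G).symm x)
      (mulInvariantVectorField (ι X) ((idChart E G).symm x)) = chartFrame ι x X := by
  set g := (idChart E G).symm x with hg
  have hgs : g ∈ (idChart E G).source := (idChart E G).map_target hx
  have hL : MDifferentiableAt 𝓘(ℝ, E) 𝓘(ℝ, E) (fun h : G => g * h) 1 :=
    (contMDiff_mul_left (I := 𝓘(ℝ, E)) (n := ∞) (a := g)).contMDiffAt.mdifferentiableAt (by simp)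
  have hc : MDifferentiableAt 𝓘(ℝ, E) 𝓘(ℝ, E) (idChart E G) g :=
    (contMDiffAt_idChart hgs).mdifferentiableAt (by simp)
  have hm : DifferentiableAt ℝ (fun y => chartMul G (x, y)) (idChart E G 1) :=
    ((contDiffAt_chartMul hx).differentiableAt (by simp)).comp _
      ((differentiableAt_const x).prodMk differentiableAt_id)
  have e1 : mfderiv 𝓘(ℝ, E) 𝓘(ℝ, E) (idChart E G ∘ fun h : G => g * h) 1 (ι X)
      = mfderiv 𝓘(ℝ, E) 𝓘(ℝ, E) (idChart E G) g (mulInvariantVectorField (ι X) g) :=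
    mfderiv_comp_apply_of_eq (x := (1 : G)) (I' := 𝓘(ℝ, E)) (y := g) hc hL (mul_one g) (ι X)
  have e2 : mfderiv 𝓘(ℝ, E) 𝓘(ℝ, E) ((fun y => chartMul G (x, y)) ∘ idChart E G) 1 (ι X)
      = fderiv ℝ (fun y => chartMul G (x, y)) (idChart E G 1) (ι X) := by
    rw [mfderiv_comp_apply (x := (1 : G)) (I' := 𝓘(ℝ, E)) hm.mdifferentiableAt
      ((contMDiffAt_idChart (mem_extChartAt_source (1 : G))).mdifferentiableAt (by simp)),
      mfderiv_extChartAt_self, mfderiv_eq_fderiv]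
    rfl
  have e3 : ((fun y => chartMul G (x, y)) ∘ idChart E G) =ᶠ[𝓝 1] idChart E G ∘ fun h : G => g * h := by
    filter_upwards [extChartAt_source_mem_nhds (I := 𝓘(ℝ, E)) (1 : G)] with h hh
    simp only [comp_apply, chartMul]
    rw [(idChart E G).left_inv hh]
  have e4 : fderiv ℝ (fun y => chartMul G (x, y)) (idChart E G 1)
      = fderiv ℝ (chartMul G) (x, idChart E G 1) ∘L .inr ℝ E E := by
    refine HasFDerivAt.fderiv ?_
    exact HasFDerivAt.comp (idChart E G 1) ((contDiffAt_chartMul hx).differentiableAt (by simp)).hasFDerivAt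
      (hasFDerivAt_prodMk_right x (idChart E G 1))
  have e5 : mfderiv 𝓘(ℝ, E) 𝓘(ℝ, E) (idChart E G ∘ fun h : G => g * h) 1 (ι X)
      = mfderiv 𝓘(ℝ, E) 𝓘(ℝ, E) ((fun y => chartMul G (x, y)) ∘ idChart E G) 1 (ι X) :=
    congrArg (fun T : E →L[ℝ] E => T (ι X)) e3.mfderiv_eq.symm
  exact e1.symm.trans (e5.trans (e2.trans (DFunLike.congr_fun e4 (ι X))))

theorem mfderiv_idChart_symm_chartFrame {x : E} (hx : x ∈ (idChart E G).target) (X : S) :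
    mfderiv 𝓘(ℝ, E) 𝓘(ℝ, E) (idChart E G).symm x (chartFrame ι x X)
      = mulInvariantVectorField (ι X) ((idChart E G).symm x) := by
  rw [← mfderiv_idChart_mulInvariantVectorField ι hx X]
  have h := mfderivWithin_extChartAt_symm_comp_mfderiv_extChartAt (I := 𝓘(ℝ, E)) (x := (1 : G)) hx
  simp only [modelWithCornersSelf_coe, range_id, mfderivWithin_univ] at h
  exact DFunLike.congr_fun h _

theorem mlieBracket_apply_eq_lieBracket (V W : ∀ x : E, TangentSpace 𝓘(ℝ, E) x) (x : E) :
    mlieBracket 𝓘(ℝ, E) V W x = lieBracket ℝ V W x := by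
  rw [← mlieBracketWithin_univ, mlieBracketWithin_eq_lieBracketWithin]
  exact congrFun (lieBracketWithin_univ (𝕜 := ℝ) (V := fun x => (V x : E)) (W := fun x => (W x : E))) x

/-- A left invariant vector field with a zero vanishes. -/
theorem mulInvariantVectorField_injective {v : GroupLieAlgebra 𝓘(ℝ, E) G} {g : G}
    (h : mulInvariantVectorField v g = 0) : v = 0 := by
  have e : mfderiv 𝓘(ℝ, E) 𝓘(ℝ, E) ((fun h : G => g⁻¹ * h) ∘ fun h : G => g * h) 1 v
      = mfderiv 𝓘(ℝ, E) 𝓘(ℝ, E) (fun h : G => g⁻¹ * h) g (mulInvariantVectorField v g) :=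
    mfderiv_comp_apply_of_eq (x := (1 : G)) (I' := 𝓘(ℝ, E)) (y := g)
      ((contMDiff_mul_left (I := 𝓘(ℝ, E)) (n := ∞)).contMDiffAt.mdifferentiableAt (by simp))
      ((contMDiff_mul_left (I := 𝓘(ℝ, E)) (n := ∞)).contMDiffAt.mdifferentiableAt (by simp))
      (mul_one g) v
  have e2 : ((fun h : G => g⁻¹ * h) ∘ fun h : G => g * h) = id := by ext; simp
  rw [h, e2, mfderiv_id, map_zero] at e
  exact e

theorem isInvertible_chartFrame [FiniteDimensional ℝ E] {x : E} (hx : x ∈ (idChart E G).target) :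
    (chartFrame ι x).IsInvertible := by
  have : FiniteDimensional ℝ (GroupLieAlgebra 𝓘(ℝ, E) G) := inferInstanceAs (FiniteDimensional ℝ E)
  have : FiniteDimensional ℝ S := ι.symm.toLinearEquiv.finiteDimensional
  have hinj : Injective (chartFrame ι x) := by
    rw [injective_iff_map_eq_zero]
    intro X hX
    have h := mfderiv_idChart_symm_chartFrame ι hx X
    have h0 : mfderiv 𝓘(ℝ, E) 𝓘(ℝ, E) (idChart E G).symm x (chartFrame ι x X) = 0 :=
      (congrArg _ hX).trans (ContinuousLinearMap.map_zero _)
    have := mulInvariantVectorField_injective (h.symm.trans h0)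
    simpa using this
  have hd : Module.finrank ℝ S = Module.finrank ℝ E := ι.toLinearEquiv.finrank_eq
  refine ⟨(LinearEquiv.ofInjectiveOfFinrankEq (chartFrame ι x).toLinearMap hinj
    hd).toContinuousLinearEquiv, ?_⟩
  ext X
  rfl

/-- The bracket of the left invariant fields, read in the chart at the identity: the structure equation
of the frame `chartFrame ι`. -/
theorem lieBracket_chartFrame [CompleteSpace E] {x : E} (hx : x ∈ (idChart E G).target) (X Y : S) :
    fderiv ℝ (chartFrame ι) x (chartFrame ι x X) Y - fderiv ℝ (chartFrame ι) x (chartFrame ι x Y) X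
      = chartFrame ι x (ι.symm ⁅ι X, ι Y⁆) := by
  have : LieGroup 𝓘(ℝ, E) (minSmoothness ℝ 3) G := by
    rw [minSmoothness_of_isRCLikeNormedField]; infer_instance
  have hp : ∀ x ∈ (idChart E G).target, ∀ v : GroupLieAlgebra 𝓘(ℝ, E) G,
      mpullback 𝓘(ℝ, E) 𝓘(ℝ, E) (idChart E G).symm (mulInvariantVectorField v) x
        = chartFrame ι x (ι.symm v) := by
    intro x hx v
    have hinv := isInvertible_mfderivWithin_extChartAt_symm (I := 𝓘(ℝ, E)) (x := (1 : G)) hx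
    simp only [modelWithCornersSelf_coe, range_id, mfderivWithin_univ] at hinv
    have h := mfderiv_idChart_symm_chartFrame ι hx (ι.symm v)
    rw [ι.apply_symm_apply] at h
    rw [mpullback, ← h]
    exact DFunLike.congr_fun hinv.inverse_comp_self _
  have hnhds := (isOpen_extChartAt_target (I := 𝓘(ℝ, E)) (1 : G)).mem_nhds hx
  have h1 := mpullback_mlieBracket (I := 𝓘(ℝ, E)) (I' := 𝓘(ℝ, E)) (n := minSmoothness ℝ 3)
    (f := (idChart E G).symm) (x₀ := x)
    (mdifferentiableAt_mulInvariantVectorField (ι X)) (mdifferentiableAt_mulInvariantVectorField (ι Y))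
    ((contMDiffAt_idChart_symm hx).of_le (by
      rw [minSmoothness_of_isRCLikeNormedField]
      exact WithTop.coe_le_coe.2 (le_top : (3 : ℕ∞) ≤ ⊤)))
    (minSmoothness_monotone (by norm_cast))
  rw [← mulInvariantVector_mlieBracket, hp x hx] at h1
  have hE : ∀ Z : S, mpullback 𝓘(ℝ, E) 𝓘(ℝ, E) (idChart E G).symm (mulInvariantVectorField (ι Z))
      =ᶠ[𝓝 x] fun x => chartFrame ι x Z := by
    intro Z
    filter_upwards [hnhds] with x' hx'
    rw [hp x' hx', ι.symm_apply_apply]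
  rw [(hE X).mlieBracket_vectorField_eq (hE Y)] at h1
  have hd : DifferentiableAt ℝ (chartFrame ι) x :=
    (contDiffAt_chartFrame ι hx).differentiableAt (by simp)
  have hf : ∀ Z : S, fderiv ℝ (fun x => chartFrame ι x Z) x = (fderiv ℝ (chartFrame ι) x).flip Z := by
    intro Z
    rw [fderiv_clm_apply hd (differentiableAt_const Z)]
    ext; simp
  have h2 : mlieBracket 𝓘(ℝ, E) (fun x => chartFrame ι x X) (fun x => chartFrame ι x Y) x
      = lieBracket ℝ (fun x => chartFrame ι x X) (fun x => chartFrame ι x Y) x :=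
    mlieBracket_apply_eq_lieBracket _ _ x
  have h3 : lieBracket ℝ (fun x => chartFrame ι x X) (fun x => chartFrame ι x Y) x
      = fderiv ℝ (chartFrame ι) x (chartFrame ι x X) Y
        - fderiv ℝ (chartFrame ι) x (chartFrame ι x Y) X := by
    rw [lieBracket_eq]
    beta_reduce
    rw [hf, hf]
    rfl
  exact h3.symm.trans (h2.symm.trans h1.symm)

end ChartFrame

/-! ### Maps with prescribed logarithmic derivative -/

section LogarithmicDerivative

open Filter Topology

variable {E : Type*} [NormedAddCommGroup E] [NormedSpace ℝ E]
  {E' : Type*} [NormedAddCommGroup E'] [NormedSpace ℝ E']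
  {E'' : Type*} [NormedAddCommGroup E''] [NormedSpace ℝ E'']

/-- A map between manifolds with vanishing differential is locally constant. -/
theorem eventually_eq_of_mfderiv_eq_zero {M : Type*} [TopologicalSpace M] [ChartedSpace E M]
    [IsManifold 𝓘(ℝ, E) ∞ M] {N : Type*} [TopologicalSpace N] [ChartedSpace E' N]
    [IsManifold 𝓘(ℝ, E') ∞ N] {f : M → N} {p : M}
    (hf : ∀ᶠ x in 𝓝 p, HasMFDerivAt 𝓘(ℝ, E) 𝓘(ℝ, E') f x 0) : ∀ᶠ x in 𝓝 p, f x = f p := by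
  set φ := extChartAt 𝓘(ℝ, E) p with hφ
  set χ := extChartAt 𝓘(ℝ, E') (f p) with hχ
  have hcont : ContinuousAt f p := hf.self_of_nhds.1
  have h1 : ∀ᶠ x in 𝓝 p, f x ∈ χ.source :=
    hcont (extChartAt_source_mem_nhds (I := 𝓘(ℝ, E')) (f p))
  have hsymm : Tendsto φ.symm (𝓝 (φ p)) (𝓝 p) := by
    have := continuousAt_extChartAt_symm (I := 𝓘(ℝ, E)) p
    rwa [ContinuousAt, extChartAt_to_inv] at this
  have h2 : ∀ᶠ y in 𝓝 (φ p), y ∈ φ.target := extChartAt_target_mem_nhds p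
  have h3 : ∀ᶠ y in 𝓝 (φ p), y ∈ φ.target ∧ HasFDerivAt (χ ∘ f ∘ φ.symm) (0 : E →L[ℝ] E') y := by
    filter_upwards [h2, hsymm.eventually (h1.and hf)] with y hy1 hy2
    refine ⟨hy1, ?_⟩
    have d1 : MDifferentiableAt 𝓘(ℝ, E) 𝓘(ℝ, E) φ.symm y :=
      ((contMDiffOn_extChartAt_symm (n := ∞) p).contMDiffAt
        ((isOpen_extChartAt_target p).mem_nhds hy1)).mdifferentiableAt (by simp)
    have d2 : MDifferentiableAt 𝓘(ℝ, E') 𝓘(ℝ, E') χ (f (φ.symm y)) :=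
      (contMDiffAt_extChartAt' (n := ∞) (by simpa [hχ] using hy2.1)).mdifferentiableAt (by simp)
    have := d2.hasMFDerivAt.comp y (hy2.2.comp y d1.hasMFDerivAt)
    rw [ContinuousLinearMap.zero_comp, ContinuousLinearMap.comp_zero] at this
    exact this.hasFDerivAt
  obtain ⟨r, hr, H⟩ := Metric.eventually_nhds_iff_ball.1 h3
  have hconst : ∀ y ∈ Metric.ball (φ p) r, (χ ∘ f ∘ φ.symm) y = (χ ∘ f ∘ φ.symm) (φ p) := by
    intro y hy
    refine (convex_ball (φ p) r).is_const_of_fderivWithin_eq_zero (𝕜 := ℝ)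
      (fun z hz => (H z hz).2.differentiableAt.differentiableWithinAt) (fun z hz => ?_) hy
      (Metric.mem_ball_self hr)
    rw [fderivWithin_of_isOpen Metric.isOpen_ball hz, (H z hz).2.fderiv]
  have h4 : ∀ᶠ x in 𝓝 p, φ x ∈ Metric.ball (φ p) r :=
    (continuousAt_extChartAt (I := 𝓘(ℝ, E)) p) (Metric.ball_mem_nhds _ hr)
  filter_upwards [h1, h4, extChartAt_source_mem_nhds (I := 𝓘(ℝ, E)) p] with x hx1 hx2 hx3
  have := hconst _ hx2
  simp only [comp_apply] at this
  rw [φ.left_inv hx3, hφ, extChartAt_to_inv] at this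
  exact χ.injOn hx1 (mem_extChartAt_source (f p)) this

variable {G : Type*} [TopologicalSpace G] [ChartedSpace E G] [Group G] [LieGroup 𝓘(ℝ, E) ∞ G]
  {G' : Type*} [TopologicalSpace G'] [ChartedSpace E' G'] [Group G'] [LieGroup 𝓘(ℝ, E') ∞ G']
  {G'' : Type*} [TopologicalSpace G''] [ChartedSpace E'' G''] [Group G'']

theorem mdifferentiableAt_mul_left (a g : G) :
    MDifferentiableAt 𝓘(ℝ, E) 𝓘(ℝ, E) (fun x : G => a * x) g :=
  (contMDiff_mul_left (I := 𝓘(ℝ, E)) (n := ∞)).contMDiffAt.mdifferentiableAt (by simp)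

theorem mdifferentiableAt_mul_right (a g : G) :
    MDifferentiableAt 𝓘(ℝ, E) 𝓘(ℝ, E) (fun x : G => x * a) g :=
  (contMDiff_mul_right (I := 𝓘(ℝ, E)) (n := ∞)).contMDiffAt.mdifferentiableAt (by simp)

theorem mfderiv_mul_left_mulInvariantVectorField (a g : G) (v : GroupLieAlgebra 𝓘(ℝ, E) G) :
    mfderiv 𝓘(ℝ, E) 𝓘(ℝ, E) (fun x : G => a * x) g (mulInvariantVectorField v g)
      = mulInvariantVectorField v (a * g) := by
  have e := mfderiv_comp_apply_of_eq (I := 𝓘(ℝ, E)) (I'' := 𝓘(ℝ, E)) (x := (1 : G))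
    (I' := 𝓘(ℝ, E)) (y := g) (g := fun x : G => a * x) (f := fun x : G => g * x)
    (mdifferentiableAt_mul_left a g) (mdifferentiableAt_mul_left g 1) (mul_one g) v
  have e2 : ((fun x : G => a * x) ∘ fun x : G => g * x) = fun x => a * g * x := by
    ext x; simp [mul_assoc]
  rw [e2] at e
  exact e.symm

/-- The left invariant vector fields span every tangent space. -/
theorem exists_mulInvariantVectorField_eq (g : G) (u : TangentSpace 𝓘(ℝ, E) g) :
    ∃ v : GroupLieAlgebra 𝓘(ℝ, E) G, mulInvariantVectorField v g = u := by
  refine ⟨mfderiv 𝓘(ℝ, E) 𝓘(ℝ, E) (fun x : G => g⁻¹ * x) g u, ?_⟩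
  have e := mfderiv_comp_apply_of_eq (I := 𝓘(ℝ, E)) (I'' := 𝓘(ℝ, E)) (x := g)
    (I' := 𝓘(ℝ, E)) (y := (1 : G)) (g := fun x : G => g * x) (f := fun x : G => g⁻¹ * x)
    (mdifferentiableAt_mul_left g 1) (mdifferentiableAt_mul_left g⁻¹ g) (inv_mul_cancel g) u
  have e2 : ((fun x : G => g * x) ∘ fun x : G => g⁻¹ * x) = id := by ext x; simp
  rw [e2, mfderiv_id] at e
  exact e.symm

theorem mulInvariantVectorField_one (v : GroupLieAlgebra 𝓘(ℝ, E) G) :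
    mulInvariantVectorField v (1 : G) = v := by
  have : (fun x : G => (1 : G) * x) = id := by ext; simp
  have h : mfderiv 𝓘(ℝ, E) 𝓘(ℝ, E) (fun x : G => (1 : G) * x) 1 v
      = mfderiv 𝓘(ℝ, E) 𝓘(ℝ, E) (id : G → G) 1 v := by
    rw [this]; rfl
  rw [mfderiv_id] at h
  exact h

/-- The map `f` between Lie groups has left logarithmic derivative `Θ` at `g`: the differential of
`f` maps the value at `g` of a left invariant vector field to that of its image under `Θ`. -/
def HasLogDerivAt (Θ : GroupLieAlgebra 𝓘(ℝ, E) G →L[ℝ] GroupLieAlgebra 𝓘(ℝ, E') G') (f : G → G')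
    (g : G) : Prop :=
  MDifferentiableAt 𝓘(ℝ, E) 𝓘(ℝ, E') f g ∧ ∀ v : GroupLieAlgebra 𝓘(ℝ, E) G,
    mfderiv 𝓘(ℝ, E) 𝓘(ℝ, E') f g (mulInvariantVectorField v g)
      = mulInvariantVectorField (Θ v) (f g)

variable {Θ : GroupLieAlgebra 𝓘(ℝ, E) G →L[ℝ] GroupLieAlgebra 𝓘(ℝ, E') G'}

theorem HasLogDerivAt.congr {f f' : G → G'} {g : G} (h : HasLogDerivAt Θ f g)
    (he : f' =ᶠ[𝓝 g] f) : HasLogDerivAt Θ f' g := by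
  refine ⟨h.1.congr_of_eventuallyEq he, fun v => ?_⟩
  have e : mfderiv 𝓘(ℝ, E) 𝓘(ℝ, E') f' g (mulInvariantVectorField v g)
      = mfderiv 𝓘(ℝ, E) 𝓘(ℝ, E') f g (mulInvariantVectorField v g) :=
    congrArg (fun T : E →L[ℝ] E' => T (mulInvariantVectorField v g)) he.mfderiv_eq
  have h2 := h.2 v
  rw [← he.self_of_nhds] at h2
  exact e.trans h2

theorem HasLogDerivAt.comp {Θ' : GroupLieAlgebra 𝓘(ℝ, E') G' →L[ℝ] GroupLieAlgebra 𝓘(ℝ, E'') G''}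
    {f : G → G'} {f' : G' → G''} {g : G} (h' : HasLogDerivAt Θ' f' (f g))
    (h : HasLogDerivAt Θ f g) : HasLogDerivAt (Θ' ∘L Θ) (f' ∘ f) g := by
  refine ⟨h'.1.comp g h.1, fun v => ?_⟩
  rw [mfderiv_comp_apply g h'.1 h.1, h.2 v, h'.2 (Θ v)]
  rfl

theorem hasLogDerivAt_mul_left (a g : G) : HasLogDerivAt (.id ℝ (GroupLieAlgebra 𝓘(ℝ, E) G))
    (fun x : G => a * x) g :=
  ⟨mdifferentiableAt_mul_left a g, mfderiv_mul_left_mulInvariantVectorField a g⟩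

/-- Left translations on both sides do not change the logarithmic derivative. -/
theorem HasLogDerivAt.translate {f : G → G'} {a g : G} (h : HasLogDerivAt Θ f (a * g)) (b : G') :
    HasLogDerivAt Θ (fun x => b * f (a * x)) g := by
  have h1 := HasLogDerivAt.comp (f' := f) (f := fun x => a * x) h (hasLogDerivAt_mul_left a g)
  exact HasLogDerivAt.comp (f' := fun x : G' => b * x) (f := fun x => f (a * x))
    (hasLogDerivAt_mul_left b (f (a * g))) h1

/-- At the identity the left invariant fields are the vectors themselves. -/
theorem HasLogDerivAt.mfderiv_one {f : G → G'} (h : HasLogDerivAt Θ f 1) (h1 : f 1 = 1)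
    (v : GroupLieAlgebra 𝓘(ℝ, E) G) : mfderiv 𝓘(ℝ, E) 𝓘(ℝ, E') f 1 v = Θ v := by
  have h2 := h.2 v
  have h3 : ∀ w : GroupLieAlgebra 𝓘(ℝ, E') G', mulInvariantVectorField w (f 1) = w := by
    intro w
    have := mulInvariantVectorField_one w
    rw [← h1] at this
    exact this
  rw [mulInvariantVectorField_one] at h2
  exact h2.trans (h3 _)

/-- Two maps with the same logarithmic derivative differ locally by a left translation: the
differential of `f₁ f₂⁻¹` vanishes. -/
theorem HasLogDerivAt.eventually_mul_inv_eq {f₁ f₂ : G → G'} {g : G}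
    (h₁ : ∀ᶠ x in 𝓝 g, HasLogDerivAt Θ f₁ x) (h₂ : ∀ᶠ x in 𝓝 g, HasLogDerivAt Θ f₂ x) :
    ∀ᶠ x in 𝓝 g, f₁ x * (f₂ x)⁻¹ = f₁ g * (f₂ g)⁻¹ := by
  refine eventually_eq_of_mfderiv_eq_zero (E := E) (E' := E') ?_
  filter_upwards [h₁, h₂] with x hx₁ hx₂
  set h : G → G' := fun x => f₁ x * (f₂ x)⁻¹ with hh
  have hinv : MDifferentiableAt 𝓘(ℝ, E') 𝓘(ℝ, E') (fun y : G' => y⁻¹) (f₂ x) :=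
    (contMDiff_inv 𝓘(ℝ, E') ∞).contMDiffAt.mdifferentiableAt (by simp)
  have hmul : ∀ z : G' × G', MDifferentiableAt (𝓘(ℝ, E').prod 𝓘(ℝ, E')) 𝓘(ℝ, E')
      (fun z : G' × G' => z.1 * z.2) z := fun z =>
    (contMDiff_mul 𝓘(ℝ, E') ∞).contMDiffAt.mdifferentiableAt (by simp)
  have hhd : MDifferentiableAt 𝓘(ℝ, E) 𝓘(ℝ, E') h x :=
    (hmul (f₁ x, (f₂ x)⁻¹)).comp x (hx₁.1.prodMk (hinv.comp x hx₂.1))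
  have hprod : MDifferentiableAt 𝓘(ℝ, E) (𝓘(ℝ, E').prod 𝓘(ℝ, E')) (fun y => (h y, f₂ y)) x :=
    hhd.prodMk hx₂.1
  have hf₁ : ∀ y, h y * f₂ y = f₁ y := fun y => by simp [hh]
  have key : ∀ v : GroupLieAlgebra 𝓘(ℝ, E) G,
      mfderiv 𝓘(ℝ, E) 𝓘(ℝ, E') h x (mulInvariantVectorField v x) = 0 := by
    intro v
    have e1 := mfderiv_comp_apply x (hmul (h x, f₂ x)) hprod (mulInvariantVectorField v x)
    rw [mfderiv_prod_eq_add_apply (hmul (h x, f₂ x)), hhd.mfderiv_prod hx₂.1] at e1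
    have e2 : ((fun z : G' × G' => z.1 * z.2) ∘ fun y => (h y, f₂ y)) = f₁ := funext hf₁
    have e3 : mfderiv 𝓘(ℝ, E') 𝓘(ℝ, E') (fun z : G' => h x * z) (f₂ x)
        (mfderiv 𝓘(ℝ, E) 𝓘(ℝ, E') f₂ x (mulInvariantVectorField v x))
        = mulInvariantVectorField (Θ v) (h x * f₂ x) := by
      rw [hx₂.2 v, mfderiv_mul_left_mulInvariantVectorField]
    have e4 : mfderiv 𝓘(ℝ, E) 𝓘(ℝ, E') f₁ x (mulInvariantVectorField v x)
        = mulInvariantVectorField (Θ v) (h x * f₂ x) := by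
      rw [hf₁]; exact hx₁.2 v
    rw [e2] at e1
    have e5 : mfderiv 𝓘(ℝ, E') 𝓘(ℝ, E') (fun z : G' => z * f₂ x) (h x)
        (mfderiv 𝓘(ℝ, E) 𝓘(ℝ, E') h x (mulInvariantVectorField v x)) = 0 := by
      have aux : ∀ p q r t : E', p = r → p = q + t → t = r → q = 0 := by
        rintro p q r t rfl h rfl
        exact right_eq_add.1 h
      exact aux _ _ _ _ e4 e1 e3
    have e8 := mfderiv_comp_apply (I := 𝓘(ℝ, E')) (I'' := 𝓘(ℝ, E')) (I' := 𝓘(ℝ, E')) (h x)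
      (mdifferentiableAt_mul_right (f₂ x)⁻¹ (h x * f₂ x)) (mdifferentiableAt_mul_right (f₂ x) (h x))
      (mfderiv 𝓘(ℝ, E) 𝓘(ℝ, E') h x (mulInvariantVectorField v x))
    rw [e5, map_zero] at e8
    have e9 : ((fun z : G' => z * (f₂ x)⁻¹) ∘ fun z : G' => z * f₂ x) = id := by ext; simp
    rw [e9, mfderiv_id] at e8
    exact e8
  have hz : mfderiv 𝓘(ℝ, E) 𝓘(ℝ, E') h x = 0 := by
    ext u
    obtain ⟨v, rfl⟩ := exists_mulInvariantVectorField_eq x u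
    exact key v
  rw [← hz]
  exact hhd.hasMFDerivAt

/-- On a connected open set a map is determined by its logarithmic derivative and one value. -/
theorem eqOn_of_hasLogDerivAt {f₁ f₂ : G → G'} {U : Set G} (hU : IsOpen U) (hc : IsPreconnected U)
    (h₁ : ∀ x ∈ U, HasLogDerivAt Θ f₁ x) (h₂ : ∀ x ∈ U, HasLogDerivAt Θ f₂ x) {a : G} (ha : a ∈ U)
    (h : f₁ a = f₂ a) : EqOn f₁ f₂ U := by
  have : PreconnectedSpace U := isPreconnected_iff_preconnectedSpace.1 hc
  have hl : IsLocallyConstant (fun x : U => f₁ x * (f₂ x)⁻¹) := by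
    rw [IsLocallyConstant.iff_eventually_eq]
    intro x
    have := HasLogDerivAt.eventually_mul_inv_eq
      (mem_of_superset (hU.mem_nhds x.2) h₁) (mem_of_superset (hU.mem_nhds x.2) h₂)
    exact continuous_subtype_val.continuousAt.eventually this
  intro x hx
  have := hl.apply_eq_of_preconnectedSpace ⟨x, hx⟩ ⟨a, ha⟩
  simp only [h, mul_inv_cancel] at this
  exact mul_inv_eq_one.1 this

theorem eq_of_hasLogDerivAt [PreconnectedSpace G] {f₁ f₂ : G → G'}
    (h₁ : ∀ x, HasLogDerivAt Θ f₁ x) (h₂ : ∀ x, HasLogDerivAt Θ f₂ x) {a : G}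
    (h : f₁ a = f₂ a) : f₁ = f₂ :=
  funext fun x => eqOn_of_hasLogDerivAt isOpen_univ isPreconnected_univ (fun x _ => h₁ x)
    (fun x _ => h₂ x) (mem_univ a) h (mem_univ x)

end LogarithmicDerivative

/-! ### Monodromy -/

section Monodromy

open Filter Topology

/-- A type, equipped with the discrete topology, as the fibre of a covering. -/
def DiscreteFiber (A : Type*) : Type _ := A

instance (A : Type*) : TopologicalSpace (DiscreteFiber A) := ⊥

instance (A : Type*) : DiscreteTopology (DiscreteFiber A) := ⟨rfl⟩

variable {X : Type*} [TopologicalSpace X] {A : Type*} [Group A]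

/-- The covering space whose sheets over `U i` are the left multiples of the local section `s i`,
where any two local sections differ by a locally constant left multiplication. -/
def sectionCore (U : X → Set X) (hU : ∀ i, IsOpen (U i)) (hi : ∀ i, i ∈ U i) (s : X → X → A)
    (hs : ∀ i j, ∀ x ∈ U i ∩ U j, ∀ᶠ y in 𝓝 x, s i y * (s j y)⁻¹ = s i x * (s j x)⁻¹) :
    FiberBundleCore X X (DiscreteFiber A) where
  baseSet := U
  isOpen_baseSet := hU
  indexAt := id
  mem_baseSet_at := hi
  coordChange i j x k := (show A from k) * (s i x * (s j x)⁻¹)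
  coordChange_self i x _ k := by
    change (show A from k) * (s i x * (s i x)⁻¹) = k
    rw [mul_inv_cancel, mul_one]
  continuousOn_coordChange i j := by
    rintro ⟨x, k⟩ hx
    refine ContinuousAt.continuousWithinAt ?_
    have h1 : ∀ᶠ p in 𝓝 ((x, k) : X × DiscreteFiber A), p.2 = k :=
      (continuous_snd.tendsto ((x, k) : X × DiscreteFiber A)).eventually
        ((isOpen_discrete {k}).mem_nhds (mem_singleton k))
    have h2 : ∀ᶠ p in 𝓝 ((x, k) : X × DiscreteFiber A),
        s i p.1 * (s j p.1)⁻¹ = s i x * (s j x)⁻¹ :=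
      (continuous_fst.tendsto ((x, k) : X × DiscreteFiber A)).eventually (hs i j x hx.1)
    refine continuousAt_const.congr
      (f := fun _ => (show DiscreteFiber A from (show A from k) * (s i x * (s j x)⁻¹))) ?_
    filter_upwards [h1, h2] with p hp1 hp2
    rw [hp1, hp2]
  coordChange_comp i j k x _ a := by
    have h : ∀ b : A, b * (s i x * (s j x)⁻¹) * (s j x * (s k x)⁻¹)
        = b * (s i x * (s k x)⁻¹) := fun b => by group
    exact h a

/-- Local sections which differ by locally constant left multiplications can be glued, after
left multiplications, to a global section over a simply connected space. -/
theorem exists_global_section [SimplyConnectedSpace X] [LocallyPathConnectedSpace X]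
    {U : X → Set X} (hU : ∀ i, IsOpen (U i)) (hi : ∀ i, i ∈ U i) {s : X → X → A}
    (hs : ∀ i j, ∀ x ∈ U i ∩ U j, ∀ᶠ y in 𝓝 x, s i y * (s j y)⁻¹ = s i x * (s j x)⁻¹)
    (x₀ : X) (a₀ : A) :
    ∃ h : X → A, h x₀ = a₀ ∧ ∀ i, ∀ᶠ x in 𝓝 i, h x * (s i x)⁻¹ = h i * (s i i)⁻¹ := by
  set Z := sectionCore U hU hi s hs with hZ
  have cov : IsCoveringMap (Bundle.TotalSpace.proj : Bundle.TotalSpace (DiscreteFiber A) Z.Fiber → X) :=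
    FiberBundle.isCoveringMap
  obtain ⟨F, ⟨hF0, hF⟩, -⟩ := cov.existsUnique_continuousMap_lifts (ContinuousMap.id X) x₀
    (⟨x₀, (show DiscreteFiber A from a₀ * (s x₀ x₀)⁻¹)⟩ : Bundle.TotalSpace (DiscreteFiber A) Z.Fiber) rfl
  have hp : ∀ x, (F x).1 = x := fun x => congrFun hF x
  let toA : Bundle.TotalSpace (DiscreteFiber A) Z.Fiber → A := fun p => p.2
  set k : X → A := fun x => toA (F x) with hk
  refine ⟨fun x => k x * s x x, ?_, fun i => ?_⟩
  · have : k x₀ = a₀ * (s x₀ x₀)⁻¹ := by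
      exact congrArg toA hF0
    simp [this]
  · have hc : ContinuousAt (fun x => (Z.localTriv i (F x)).2) i := by
      refine continuous_snd.continuousAt.comp ?_
      have : ContinuousAt (Z.localTriv i) (F i) :=
        (Z.localTriv i).toOpenPartialHomeomorph.continuousAt (by
          change (F i).1 ∈ U i
          rw [hp]; exact hi i)
      exact this.comp F.continuous.continuousAt
    have hv : ∀ x, (show A from (Z.localTriv i (F x)).2) = k x * (s x x * (s i x)⁻¹) := by
      intro x
      rw [FiberBundleCore.localTriv_apply]
      change toA (F x) * (s (F x).1 (F x).1 * (s i (F x).1)⁻¹) = _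
      rw [hp]
    have he : ∀ᶠ x in 𝓝 i, (Z.localTriv i (F x)).2 = (Z.localTriv i (F i)).2 :=
      hc.eventually ((isOpen_discrete {(Z.localTriv i (F i)).2}).mem_nhds rfl)
    filter_upwards [he] with x hx
    have h1 := hv x
    rw [hx, hv i] at h1
    rw [mul_assoc, mul_assoc, h1]

end Monodromy

/-! ### Integration of Lie algebra homomorphisms -/

section Integration

open Filter Topology

variable {E : Type*} [NormedAddCommGroup E] [NormedSpace ℝ E] [FiniteDimensional ℝ E]
  {E' : Type*} [NormedAddCommGroup E'] [NormedSpace ℝ E'] [FiniteDimensional ℝ E']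
  {G : Type*} [TopologicalSpace G] [ChartedSpace E G] [Group G] [LieGroup 𝓘(ℝ, E) ∞ G]
  {G' : Type*} [TopologicalSpace G'] [ChartedSpace E' G'] [Group G'] [LieGroup 𝓘(ℝ, E') ∞ G']
  {S : Type*} [NormedAddCommGroup S] [NormedSpace ℝ S]
  {S' : Type*} [NormedAddCommGroup S'] [NormedSpace ℝ S']
  {Θ : GroupLieAlgebra 𝓘(ℝ, E) G →L[ℝ] GroupLieAlgebra 𝓘(ℝ, E') G'}

variable (E G) in
/-- The Lie algebra of a Lie group modelled on `E`, identified with `E`. -/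
def lieAlgebraEquiv : E ≃L[ℝ] GroupLieAlgebra 𝓘(ℝ, E) G := ContinuousLinearEquiv.refl ℝ E

/-- A map whose expression `F` in the preferred charts satisfies the equation for the logarithmic
derivative has this logarithmic derivative. -/
theorem hasLogDerivAt_of_chart (ι : S ≃L[ℝ] GroupLieAlgebra 𝓘(ℝ, E) G)
    (ι' : S' ≃L[ℝ] GroupLieAlgebra 𝓘(ℝ, E') G') {θ : S →L[ℝ] S'} (hθ : ∀ X, Θ (ι X) = ι' (θ X))
    {F : E → E'} {g : G} (hg : g ∈ (idChart E G).source)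
    (hF : F (idChart E G g) ∈ (idChart E' G').target)
    (hd : DifferentiableAt ℝ F (idChart E G g))
    (h : ∀ X, fderiv ℝ F (idChart E G g) (chartFrame ι (idChart E G g) X)
      = chartFrame ι' (F (idChart E G g)) (θ X)) :
    HasLogDerivAt Θ ((idChart E' G').symm ∘ F ∘ idChart E G) g := by
  obtain ⟨x, hx, rfl⟩ : ∃ x ∈ (idChart E G).target, (idChart E G).symm x = g :=
    ⟨_, (idChart E G).map_source hg, (idChart E G).left_inv hg⟩
  have hxx : idChart E G ((idChart E G).symm x) = x := (idChart E G).right_inv hx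
  have d1 : MDifferentiableAt 𝓘(ℝ, E) 𝓘(ℝ, E) (idChart E G) ((idChart E G).symm x) :=
    (contMDiffAt_idChart hg).mdifferentiableAt (by simp)
  have d3 : MDifferentiableAt 𝓘(ℝ, E') 𝓘(ℝ, E') (idChart E' G').symm
      (F (idChart E G ((idChart E G).symm x))) :=
    (contMDiffAt_idChart_symm hF).mdifferentiableAt (by simp)
  have d2 := hd.mdifferentiableAt
  have d12 := d2.comp ((idChart E G).symm x) d1
  refine ⟨d3.comp ((idChart E G).symm x) d12, fun v => ?_⟩
  obtain ⟨X, rfl⟩ := ι.surjective v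
  have e1 := mfderiv_comp_apply ((idChart E G).symm x) d3 d12
    (mulInvariantVectorField (ι X) ((idChart E G).symm x))
  have e2 := mfderiv_comp_apply ((idChart E G).symm x) d2 d1
    (mulInvariantVectorField (ι X) ((idChart E G).symm x))
  have e3 := mfderiv_idChart_mulInvariantVectorField ι hx X
  have e4 := h X
  rw [hθ]
  rw [hxx] at e4
  have e5 : mfderiv 𝓘(ℝ, E) 𝓘(ℝ, E') (F ∘ idChart E G) ((idChart E G).symm x)
      (mulInvariantVectorField (ι X) ((idChart E G).symm x)) = chartFrame ι' (F x) (θ X) := by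
    refine e2.trans ?_
    rw [e3, mfderiv_eq_fderiv, hxx]
    exact e4
  refine e1.trans ?_
  rw [e5]
  have e6 := mfderiv_idChart_symm_chartFrame ι' (hxx ▸ hF : F x ∈ _) (θ X)
  have : ∀ y : E, y = x → mfderiv 𝓘(ℝ, E') 𝓘(ℝ, E') (idChart E' G').symm (F y)
      (chartFrame ι' (F x) (θ X)) = mulInvariantVectorField (ι' (θ X)) ((idChart E' G').symm (F y)) := by
    rintro y rfl
    exact e6
  exact this _ hxx

/-- A Lie algebra homomorphism is locally the differential of a smooth map. -/
theorem exists_local_hasLogDerivAt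
    (hΘ : ∀ v w : GroupLieAlgebra 𝓘(ℝ, E) G, Θ ⁅v, w⁆ = ⁅Θ v, Θ w⁆) :
    ∃ (U : Set G) (f : G → G'), IsOpen U ∧ 1 ∈ U ∧ f 1 = 1 ∧
      ∀ x ∈ U, HasLogDerivAt Θ f x ∧ ContMDiffAt 𝓘(ℝ, E) 𝓘(ℝ, E') ∞ f x := by
  have : CompleteSpace E := FiniteDimensional.complete ℝ E
  have : CompleteSpace E' := FiniteDimensional.complete ℝ E'
  set ι := lieAlgebraEquiv E G
  set ι' := lieAlgebraEquiv E' G'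
  set θ : E →L[ℝ] E' := (ι'.symm : GroupLieAlgebra 𝓘(ℝ, E') G' →L[ℝ] E') ∘L Θ ∘L
    (ι : E →L[ℝ] GroupLieAlgebra 𝓘(ℝ, E) G) with hθdef
  have hθ : ∀ X, Θ (ι X) = ι' (θ X) := fun X => by simp [hθdef]
  have ht : ∀ᶠ x in 𝓝 (idChart E G 1), x ∈ (idChart E G).target :=
    extChartAt_target_mem_nhds (I := 𝓘(ℝ, E)) (1 : G)
  have ht' : ∀ᶠ x in 𝓝 (idChart E' G' 1), x ∈ (idChart E' G').target :=
    extChartAt_target_mem_nhds (I := 𝓘(ℝ, E')) (1 : G')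
  obtain ⟨F, hF0, hF⟩ := exists_frame_solution (B := chartFrame ι)
    (R := fun y => chartFrame ι' y ∘L θ) (c := fun X Y => ι.symm ⁅ι X, ι Y⁆)
    (x₀ := idChart E G 1) (y₀ := idChart E' G' 1)
    (ht.mono fun x hx => contDiffAt_chartFrame ι hx)
    (ht'.mono fun y hy => (contDiffAt_chartFrame ι' hy).clm_comp contDiffAt_const)
    (isInvertible_chartFrame ι ht.self_of_nhds)
    (ht.mono fun x hx X Y => lieBracket_chartFrame ι hx X Y)
    (ht'.mono fun y hy X Y => by
      have hd : DifferentiableAt ℝ (chartFrame ι') y :=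
        (contDiffAt_chartFrame ι' hy).differentiableAt (by simp)
      have hc : θ (ι.symm ⁅ι X, ι Y⁆) = ι'.symm ⁅ι' (θ X), ι' (θ Y)⁆ := by
        rw [← hθ, ← hθ, ← hΘ]
        simp [hθdef]
      rw [fderiv_clm_comp hd (differentiableAt_const θ)]
      simp only [fderiv_fun_const, ContinuousLinearMap.comp_apply, hc,
        ← lieBracket_chartFrame ι' hy]
      simp)
  have hc : Tendsto (idChart E G) (𝓝 1) (𝓝 (idChart E G 1)) :=
    continuousAt_extChartAt (I := 𝓘(ℝ, E)) (1 : G)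
  have hFt : ∀ᶠ x in 𝓝 (idChart E G 1), F x ∈ (idChart E' G').target := by
    refine hF.self_of_nhds.1.continuousAt.eventually ?_
    rwa [hF0]
  have hall : ∀ᶠ g in 𝓝 (1 : G),
      HasLogDerivAt Θ ((idChart E' G').symm ∘ F ∘ idChart E G) g ∧
      ContMDiffAt 𝓘(ℝ, E) 𝓘(ℝ, E') ∞ ((idChart E' G').symm ∘ F ∘ idChart E G) g := by
    filter_upwards [hc.eventually hF, hc.eventually hFt,
      extChartAt_source_mem_nhds (I := 𝓘(ℝ, E)) (1 : G)] with g hg1 hg2 hg3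
    refine ⟨hasLogDerivAt_of_chart ι ι' hθ hg3 hg2 (hg1.1.differentiableAt (by simp)) hg1.2.2, ?_⟩
    exact (contMDiffAt_idChart_symm hg2).comp g (hg1.1.contMDiffAt.comp g (contMDiffAt_idChart hg3))
  obtain ⟨U, hU, hUo, h1U⟩ := eventually_nhds_iff.1 hall
  refine ⟨U, (idChart E' G').symm ∘ F ∘ idChart E G, hUo, h1U, ?_, hU⟩
  simp only [comp_apply, hF0]
  exact extChartAt_to_inv (I := 𝓘(ℝ, E')) (1 : G')

/-- A homomorphism from the Lie algebra of a simply connected Lie group to the Lie algebra of a Lie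
group is the differential of a smooth homomorphism. -/
theorem exists_monoidHom_mfderiv_eq [SimplyConnectedSpace G]
    (hΘ : ∀ v w : GroupLieAlgebra 𝓘(ℝ, E) G, Θ ⁅v, w⁆ = ⁅Θ v, Θ w⁆) :
    ∃ f : G →* G', ContMDiff 𝓘(ℝ, E) 𝓘(ℝ, E') ∞ f ∧ ∀ g, HasLogDerivAt Θ f g := by
  have : IsTopologicalGroup G := topologicalGroup_of_lieGroup 𝓘(ℝ, E) ∞
  have : LocallyPathConnectedSpace G := ChartedSpace.locallyPathConnectedSpace E G
  obtain ⟨V, f₀, hV, h1V, hf1, hf⟩ := exists_local_hasLogDerivAt hΘ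
  set U : G → Set G := fun i => (fun x => i⁻¹ * x) ⁻¹' V with hU
  have hUo : ∀ i, IsOpen (U i) := fun i => hV.preimage (continuous_const_mul _)
  have hUi : ∀ i, i ∈ U i := fun i => by simpa [hU] using h1V
  have hlog : ∀ i, ∀ x ∈ U i, HasLogDerivAt Θ (fun y => f₀ (i⁻¹ * y)) x := by
    intro i x hx
    have := (hf _ hx).1.translate (g := x) 1
    simpa using this
  obtain ⟨h, h1, hh⟩ := exists_global_section hUo hUi (s := fun i x => f₀ (i⁻¹ * x))
    (fun i j x hx => HasLogDerivAt.eventually_mul_inv_eq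
      (mem_of_superset ((hUo i).mem_nhds hx.1) (hlog i))
      (mem_of_superset ((hUo j).mem_nhds hx.2) (hlog j))) 1 1
  have hloc : ∀ i, h =ᶠ[𝓝 i] fun x => h i * f₀ (i⁻¹ * x) := by
    intro i
    filter_upwards [hh i] with x hx
    rw [inv_mul_cancel, hf1, inv_one, mul_one] at hx
    rw [← hx]; group
  have hlogh : ∀ g, HasLogDerivAt Θ h g := fun g =>
    ((hf (g⁻¹ * g) (by simpa using h1V)).1.translate (h g)).congr (hloc g)
  have hsm : ContMDiff 𝓘(ℝ, E) 𝓘(ℝ, E') ∞ h := by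
    intro g
    refine ContMDiffAt.congr_of_eventuallyEq ?_ (hloc g)
    have h2 : ContMDiffAt 𝓘(ℝ, E) 𝓘(ℝ, E') ∞ f₀ (g⁻¹ * g) := (hf _ (by simpa using h1V)).2
    have h3 : ContMDiffAt 𝓘(ℝ, E) 𝓘(ℝ, E') ∞ (fun x => f₀ (g⁻¹ * x)) g :=
      ContMDiffAt.comp g (g := f₀) h2 (contMDiff_mul_left (I := 𝓘(ℝ, E)) (n := ∞)).contMDiffAt
    exact contMDiffAt_const.mul h3
  have hmul : ∀ a b, h (a * b) = h a * h b := by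
    intro a b
    have e := eq_of_hasLogDerivAt (f₁ := fun x => (h a)⁻¹ * h (a * x)) (f₂ := h) (a := 1)
      (fun x => (hlogh (a * x)).translate _) hlogh (by simp [h1])
    rw [← congrFun e b]; simp
  exact ⟨⟨⟨h, h1⟩, hmul⟩, hsm, hlogh⟩

end Integration

section Isomorphisms

open Filter Topology

variable {E : Type*} [NormedAddCommGroup E] [NormedSpace ℝ E] [FiniteDimensional ℝ E]
  {E' : Type*} [NormedAddCommGroup E'] [NormedSpace ℝ E'] [FiniteDimensional ℝ E']
  {G : Type*} [TopologicalSpace G] [ChartedSpace E G] [Group G] [LieGroup 𝓘(ℝ, E) ∞ G]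
  {G' : Type*} [TopologicalSpace G'] [ChartedSpace E' G'] [Group G'] [LieGroup 𝓘(ℝ, E') ∞ G']

theorem hasLogDerivAt_id (g : G) :
    HasLogDerivAt (.id ℝ (GroupLieAlgebra 𝓘(ℝ, E) G)) (id : G → G) g := by
  refine ⟨mdifferentiableAt_id, fun v => ?_⟩
  rw [mfderiv_id]
  rfl

/-- An isomorphism between the Lie algebras of simply connected Lie groups is the differential of an
isomorphism of Lie groups. -/
theorem exists_mulEquiv_hasLogDerivAt [SimplyConnectedSpace G] [SimplyConnectedSpace G']
    (Θ : GroupLieAlgebra 𝓘(ℝ, E) G ≃L[ℝ] GroupLieAlgebra 𝓘(ℝ, E') G')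
    (hΘ : ∀ v w, Θ ⁅v, w⁆ = ⁅Θ v, Θ w⁆) :
    ∃ f : G ≃* G', ContMDiff 𝓘(ℝ, E) 𝓘(ℝ, E') ∞ f ∧ ContMDiff 𝓘(ℝ, E') 𝓘(ℝ, E) ∞ f.symm ∧
      (∀ g, HasLogDerivAt (Θ : GroupLieAlgebra 𝓘(ℝ, E) G →L[ℝ] GroupLieAlgebra 𝓘(ℝ, E') G') f g) ∧
      ∀ g, HasLogDerivAt (Θ.symm : GroupLieAlgebra 𝓘(ℝ, E') G' →L[ℝ] GroupLieAlgebra 𝓘(ℝ, E) G)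
        f.symm g := by
  obtain ⟨f, hf, hf'⟩ := exists_monoidHom_mfderiv_eq
    (Θ := (Θ : GroupLieAlgebra 𝓘(ℝ, E) G →L[ℝ] GroupLieAlgebra 𝓘(ℝ, E') G')) hΘ
  obtain ⟨k, hk, hk'⟩ := exists_monoidHom_mfderiv_eq
    (Θ := (Θ.symm : GroupLieAlgebra 𝓘(ℝ, E') G' →L[ℝ] GroupLieAlgebra 𝓘(ℝ, E) G)) (fun v w => by
      have h := hΘ (Θ.symm v) (Θ.symm w)
      rw [Θ.apply_symm_apply, Θ.apply_symm_apply] at h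
      exact (Θ.symm_apply_eq).2 h.symm)
  have h1 : (k ∘ f : G → G) = id := by
    refine eq_of_hasLogDerivAt (Θ := .id ℝ (GroupLieAlgebra 𝓘(ℝ, E) G)) (a := 1) (fun x => ?_)
      hasLogDerivAt_id (by simp)
    have := (hk' (f x)).comp (hf' x)
    rwa [ContinuousLinearEquiv.coe_symm_comp_coe] at this
  have h2 : (f ∘ k : G' → G') = id := by
    refine eq_of_hasLogDerivAt (Θ := .id ℝ (GroupLieAlgebra 𝓘(ℝ, E') G')) (a := 1) (fun x => ?_)
      hasLogDerivAt_id (by simp)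
    have := (hf' (k x)).comp (hk' x)
    rwa [ContinuousLinearEquiv.coe_comp_coe_symm] at this
  let e : G ≃* G' :=
    { toFun := f
      invFun := k
      left_inv := congrFun h1
      right_inv := congrFun h2
      map_mul' := map_mul f }
  exact ⟨e, hf, hk, hf', hk'⟩

end Isomorphisms

/-! ### One-parameter groups of automorphisms -/

section OneParameter

open Filter Topology

variable {S : Type*} [NormedAddCommGroup S] [NormedSpace ℝ S] [FiniteDimensional ℝ S]

theorem hasDerivAt_exp_smul (D : S →L[ℝ] S) (t : ℝ) :
    HasDerivAt (fun t : ℝ => NormedSpace.exp (t • D)) (D ∘L NormedSpace.exp (t • D)) t := by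
  have : CompleteSpace S := FiniteDimensional.complete ℝ S
  exact hasDerivAt_exp_smul_const' (𝕂 := ℝ) D t

theorem hasDerivAt_exp_neg_smul (D : S →L[ℝ] S) (t : ℝ) :
    HasDerivAt (fun t : ℝ => NormedSpace.exp (-(t • D))) (-(NormedSpace.exp (-(t • D)) ∘L D)) t := by
  have : CompleteSpace S := FiniteDimensional.complete ℝ S
  have h := hasDerivAt_exp_smul_const (𝕂 := ℝ) (-D) t
  simp only [smul_neg] at h
  exact h.congr_deriv (mul_neg _ _)

theorem exp_neg_comp_exp (D : S →L[ℝ] S) (X : S) :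
    (NormedSpace.exp (-D) : S →L[ℝ] S) ((NormedSpace.exp D : S →L[ℝ] S) X) = X := by
  have h := exp_mul_exp_neg (-D)
  rw [neg_neg] at h
  exact DFunLike.congr_fun h X

theorem exp_comp_exp_neg (D : S →L[ℝ] S) (X : S) :
    (NormedSpace.exp D : S →L[ℝ] S) ((NormedSpace.exp (-D) : S →L[ℝ] S) X) = X :=
  DFunLike.congr_fun (exp_mul_exp_neg D) X

theorem exp_add_smul_apply (D : S →L[ℝ] S) (t t' : ℝ) (X : S) :
    (NormedSpace.exp ((t + t') • D) : S →L[ℝ] S) X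
      = (NormedSpace.exp (t • D) : S →L[ℝ] S) ((NormedSpace.exp (t' • D) : S →L[ℝ] S) X) := by
  have : CompleteSpace S := FiniteDimensional.complete ℝ S
  let _ : NormedAlgebra ℚ (S →L[ℝ] S) := NormedAlgebra.restrictScalars ℚ ℝ _
  have h : Commute (t • D) (t' • D) := ((Commute.refl D).smul_left t).smul_right t'
  rw [add_smul, NormedSpace.exp_add_of_commute h]
  rfl

/-- The exponential of a derivation is an automorphism. -/
theorem exp_derivation_apply {c : S →L[ℝ] S →L[ℝ] S} {D : S →L[ℝ] S}
    (hD : ∀ X Y, D (c X Y) = c (D X) Y + c X (D Y)) (t : ℝ) (X Y : S) :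
    (NormedSpace.exp (t • D) : S →L[ℝ] S) (c X Y)
      = c ((NormedSpace.exp (t • D) : S →L[ℝ] S) X) ((NormedSpace.exp (t • D) : S →L[ℝ] S) Y) := by
  set h : ℝ → S := fun t => (NormedSpace.exp (-(t • D)) : S →L[ℝ] S)
    (c ((NormedSpace.exp (t • D) : S →L[ℝ] S) X) ((NormedSpace.exp (t • D) : S →L[ℝ] S) Y)) with hh
  have hd : ∀ t, HasDerivAt h 0 t := by
    intro t
    have e1 : ∀ Z : S, HasDerivAt (fun t : ℝ => (NormedSpace.exp (t • D) : S →L[ℝ] S) Z)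
        (D ((NormedSpace.exp (t • D) : S →L[ℝ] S) Z)) t := fun Z => by
      simpa using (hasDerivAt_exp_smul D t).clm_apply (hasDerivAt_const t Z)
    have e2 := (c.hasFDerivAt.comp_hasDerivAt t (e1 X)).clm_apply (e1 Y)
    have e3 := (hasDerivAt_exp_neg_smul D t).clm_apply e2
    refine e3.congr_deriv ?_
    simp [hD]
  have hconst := is_const_of_deriv_eq_zero (fun t => (hd t).differentiableAt)
    (fun t => (hd t).deriv) t 0
  simp only [hh, zero_smul, neg_zero, NormedSpace.exp_zero] at hconst
  have e := congrArg (NormedSpace.exp (t • D) : S →L[ℝ] S) hconst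
  rw [exp_comp_exp_neg] at e
  exact e.symm

variable {E : Type*} [NormedAddCommGroup E] [NormedSpace ℝ E] [FiniteDimensional ℝ E]
  {G : Type*} [TopologicalSpace G] [ChartedSpace E G] [Group G] [LieGroup 𝓘(ℝ, E) ∞ G]
  {ι : S ≃L[ℝ] GroupLieAlgebra 𝓘(ℝ, E) G} {c : S →L[ℝ] S →L[ℝ] S} {D : S →L[ℝ] S}

/-- The vector field on a Lie group which integrates a derivation `D` of its Lie algebra, written in
the left invariant frame near the identity. -/
theorem exists_derivation_field (hc : ∀ X Y, c X Y = ι.symm ⁅ι X, ι Y⁆)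
    (hD : ∀ X Y, D (c X Y) = c (D X) Y + c X (D Y)) :
    ∃ ξ : E → S, ∀ᶠ x in 𝓝 (idChart E G 1), ContDiffAt ℝ ∞ ξ x ∧
      ∀ X, fderiv ℝ ξ x (chartFrame ι x X) = D X - c X (ξ x) := by
  have : CompleteSpace E := FiniteDimensional.complete ℝ E
  have : CompleteSpace S := FiniteDimensional.complete ℝ S
  have : LieGroup 𝓘(ℝ, E) (minSmoothness ℝ 3) G := by
    rw [minSmoothness_of_isRCLikeNormedField]; infer_instance
  have ht : ∀ᶠ x in 𝓝 (idChart E G 1), x ∈ (idChart E G).target :=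
    extChartAt_target_mem_nhds (I := 𝓘(ℝ, E)) (1 : G)
  have hskew : ∀ X Y, c X Y = - c Y X := fun X Y => by
    rw [hc, hc, ← map_neg, lie_skew]
  have hjac : ∀ X Y Z, c X (c Y Z) = c (c X Y) Z + c Y (c X Z) := fun X Y Z => by
    simp only [hc, ι.apply_symm_apply, ← map_add]
    rw [leibniz_lie]
  obtain ⟨ξ, -, hξ⟩ := exists_frame_solution (B := chartFrame ι) (R := fun y => D - c.flip y)
    (c := fun X Y => c X Y) (x₀ := idChart E G 1) (y₀ := (0 : S))
    (ht.mono fun x hx => contDiffAt_chartFrame ι hx)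
    (Eventually.of_forall fun y => contDiffAt_const.sub c.flip.contDiff.contDiffAt)
    (isInvertible_chartFrame ι ht.self_of_nhds)
    (ht.mono fun x hx X Y => by simp only [hc]; exact lieBracket_chartFrame ι hx X Y)
    (Eventually.of_forall fun y X Y => by
      have hd : fderiv ℝ (fun y => D - c.flip y) y = -c.flip := by
        have h1 : HasFDerivAt (fun y => D - c.flip y) (-c.flip) y :=
          c.flip.hasFDerivAt.const_sub D
        exact h1.fderiv
      rw [hd]
      simp only [neg_apply, ContinuousLinearMap.flip_apply, sub_apply, map_sub, hD]
      rw [hskew Y (D X), hjac X Y y]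
      abel)
  exact ⟨ξ, hξ.mono fun x hx => ⟨hx.1, fun X => by simpa using hx.2.2 X⟩⟩

/-- The frame of `ℝ × E` given by `∂ₜ` and the left invariant vector fields twisted by
`e^{-tD}`. -/
def flowFrame (ι : S ≃L[ℝ] GroupLieAlgebra 𝓘(ℝ, E) G) (D : S →L[ℝ] S) (z : ℝ × E) :
    ℝ × S →L[ℝ] ℝ × E :=
  ContinuousLinearMap.inl ℝ ℝ E ∘L .fst ℝ ℝ S
    + .inr ℝ ℝ E ∘L (chartFrame ι z.2 ∘L NormedSpace.exp (-(z.1 • D))) ∘L .snd ℝ ℝ S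

theorem contDiff_exp_neg_smul (D : S →L[ℝ] S) :
    ContDiff ℝ ∞ fun t : ℝ => (NormedSpace.exp (-(t • D)) : S →L[ℝ] S) := by
  have : CompleteSpace S := FiniteDimensional.complete ℝ S
  have h : ContDiff ℝ ∞ fun A : S →L[ℝ] S => NormedSpace.exp A :=
    contDiff_iff_contDiffAt.2 fun A => (NormedSpace.exp_analytic (𝕂 := ℝ) A).contDiffAt
  exact h.comp (contDiff_id.smul contDiff_const).neg

theorem flowFrame_apply (z : ℝ × E) (X : ℝ × S) : flowFrame ι D z X
    = (X.1, chartFrame ι z.2 ((NormedSpace.exp (-(z.1 • D)) : S →L[ℝ] S) X.2)) := by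
  simp [flowFrame]

theorem contDiffAt_flowFrame {z : ℝ × E} (hz : z.2 ∈ (idChart E G).target) :
    ContDiffAt ℝ ∞ (flowFrame ι D) z := by
  have h1 : ContDiffAt ℝ ∞ (fun z : ℝ × E => chartFrame ι z.2) z :=
    ContDiffAt.comp z (contDiffAt_chartFrame ι hz) contDiffAt_snd
  have h2 : ContDiffAt ℝ ∞ (fun z : ℝ × E => (NormedSpace.exp (-(z.1 • D)) : S →L[ℝ] S)) z :=
    ContDiffAt.comp (g := fun t : ℝ => (NormedSpace.exp (-(t • D)) : S →L[ℝ] S)) (f := Prod.fst) z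
      (contDiff_exp_neg_smul D).contDiffAt contDiffAt_fst
  exact contDiffAt_const.add
    (contDiffAt_const.clm_comp ((h1.clm_comp h2).clm_comp contDiffAt_const))

theorem isInvertible_flowFrame {z : ℝ × E} (hz : z.2 ∈ (idChart E G).target) :
    (flowFrame ι D z).IsInvertible := by
  obtain ⟨e, he⟩ := isInvertible_chartFrame ι hz
  refine ⟨(ContinuousLinearEquiv.refl ℝ ℝ).prodCongr ((expEquiv (-(z.1 • D))).trans e), ?_⟩
  ext X <;> simp [flowFrame, ← he, expEquiv]

/-- The derivative of `flowFrame` has one term from the frame on `E` and one from the factor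
`e^{-tD}`. -/
theorem fderiv_flowFrame {z : ℝ × E} (hz : z.2 ∈ (idChart E G).target) (u : ℝ × E) (Y : ℝ × S) :
    fderiv ℝ (flowFrame ι D) z u Y =
      (0, fderiv ℝ (chartFrame ι) z.2 u.2 ((NormedSpace.exp (-(z.1 • D)) : S →L[ℝ] S) Y.2)
        - u.1 • chartFrame ι z.2 ((NormedSpace.exp (-(z.1 • D)) : S →L[ℝ] S) (D Y.2))) := by
  have hd : HasFDerivAt (chartFrame ι) (fderiv ℝ (chartFrame ι) z.2) z.2 :=
    ((contDiffAt_chartFrame ι hz).differentiableAt (by simp)).hasFDerivAt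
  have d1 : HasFDerivAt (fun z : ℝ × E => chartFrame ι z.2)
      (fderiv ℝ (chartFrame ι) z.2 ∘L .snd ℝ ℝ E) z := hd.comp z hasFDerivAt_snd
  have d2 : HasFDerivAt (fun z : ℝ × E => (NormedSpace.exp (-(z.1 • D)) : S →L[ℝ] S) Y.2)
      (ContinuousLinearMap.smulRight (ContinuousLinearMap.fst ℝ ℝ E)
        (-((NormedSpace.exp (-(z.1 • D)) : S →L[ℝ] S) (D Y.2)))) z := by
    have h1 : HasDerivAt (fun t : ℝ => (NormedSpace.exp (-(t • D)) : S →L[ℝ] S) Y.2)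
        (-((NormedSpace.exp (-(z.1 • D)) : S →L[ℝ] S) (D Y.2))) z.1 := by
      simpa using (hasDerivAt_exp_neg_smul D z.1).clm_apply (hasDerivAt_const z.1 Y.2)
    refine (h1.hasFDerivAt.comp z hasFDerivAt_fst).congr_fderiv ?_
    ext <;> simp
  have d3 := (hasFDerivAt_const Y.1 z).prodMk (d1.clm_apply d2)
  have hdf : DifferentiableAt ℝ (flowFrame ι D) z :=
    (contDiffAt_flowFrame hz).differentiableAt (by simp)
  have d4 := hdf.hasFDerivAt.clm_apply (hasFDerivAt_const Y z)
  have d5 : HasFDerivAt (fun z => flowFrame ι D z Y) _ z :=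
    d3.congr_of_eventuallyEq (Eventually.of_forall fun z => flowFrame_apply z Y)
  have := DFunLike.congr_fun (d4.unique d5) u
  simp at this
  rw [this]
  ext
  · simp
  · simp [sub_eq_add_neg, add_comm]

/-- For a derivation `D` of the Lie algebra, the local maps with logarithmic derivative `e^{tD}`
can be chosen to depend smoothly on `t`. -/
theorem exists_local_flow (hc : ∀ X Y, c X Y = ι.symm ⁅ι X, ι Y⁆)
    (hD : ∀ X Y, D (c X Y) = c (D X) Y + c X (D Y)) :
    ∃ F : ℝ × E → E, F (0, idChart E G 1) = idChart E G 1 ∧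
      ∀ᶠ z in 𝓝 (0, idChart E G 1), ContDiffAt ℝ ∞ F z ∧ ∀ X,
        fderiv ℝ F z (0, chartFrame ι z.2 X)
          = chartFrame ι (F z) ((NormedSpace.exp (z.1 • D) : S →L[ℝ] S) X) := by
  have : CompleteSpace E := FiniteDimensional.complete ℝ E
  have : CompleteSpace S := FiniteDimensional.complete ℝ S
  have : LieGroup 𝓘(ℝ, E) (minSmoothness ℝ 3) G := by
    rw [minSmoothness_of_isRCLikeNormedField]; infer_instance
  obtain ⟨ξ, hξ⟩ := exists_derivation_field hc hD
  have ht : ∀ᶠ x in 𝓝 (idChart E G 1), x ∈ (idChart E G).target :=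
    extChartAt_target_mem_nhds (I := 𝓘(ℝ, E)) (1 : G)
  have ht2 : ∀ᶠ z in 𝓝 ((0 : ℝ), idChart E G 1), z.2 ∈ (idChart E G).target :=
    (continuous_snd.tendsto ((0 : ℝ), idChart E G 1)).eventually ht
  have hskew : ∀ X Y, c X Y = - c Y X := fun X Y => by
    rw [hc, hc, ← map_neg, lie_skew]
  have hBr : ∀ x ∈ (idChart E G).target, ∀ X Y,
      fderiv ℝ (chartFrame ι) x (chartFrame ι x X) Y
        - fderiv ℝ (chartFrame ι) x (chartFrame ι x Y) X = chartFrame ι x (c X Y) :=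
    fun x hx X Y => by rw [hc]; exact lieBracket_chartFrame ι hx X Y
  obtain ⟨F, hF0, hF⟩ := exists_frame_solution (B := flowFrame ι D)
    (R := fun y => ContinuousLinearMap.smulRight (ContinuousLinearMap.fst ℝ ℝ S)
      (chartFrame ι y (ξ y)) + chartFrame ι y ∘L .snd ℝ ℝ S)
    (c := fun X Y => ((0 : ℝ), c X.2 Y.2 - X.1 • D Y.2 + Y.1 • D X.2))
    (x₀ := ((0 : ℝ), idChart E G 1)) (y₀ := idChart E G 1)
    (ht2.mono fun z hz => contDiffAt_flowFrame hz)
    (by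
      filter_upwards [ht, hξ] with y hy hξy
      have h1 := contDiffAt_chartFrame ι hy
      exact (contDiffAt_const.smulRight (h1.clm_apply hξy.1)).add (h1.clm_comp contDiffAt_const))
    (isInvertible_flowFrame ht2.self_of_nhds)
    (by
      filter_upwards [ht2] with z hz X Y
      rw [fderiv_flowFrame hz, fderiv_flowFrame hz]
      simp only [flowFrame_apply, Prod.mk_sub_mk, sub_zero]
      have hexp : ∀ X Y, (NormedSpace.exp (-(z.1 • D)) : S →L[ℝ] S) (c X Y)
          = c ((NormedSpace.exp (-(z.1 • D)) : S →L[ℝ] S) X)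
            ((NormedSpace.exp (-(z.1 • D)) : S →L[ℝ] S) Y) := by
        intro X Y
        have := exp_derivation_apply hD (-z.1) X Y
        rwa [neg_smul] at this
      congr 1
      rw [map_add, map_sub, map_add, map_sub, hexp, ← hBr _ hz]
      simp only [map_smul]
      abel)
    (by
      filter_upwards [ht, hξ] with y hy hξy X Y
      have hd : HasFDerivAt (chartFrame ι) (fderiv ℝ (chartFrame ι) y) y :=
        ((contDiffAt_chartFrame ι hy).differentiableAt (by simp)).hasFDerivAt
      have hdξ : HasFDerivAt ξ (fderiv ℝ ξ y) y := (hξy.1.differentiableAt (by simp)).hasFDerivAt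
      have hR : ∀ u (Y : ℝ × S), fderiv ℝ (fun y => ContinuousLinearMap.smulRight
          (ContinuousLinearMap.fst ℝ ℝ S) (chartFrame ι y (ξ y)) + chartFrame ι y ∘L .snd ℝ ℝ S) y u Y
          = fderiv ℝ (chartFrame ι) y u (Y.1 • ξ y + Y.2) + Y.1 • chartFrame ι y (fderiv ℝ ξ y u) := by
        intro u Y
        have hdR : DifferentiableAt ℝ (fun y => ContinuousLinearMap.smulRight
            (ContinuousLinearMap.fst ℝ ℝ S) (chartFrame ι y (ξ y))
              + chartFrame ι y ∘L .snd ℝ ℝ S) y := by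
          have h1 := contDiffAt_chartFrame ι hy
          exact ((contDiffAt_const.smulRight (h1.clm_apply hξy.1)).add
            (h1.clm_comp contDiffAt_const)).differentiableAt (by simp)
        have d1 := hdR.hasFDerivAt.clm_apply (hasFDerivAt_const Y y)
        have d2 := ((hd.clm_apply hdξ).const_smul Y.1).add (hd.clm_apply (hasFDerivAt_const Y.2 y))
        have := DFunLike.congr_fun (d1.unique d2) u
        simp at this
        rw [this, map_add, map_smul]
        abel
      rw [hR, hR]
      have e := hBr y hy (X.1 • ξ y + X.2) (Y.1 • ξ y + Y.2)
      have e2 : ∀ X : ℝ × S, (ContinuousLinearMap.smulRight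
          (ContinuousLinearMap.fst ℝ ℝ S) (chartFrame ι y (ξ y)) + chartFrame ι y ∘L .snd ℝ ℝ S) X
          = chartFrame ι y (X.1 • ξ y + X.2) := by
        intro X; simp
      have hcc : c (ξ y) (ξ y) = 0 := by rw [hc, lie_self, map_zero]
      have e3 : c (X.1 • ξ y + X.2) (Y.1 • ξ y + Y.2)
          = Y.1 • c X.2 (ξ y) - X.1 • c Y.2 (ξ y) + c X.2 Y.2 := by
        simp only [map_add, map_smul, add_apply, smul_apply, hcc, hskew (ξ y) Y.2]
        module
      rw [e3] at e
      rw [e2, e2, e2, hξy.2, hξy.2]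
      simp only [map_add, map_sub, map_smul, add_apply, smul_apply, hcc, zero_smul, zero_add] at e ⊢
      rw [eq_add_of_sub_eq e]
      module)
  refine ⟨F, hF0, ?_⟩
  filter_upwards [hF] with z hz
  refine ⟨hz.1, fun X => ?_⟩
  have := hz.2.2 (0, (NormedSpace.exp (z.1 • D) : S →L[ℝ] S) X)
  rw [flowFrame_apply, exp_neg_comp_exp] at this
  simpa using this

end OneParameter

/-! ### Joint smoothness of one-parameter groups -/

section FlowSmoothness

open Filter Topology

variable {S : Type*} [NormedAddCommGroup S] [NormedSpace ℝ S] [FiniteDimensional ℝ S]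
  {E : Type*} [NormedAddCommGroup E] [NormedSpace ℝ E] [FiniteDimensional ℝ E]
  {G : Type*} [TopologicalSpace G] [ChartedSpace E G] [Group G] [LieGroup 𝓘(ℝ, E) ∞ G]
  {ι : S ≃L[ℝ] GroupLieAlgebra 𝓘(ℝ, E) G} {c : S →L[ℝ] S →L[ℝ] S} {D : S →L[ℝ] S}

/-- Endomorphisms `Φ t` of a Lie group with differentials `e^{tD}` depend smoothly on `t`, at `t = 0`
and near the identity: there `Φ t g = f (t, 1)⁻¹ f (t, g)` for the smooth local maps `f` of
`exists_local_flow`. -/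
theorem eventually_contMDiffAt_flow
    {Θ : ℝ → GroupLieAlgebra 𝓘(ℝ, E) G →L[ℝ] GroupLieAlgebra 𝓘(ℝ, E) G}
    {Φ : ℝ → G →* G} (hc : ∀ X Y, c X Y = ι.symm ⁅ι X, ι Y⁆)
    (hD : ∀ X Y, D (c X Y) = c (D X) Y + c X (D Y))
    (hΘ : ∀ t X, Θ t (ι X) = ι ((NormedSpace.exp (t • D) : S →L[ℝ] S) X))
    (hΦ : ∀ t g, HasLogDerivAt (Θ t) (Φ t) g) :
    ∀ᶠ g in 𝓝 (1 : G), ContMDiffAt (𝓘(ℝ, ℝ).prod 𝓘(ℝ, E)) 𝓘(ℝ, E) ∞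
      (fun z : ℝ × G => Φ z.1 z.2) (0, g) := by
  obtain ⟨F, hF0, hF⟩ := exists_local_flow hc hD
  set x₀ := idChart E G 1 with hx₀
  have hFt : ∀ᶠ z in 𝓝 ((0 : ℝ), x₀), F z ∈ (idChart E G).target := by
    have h1 := hF.self_of_nhds.1.continuousAt
    rw [ContinuousAt, hF0] at h1
    exact h1.eventually (extChartAt_target_mem_nhds (I := 𝓘(ℝ, E)) (1 : G))
  have hcont : ContinuousAt (fun z : ℝ × G => (z.1, idChart E G z.2)) (0, 1) :=
    continuousAt_fst.prodMk (ContinuousAt.comp (g := idChart E G) (f := Prod.snd)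
      (continuousAt_extChartAt (I := 𝓘(ℝ, E)) (1 : G)) continuousAt_snd)
  have hs : ∀ᶠ z in 𝓝 ((0 : ℝ), (1 : G)), z.2 ∈ (idChart E G).source :=
    continuousAt_snd.eventually (extChartAt_source_mem_nhds (I := 𝓘(ℝ, E)) (1 : G))
  have hall := (hcont.eventually (hF.and hFt)).and hs
  rw [nhds_prod_eq] at hall
  obtain ⟨pa, hpa, pb, hpb, hP⟩ := eventually_prod_iff.1 hall
  have : LocallyConnectedSpace G := ChartedSpace.locallyConnectedSpace E G
  obtain ⟨V, hVpb, hVo, h1V, hVc⟩ :=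
    locallyConnectedSpace_iff_subsets_isOpen_isConnected.1 ‹_› (1 : G) {g | pb g} hpb
  set f : ℝ × G → G := fun z => (idChart E G).symm (F (z.1, idChart E G z.2)) with hf
  have hlog : ∀ t, pa t → ∀ g ∈ V, HasLogDerivAt (Θ t) (fun g => f (t, g)) g := by
    intro t ht g hg
    obtain ⟨⟨⟨hz1, hz2⟩, hz3⟩, hz4⟩ := hP ht (hVpb hg)
    have hd : HasFDerivAt (fun x => F (t, x))
        (fderiv ℝ F (t, idChart E G g) ∘L .inr ℝ ℝ E) (idChart E G g) :=
      (hz1.differentiableAt (by simp)).hasFDerivAt.comp _ (hasFDerivAt_prodMk_right t _)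
    refine hasLogDerivAt_of_chart ι ι (hΘ t) (F := fun x => F (t, x)) hz4 hz3
      hd.differentiableAt (fun X => ?_)
    rw [hd.fderiv]
    simpa using hz2 X
  have hsm : ∀ g ∈ V, ContMDiffAt (𝓘(ℝ, ℝ).prod 𝓘(ℝ, E)) 𝓘(ℝ, E) ∞ f (0, g) := by
    intro g hg
    obtain ⟨⟨⟨hz1, hz2⟩, hz3⟩, hz4⟩ := hP hpa.self_of_nhds (hVpb hg)
    have h1 : ContMDiffAt (𝓘(ℝ, ℝ).prod 𝓘(ℝ, E)) 𝓘(ℝ, ℝ × E) ∞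
        (fun z : ℝ × G => (z.1, idChart E G z.2)) (0, g) :=
      contMDiffAt_fst.prodMk_space
        (ContMDiffAt.comp (g := idChart E G) (0, g) (contMDiffAt_idChart hz4) contMDiffAt_snd)
    have h2 := ContMDiffAt.comp (g := F) (0, g) hz1.contMDiffAt h1
    exact ContMDiffAt.comp (g := (idChart E G).symm) (0, g) (contMDiffAt_idChart_symm hz3) h2
  have heq : ∀ t, pa t → ∀ g ∈ V, Φ t g = (f (t, 1))⁻¹ * f (t, g) := by
    intro t ht
    refine eqOn_of_hasLogDerivAt hVo hVc.isPreconnected (fun x _ => hΦ t x) (fun x hx => ?_) h1V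
      (by simp)
    have h := (hlog t ht (1 * x) (by rwa [one_mul])).translate (f (t, 1))⁻¹
    simpa using h
  filter_upwards [hVo.mem_nhds h1V] with g hg
  have h1 : ContMDiffAt (𝓘(ℝ, ℝ).prod 𝓘(ℝ, E)) 𝓘(ℝ, E) ∞ (fun z : ℝ × G => f (z.1, 1)) (0, g) :=
    ContMDiffAt.comp (g := f) (f := fun z : ℝ × G => (z.1, (1 : G))) (0, g) (hsm 1 h1V)
      (contMDiffAt_fst.prodMk contMDiffAt_const)
  refine (h1.inv.mul (hsm g hg)).congr_of_eventuallyEq ?_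
  rw [nhds_prod_eq]
  filter_upwards [hpa.prod_mk (hVo.mem_nhds hg)] with z hz
  exact heq z.1 hz.1 z.2 hz.2

/-- A one-parameter group of automorphisms of a connected Lie group with differentials `e^{tD}` is
smooth in both variables. -/
theorem contMDiff_flow [PreconnectedSpace G]
    {Θ : ℝ → GroupLieAlgebra 𝓘(ℝ, E) G →L[ℝ] GroupLieAlgebra 𝓘(ℝ, E) G}
    {Φ : ℝ → G →* G} (hc : ∀ X Y, c X Y = ι.symm ⁅ι X, ι Y⁆)
    (hD : ∀ X Y, D (c X Y) = c (D X) Y + c X (D Y))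
    (hΘ : ∀ t X, Θ t (ι X) = ι ((NormedSpace.exp (t • D) : S →L[ℝ] S) X))
    (hΦ : ∀ t g, HasLogDerivAt (Θ t) (Φ t) g) (hsm : ∀ t, ContMDiff 𝓘(ℝ, E) 𝓘(ℝ, E) ∞ (Φ t))
    (hadd : ∀ t t' g, Φ (t + t') g = Φ t (Φ t' g)) :
    ContMDiff (𝓘(ℝ, ℝ).prod 𝓘(ℝ, E)) 𝓘(ℝ, E) ∞ (fun z : ℝ × G => Φ z.1 z.2) := by
  have : ContMDiffMul 𝓘(ℝ, E) ∞ G := inferInstance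
  have : IsTopologicalGroup G := topologicalGroup_of_lieGroup 𝓘(ℝ, E) ∞
  have hev := eventually_contMDiffAt_flow hc hD hΘ hΦ
  let A : Subgroup G :=
    { carrier := {g | ContMDiffAt (𝓘(ℝ, ℝ).prod 𝓘(ℝ, E)) 𝓘(ℝ, E) ∞
        (fun z : ℝ × G => Φ z.1 z.2) (0, g)}
      one_mem' := hev.self_of_nhds
      mul_mem' := by
        intro g h hg hh
        have h1 : ContMDiffAt (𝓘(ℝ, ℝ).prod 𝓘(ℝ, E)) 𝓘(ℝ, E) ∞
            (fun z : ℝ × G => Φ z.1 g) (0, g * h) :=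
          ContMDiffAt.comp (g := fun z : ℝ × G => Φ z.1 z.2) (f := fun z : ℝ × G => (z.1, g))
            (0, g * h) hg (contMDiffAt_fst.prodMk contMDiffAt_const)
        have h2 : ContMDiffAt (𝓘(ℝ, ℝ).prod 𝓘(ℝ, E)) 𝓘(ℝ, E) ∞
            (fun z : ℝ × G => Φ z.1 (g⁻¹ * z.2)) (0, g * h) :=
          ContMDiffAt.comp_of_eq (g := fun z : ℝ × G => Φ z.1 z.2)
            (f := fun z : ℝ × G => (z.1, g⁻¹ * z.2)) hh
            (contMDiffAt_fst.prodMk (contMDiffAt_const.mul contMDiffAt_snd)) (by simp)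
        refine (h1.mul h2).congr_of_eventuallyEq (Eventually.of_forall fun z => ?_)
        simp
      inv_mem' := by
        intro g hg
        have h2 : ContMDiffAt (𝓘(ℝ, ℝ).prod 𝓘(ℝ, E)) 𝓘(ℝ, E) ∞
            (fun z : ℝ × G => Φ z.1 z.2⁻¹) (0, g⁻¹) :=
          ContMDiffAt.comp_of_eq (g := fun z : ℝ × G => Φ z.1 z.2)
            (f := fun z : ℝ × G => (z.1, z.2⁻¹)) hg
            (contMDiffAt_fst.prodMk contMDiffAt_snd.inv) (by simp)
        refine h2.inv.congr_of_eventuallyEq (Eventually.of_forall fun z => ?_)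
        simp }
  have hA : (A : Set G) = univ := by
    have ho : IsOpen (A : Set G) := A.isOpen_of_mem_nhds (g := 1) hev
    exact IsClopen.eq_univ ⟨A.isClosed_of_isOpen ho, ho⟩ ⟨1, A.one_mem⟩
  rintro ⟨t₀, g⟩
  have hg : ContMDiffAt (𝓘(ℝ, ℝ).prod 𝓘(ℝ, E)) 𝓘(ℝ, E) ∞
      (fun z : ℝ × G => Φ z.1 z.2) (0, g) := by
    have : g ∈ (A : Set G) := hA ▸ mem_univ g
    exact this
  have h2 : ContMDiffAt (𝓘(ℝ, ℝ).prod 𝓘(ℝ, E)) 𝓘(ℝ, E) ∞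
      (fun z : ℝ × G => Φ (z.1 - t₀) z.2) (t₀, g) :=
    ContMDiffAt.comp_of_eq (g := fun z : ℝ × G => Φ z.1 z.2)
      (f := fun z : ℝ × G => (z.1 - t₀, z.2)) hg
      ((contMDiffAt_fst.sub contMDiffAt_const).prodMk contMDiffAt_snd) (by simp)
  refine (ContMDiffAt.comp (g := Φ t₀) (t₀, g) (hsm t₀).contMDiffAt h2).congr_of_eventuallyEq
    (Eventually.of_forall fun z => ?_)
  simp [← hadd]

end FlowSmoothness

/-! ### Slices of homogeneous spaces -/

section Slices

open Filter Topology

variable {𝔨 : Type w} [NormedAddCommGroup 𝔨] [NormedSpace ℝ 𝔨] [FiniteDimensional ℝ 𝔨]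
  {𝔭 : Type v} [NormedAddCommGroup 𝔭] [NormedSpace ℝ 𝔭] [FiniteDimensional ℝ 𝔭]

namespace HomogeneousSpace

variable (H : HomogeneousSpace.{u} 𝔨 𝔭)

/-- The projection `π : G → G/K`. -/
def proj (g : H.G) : H.Space := (g : H.G ⧸ H.K)

theorem proj_eq_smul (g : H.G) : H.proj g = g • H.origin := by
  have h : g • H.origin = ((g • (1 : H.G) : H.G) : H.G ⧸ H.K) := rfl
  rw [h, smul_eq_mul, mul_one]
  rfl

theorem proj_mul (a g : H.G) : H.proj (a * g) = a • H.proj g := rfl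

theorem contMDiff_proj : ContMDiff 𝓘(ℝ, 𝔨 × 𝔭) 𝓘(ℝ, 𝔭) ∞ H.proj := by
  have h := H.smooth_smul.comp (contMDiff_id.prodMk (contMDiff_const (c := H.origin)))
  rwa [show H.proj = _ from funext H.proj_eq_smul]

/-- By equivariance of `π`, its differential at `g` is that at the identity, translated by `g`. -/
theorem mfderiv_proj_mulInvariantVectorField (g : H.G) (X : 𝔨 × 𝔭) :
    mfderiv 𝓘(ℝ, 𝔨 × 𝔭) 𝓘(ℝ, 𝔭) H.proj g (mulInvariantVectorField (H.ι X) g)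
      = diffEquiv (H.translation g) H.origin (H.ψ X.2) := by
  have e1 := mfderiv_comp_apply_of_eq (I := 𝓘(ℝ, 𝔨 × 𝔭)) (I'' := 𝓘(ℝ, 𝔭)) (x := (1 : H.G))
    (I' := 𝓘(ℝ, 𝔨 × 𝔭)) (y := g) (g := H.proj) (f := fun x : H.G => g * x)
    (H.contMDiff_proj.mdifferentiableAt (by simp)) (mdifferentiableAt_mul_left g 1) (mul_one g)
    (H.ι X)
  have e2 := mfderiv_comp_apply_of_eq (I := 𝓘(ℝ, 𝔨 × 𝔭)) (I'' := 𝓘(ℝ, 𝔭)) (x := (1 : H.G))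
    (I' := 𝓘(ℝ, 𝔭)) (y := H.origin) (g := fun p : H.Space => g • p) (f := H.proj)
    ((H.contMDiff_translation g).mdifferentiableAt (by simp))
    (H.contMDiff_proj.mdifferentiableAt (by simp)) rfl (H.ι X)
  have e3 : mfderiv 𝓘(ℝ, 𝔨 × 𝔭) 𝓘(ℝ, 𝔭) H.proj 1 (H.ι X) = H.ψ X.2 := H.mfderiv_proj X.1 X.2
  rw [e3] at e2
  exact e1.symm.trans e2

/-- Coordinates of `G` near the identity adapted to the fibration `π : G → G/K`: `ν (z, y)` lies
over the point of `G/K` with coordinates `y`. -/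
theorem exists_slice :
    ∃ (ν : 𝔨 × 𝔭 → H.G) (z : H.G → 𝔨), ν (0, extChartAt 𝓘(ℝ, 𝔭) H.origin H.origin) = 1 ∧
      ContMDiffAt 𝓘(ℝ, 𝔨 × 𝔭) 𝓘(ℝ, 𝔨 × 𝔭) ∞ ν (0, extChartAt 𝓘(ℝ, 𝔭) H.origin H.origin) ∧
      (∀ᶠ x in 𝓝 ((0 : 𝔨), extChartAt 𝓘(ℝ, 𝔭) H.origin H.origin),
        MDifferentiableAt 𝓘(ℝ, 𝔨 × 𝔭) 𝓘(ℝ, 𝔨 × 𝔭) ν x ∧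
        H.proj (ν x) = (extChartAt 𝓘(ℝ, 𝔭) H.origin).symm x.2) ∧
      Tendsto z (𝓝 1) (𝓝 0) ∧
      ∀ᶠ g in 𝓝 (1 : H.G), ν (z g, extChartAt 𝓘(ℝ, 𝔭) H.origin (H.proj g)) = g := by
  have : CompleteSpace (𝔨 × 𝔭) := FiniteDimensional.complete ℝ (𝔨 × 𝔭)
  set φ := idChart (𝔨 × 𝔭) H.G with hφ
  set χ := extChartAt 𝓘(ℝ, 𝔭) H.origin with hχ
  set x₀ := φ 1 with hx₀
  have hx₀t : x₀ ∈ φ.target := mem_extChartAt_target (I := 𝓘(ℝ, 𝔨 × 𝔭)) (1 : H.G)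
  have hφx₀ : φ.symm x₀ = 1 := extChartAt_to_inv (I := 𝓘(ℝ, 𝔨 × 𝔭)) (1 : H.G)
  obtain ⟨M, hM⟩ := isInvertible_chartFrame H.ι hx₀t
  -- the second coordinate is `π` in charts
  set P : 𝔨 × 𝔭 → 𝔭 := fun x => χ (H.proj (φ.symm x)) with hP
  have hP1 : ContMDiffAt 𝓘(ℝ, 𝔨 × 𝔭) 𝓘(ℝ, 𝔭) ∞ P x₀ := by
    have h1 : ContMDiffAt 𝓘(ℝ, 𝔨 × 𝔭) 𝓘(ℝ, 𝔨 × 𝔭) ∞ φ.symm x₀ := contMDiffAt_idChart_symm hx₀t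
    have h2 : ContMDiffAt 𝓘(ℝ, 𝔨 × 𝔭) 𝓘(ℝ, 𝔭) ∞ (χ ∘ H.proj) 1 :=
      ContMDiffAt.comp (1 : H.G) (contMDiffAt_extChartAt (I := 𝓘(ℝ, 𝔭)) (x := H.origin))
        H.contMDiff_proj.contMDiffAt
    exact ContMDiffAt.comp_of_eq (g := χ ∘ H.proj) h2 h1 hφx₀
  have hPM : ∀ X : 𝔨 × 𝔭, fderiv ℝ P x₀ (M X)
      = mfderiv 𝓘(ℝ, 𝔭) 𝓘(ℝ, 𝔭) χ H.origin (H.ψ X.2) := by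
    intro X
    rw [← mfderiv_eq_fderiv]
    have h1 : MDifferentiableAt 𝓘(ℝ, 𝔨 × 𝔭) 𝓘(ℝ, 𝔨 × 𝔭) φ.symm x₀ :=
      (contMDiffAt_idChart_symm hx₀t).mdifferentiableAt (by simp)
    have h2 : MDifferentiableAt 𝓘(ℝ, 𝔨 × 𝔭) 𝓘(ℝ, 𝔭) H.proj 1 :=
      H.contMDiff_proj.mdifferentiableAt (by simp)
    have h3 : MDifferentiableAt 𝓘(ℝ, 𝔭) 𝓘(ℝ, 𝔭) χ H.origin :=
      (contMDiffAt_extChartAt (I := 𝓘(ℝ, 𝔭)) (n := ∞) (x := H.origin)).mdifferentiableAt (by simp)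
    have e1 := mfderiv_comp_apply_of_eq (I := 𝓘(ℝ, 𝔨 × 𝔭)) (I'' := 𝓘(ℝ, 𝔭)) (x := x₀)
      (I' := 𝓘(ℝ, 𝔨 × 𝔭)) (y := (1 : H.G)) (g := χ ∘ H.proj) (f := φ.symm)
      (h3.comp 1 h2) h1 hφx₀ (M X)
    have e2 := mfderiv_comp_apply (I := 𝓘(ℝ, 𝔨 × 𝔭)) (I'' := 𝓘(ℝ, 𝔭)) (x := (1 : H.G))
      (I' := 𝓘(ℝ, 𝔭)) (g := χ) (f := H.proj) h3 h2 (H.ι X)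
    have e3 : mfderiv 𝓘(ℝ, 𝔨 × 𝔭) 𝓘(ℝ, 𝔭) H.proj 1 (H.ι X) = H.ψ X.2 := H.mfderiv_proj X.1 X.2
    have e4 : mfderiv 𝓘(ℝ, 𝔨 × 𝔭) 𝓘(ℝ, 𝔨 × 𝔭) φ.symm x₀ (M X) = H.ι X := by
      have h := mfderiv_idChart_symm_chartFrame H.ι hx₀t X
      rw [← hM] at h
      have h' : mulInvariantVectorField (H.ι X) (φ.symm x₀)
          = mulInvariantVectorField (I := 𝓘(ℝ, 𝔨 × 𝔭)) (H.ι X) (1 : H.G) := by rw [hφx₀]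
      rw [mulInvariantVectorField_one] at h'
      exact h.trans h'
    rw [e3] at e2
    refine Eq.trans e1 (Eq.trans ?_ e2)
    exact congrArg (mfderiv 𝓘(ℝ, 𝔨 × 𝔭) 𝓘(ℝ, 𝔭) (χ ∘ H.proj) 1) e4
  obtain ⟨C, hC⟩ : ∃ C : TangentSpace 𝓘(ℝ, 𝔭) H.origin ≃L[ℝ] 𝔭,
      ∀ X, mfderiv 𝓘(ℝ, 𝔭) 𝓘(ℝ, 𝔭) χ H.origin X = C X := by
    obtain ⟨C, hC⟩ := isInvertible_mfderiv_extChartAt (I := 𝓘(ℝ, 𝔭))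
      (mem_extChartAt_source (I := 𝓘(ℝ, 𝔭)) H.origin)
    exact ⟨C, fun X => (DFunLike.congr_fun hC X).symm⟩
  set N : 𝔨 × 𝔭 → 𝔨 × 𝔭 := fun x => ((M.symm (x - x₀)).1, P x) with hN
  have hNs : ContDiffAt ℝ ∞ N x₀ :=
    (contDiff_fst.contDiffAt.comp x₀ (M.symm.contDiff.contDiffAt.comp x₀
      (contDiffAt_id.sub contDiffAt_const))).prodMk hP1.contDiffAt
  have hPd : HasFDerivAt P (fderiv ℝ P x₀) x₀ :=
    (hP1.contDiffAt.differentiableAt (by simp)).hasFDerivAt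
  let N' : (𝔨 × 𝔭) ≃L[ℝ] (𝔨 × 𝔭) :=
    M.symm.trans ((ContinuousLinearEquiv.refl ℝ 𝔨).prodCongr (H.ψ.trans C))
  have hNd : HasFDerivAt N (N' : 𝔨 × 𝔭 →L[ℝ] 𝔨 × 𝔭) x₀ := by
    have h1 : HasFDerivAt (fun x => (M.symm (x - x₀)).1)
        (ContinuousLinearMap.fst ℝ 𝔨 𝔭 ∘L (M.symm : 𝔨 × 𝔭 →L[ℝ] 𝔨 × 𝔭)) x₀ := by
      exact HasFDerivAt.comp (f := fun x => x - x₀) x₀ (ContinuousLinearMap.fst ℝ 𝔨 𝔭 ∘L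
        (M.symm : 𝔨 × 𝔭 →L[ℝ] 𝔨 × 𝔭)).hasFDerivAt ((hasFDerivAt_id x₀).sub_const x₀)
    refine (h1.prodMk hPd).congr_fderiv ?_
    refine ContinuousLinearMap.ext fun Y => ?_
    obtain ⟨X, rfl⟩ := M.surjective Y
    have := hPM X
    rw [hC] at this
    ext
    · simp [N']
    · simpa [N'] using this
  set Ninv := hNs.localInverse hNd (by simp) with hNinv
  have hN0 : N x₀ = (0, χ H.origin) := by
    simp only [hN, hP, sub_self, map_zero, Prod.fst_zero, hφx₀]
    rfl
  have hNinv_s : ContDiffAt ℝ ∞ Ninv (0, χ H.origin) := by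
    have := hNs.to_localInverse hNd (by simp)
    rwa [hN0] at this
  have hNinv0 : Ninv (0, χ H.origin) = x₀ := by
    rw [← hN0]; exact hNs.localInverse_apply_image hNd (by simp)
  have hleft : ∀ᶠ x in 𝓝 x₀, Ninv (N x) = x :=
    (hNs.hasStrictFDerivAt' hNd (by simp)).eventually_left_inverse
  have hright : ∀ᶠ y in 𝓝 ((0 : 𝔨), χ H.origin), N (Ninv y) = y := by
    have := (hNs.hasStrictFDerivAt' hNd (by simp)).eventually_right_inverse
    rwa [hN0] at this
  have htar : ∀ᶠ y in 𝓝 ((0 : 𝔨), χ H.origin), Ninv y ∈ φ.target := by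
    have h := hNinv_s.continuousAt
    rw [ContinuousAt, hNinv0] at h
    exact h.eventually (extChartAt_target_mem_nhds (I := 𝓘(ℝ, 𝔨 × 𝔭)) (1 : H.G))
  have hφc : ContinuousAt φ 1 := continuousAt_extChartAt (I := 𝓘(ℝ, 𝔨 × 𝔭)) (1 : H.G)
  have hsrc : ∀ᶠ g in 𝓝 (1 : H.G), g ∈ φ.source :=
    extChartAt_source_mem_nhds (I := 𝓘(ℝ, 𝔨 × 𝔭)) (1 : H.G)
  have hsrc' : ∀ᶠ y in 𝓝 ((0 : 𝔨), χ H.origin), H.proj (φ.symm (Ninv y)) ∈ χ.source := by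
    have h1 : ContinuousAt (fun x => H.proj (φ.symm x)) x₀ :=
      H.contMDiff_proj.continuous.continuousAt.comp
        (contMDiffAt_idChart_symm hx₀t).continuousAt
    have h2 : ContinuousAt (fun y => H.proj (φ.symm (Ninv y))) (0, χ H.origin) :=
      ContinuousAt.comp_of_eq (g := fun x => H.proj (φ.symm x)) h1 hNinv_s.continuousAt hNinv0
    refine h2.eventually_mem ?_
    rw [hNinv0, hφx₀]
    exact extChartAt_source_mem_nhds (I := 𝓘(ℝ, 𝔭)) H.origin
  refine ⟨fun y => φ.symm (Ninv y), fun g => (M.symm (φ g - x₀)).1, ?_, ?_, ?_, ?_, ?_⟩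
  · exact (congrArg φ.symm hNinv0).trans hφx₀
  · exact ContMDiffAt.comp_of_eq (g := φ.symm) (contMDiffAt_idChart_symm hx₀t)
      hNinv_s.contMDiffAt hNinv0
  · have hsm : ∀ᶠ y in 𝓝 ((0 : 𝔨), χ H.origin), ContDiffAt ℝ 1 Ninv y :=
      (hNinv_s.of_le (by simp)).eventually (by simp)
    filter_upwards [hsm, hright, htar, hsrc'] with y hy1 hy2 hy3 hy4
    refine ⟨MDifferentiableAt.comp (g := φ.symm) y
      ((contMDiffAt_idChart_symm hy3).mdifferentiableAt (by simp))
      (hy1.differentiableAt (by simp)).mdifferentiableAt, ?_⟩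
    have h : χ (H.proj (φ.symm (Ninv y))) = y.2 := congrArg Prod.snd hy2
    rw [← h, χ.left_inv hy4]
  · have h : ContinuousAt (fun g => (M.symm (φ g - x₀)).1) 1 :=
      continuous_fst.continuousAt.comp (M.symm.continuous.continuousAt.comp
        (hφc.sub continuousAt_const))
    have := h.tendsto
    simpa [← hx₀] using this
  · filter_upwards [hφc.eventually hleft, hsrc] with g hg1 hg2
    have h : N (φ g) = ((M.symm (φ g - x₀)).1, χ (H.proj g)) := by
      simp only [hN, hP, φ.left_inv hg2]
    rw [← h, hg1, φ.left_inv hg2]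

end HomogeneousSpace

end Slices

/-! ### Maps between homogeneous spaces -/

section Quotients

open Filter Topology

variable {𝔨 : Type w} [NormedAddCommGroup 𝔨] [NormedSpace ℝ 𝔨] [FiniteDimensional ℝ 𝔨]
  {𝔭 : Type v} [NormedAddCommGroup 𝔭] [NormedSpace ℝ 𝔭] [FiniteDimensional ℝ 𝔭]

namespace HomogeneousSpace

variable (H : HomogeneousSpace.{u} 𝔨 𝔭)

theorem proj_eq_proj_iff {a b : H.G} : H.proj a = H.proj b ↔ a⁻¹ * b ∈ H.K := QuotientGroup.eq

theorem proj_surjective : Surjective H.proj := Quotient.mk_surjective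

/-- The projection `π : G → G/K` has smooth local sections. -/
theorem exists_local_section (g₀ : H.G) : ∃ σ : H.Space → H.G, σ (H.proj g₀) = g₀ ∧
    ContMDiffAt 𝓘(ℝ, 𝔭) 𝓘(ℝ, 𝔨 × 𝔭) ∞ σ (H.proj g₀) ∧
    ∀ᶠ p in 𝓝 (H.proj g₀), H.proj (σ p) = p := by
  obtain ⟨ν, z, hν1, hνs, hν, -, -⟩ := H.exists_slice
  set χ := extChartAt 𝓘(ℝ, 𝔭) H.origin with hχ
  have hχs : ContMDiffAt 𝓘(ℝ, 𝔭) 𝓘(ℝ, 𝔨 × 𝔭) ∞ (fun p => ((0 : 𝔨), χ p)) H.origin :=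
    contMDiffAt_const.prodMk_space (contMDiffAt_extChartAt (I := 𝓘(ℝ, 𝔭)) (x := H.origin))
  have hsrc : ∀ᶠ p in 𝓝 H.origin, p ∈ χ.source := extChartAt_source_mem_nhds (I := 𝓘(ℝ, 𝔭)) H.origin
  have h0 : ∀ᶠ p in 𝓝 H.origin, H.proj (ν (0, χ p)) = p := by
    filter_upwards [hχs.continuousAt.eventually hν, hsrc] with p hp hp'
    rw [hp.2, χ.left_inv hp']
  have hg : g₀⁻¹ • H.proj g₀ = H.origin := by rw [← H.proj_mul, inv_mul_cancel]; rfl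
  have htr := (H.contMDiff_translation g₀⁻¹).contMDiffAt (x := H.proj g₀)
  refine ⟨fun p => g₀ * ν (0, χ (g₀⁻¹ • p)), ?_, ?_, ?_⟩
  · change g₀ * ν (0, χ (g₀⁻¹ • H.proj g₀)) = g₀
    rw [hg, hν1, mul_one]
  · have h1 : ContMDiffAt 𝓘(ℝ, 𝔭) 𝓘(ℝ, 𝔨 × 𝔭) ∞ (fun p => ν (0, χ p)) H.origin :=
      ContMDiffAt.comp (g := ν) H.origin hνs hχs
    exact contMDiffAt_const.mul
      (ContMDiffAt.comp_of_eq (g := fun p => ν (0, χ p)) (f := fun p => g₀⁻¹ • p) h1 htr hg)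
  · have h1 : Tendsto (fun p : H.Space => g₀⁻¹ • p) (𝓝 (H.proj g₀)) (𝓝 H.origin) := by
      have := htr.continuousAt
      rwa [ContinuousAt, hg] at this
    filter_upwards [h1.eventually h0] with p hp
    rw [H.proj_mul, hp, smul_inv_smul]

section Descent

variable {EN : Type*} [NormedAddCommGroup EN] [NormedSpace ℝ EN] {N : Type*} [TopologicalSpace N]
  [ChartedSpace EN N]

/-- A map on `G/K` is smooth if its composition with the projection is. -/
theorem contMDiff_of_comp_proj {f : H.Space → N}
    (h : ContMDiff 𝓘(ℝ, 𝔨 × 𝔭) 𝓘(ℝ, EN) ∞ (f ∘ H.proj)) : ContMDiff 𝓘(ℝ, 𝔭) 𝓘(ℝ, EN) ∞ f := by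
  intro p
  obtain ⟨g, rfl⟩ := H.proj_surjective p
  obtain ⟨σ, -, hσ, hσ'⟩ := H.exists_local_section g
  refine (ContMDiffAt.comp (H.proj g) h.contMDiffAt hσ).congr_of_eventuallyEq ?_
  filter_upwards [hσ'] with p hp
  simp [hp]

/-- Smoothness descends from `ℝ × G` to `ℝ × G/K`. -/
theorem contMDiff_prod_of_comp_proj {f : ℝ × H.Space → N}
    (h : ContMDiff (𝓘(ℝ, ℝ).prod 𝓘(ℝ, 𝔨 × 𝔭)) 𝓘(ℝ, EN) ∞
      fun z : ℝ × H.G => f (z.1, H.proj z.2)) :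
    ContMDiff (𝓘(ℝ, ℝ).prod 𝓘(ℝ, 𝔭)) 𝓘(ℝ, EN) ∞ f := by
  rintro ⟨t, p⟩
  obtain ⟨g, rfl⟩ := H.proj_surjective p
  obtain ⟨σ, -, hσ, hσ'⟩ := H.exists_local_section g
  have h1 : ContMDiffAt (𝓘(ℝ, ℝ).prod 𝓘(ℝ, 𝔭)) (𝓘(ℝ, ℝ).prod 𝓘(ℝ, 𝔨 × 𝔭)) ∞
      (fun z : ℝ × H.Space => (z.1, σ z.2)) (t, H.proj g) :=
    contMDiffAt_fst.prodMk (ContMDiffAt.comp (g := σ) (t, H.proj g) hσ contMDiffAt_snd)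
  refine (ContMDiffAt.comp (t, H.proj g) h.contMDiffAt h1).congr_of_eventuallyEq ?_
  filter_upwards [continuousAt_snd.eventually hσ'] with p hp
  simp [hp]

end Descent

variable {H} {H' : HomogeneousSpace.{u} 𝔨 𝔭}
  {Θ : GroupLieAlgebra 𝓘(ℝ, 𝔨 × 𝔭) H.G →L[ℝ] GroupLieAlgebra 𝓘(ℝ, 𝔨 × 𝔭) H'.G}

/-- A homomorphism whose differential maps `𝔨` to `𝔨'` maps `K` to `K'`: the composition with the
projection to `G'/K'` has vanishing differential along `K`. -/
theorem map_mem_of_hasLogDerivAt (f : H.G →* H'.G) (hf : ∀ g, HasLogDerivAt Θ f g)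
    (hΘ : ∀ Z : 𝔨, (H'.ι.symm (Θ (H.ι (Z, 0)))).2 = 0) {k : H.G} (hk : k ∈ H.K) : f k ∈ H'.K := by
  have : IsTopologicalGroup H.G := topologicalGroup_of_lieGroup 𝓘(ℝ, 𝔨 × 𝔭) ∞
  obtain ⟨ν, z, hν1, -, hν, hz, hνz⟩ := H.exists_slice
  set y₀ := extChartAt 𝓘(ℝ, 𝔭) H.origin H.origin with hy₀
  set κ : 𝔨 → H.G := fun x => ν (x, y₀) with hκ
  have hpt : Tendsto (fun x : 𝔨 => (x, y₀)) (𝓝 0) (𝓝 (0, y₀)) :=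
    (Continuous.prodMk_left y₀).tendsto 0
  have hder : ∀ᶠ x in 𝓝 (0 : 𝔨), HasMFDerivAt 𝓘(ℝ, 𝔨) 𝓘(ℝ, 𝔭)
      (fun x => H'.proj (f (κ x))) x 0 := by
    filter_upwards [hpt.eventually hν, (hpt.eventually hν).eventually_nhds] with x hx hx'
    have hκd : MDifferentiableAt 𝓘(ℝ, 𝔨) 𝓘(ℝ, 𝔨 × 𝔭) κ x :=
      MDifferentiableAt.comp (g := ν) (I' := 𝓘(ℝ, 𝔨 × 𝔭)) (f := fun x => (x, y₀)) x hx.1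
        (differentiableAt_id.prodMk (differentiableAt_const _)).mdifferentiableAt
    have hpd := fun g => H.contMDiff_proj.mdifferentiableAt (x := g) (by simp)
    have hpd' := fun g => H'.contMDiff_proj.mdifferentiableAt (x := g) (by simp)
    have hconst : mfderiv 𝓘(ℝ, 𝔨) 𝓘(ℝ, 𝔭) (H.proj ∘ κ) x = 0 := by
      have h1 : H.proj ∘ κ =ᶠ[𝓝 x] fun _ => H.proj (κ x) := by
        filter_upwards [hx'] with x' h'
        exact h'.2.trans hx.2.symm
      exact h1.mfderiv_eq.trans mfderiv_const
    have hd : MDifferentiableAt 𝓘(ℝ, 𝔨) 𝓘(ℝ, 𝔭) (H'.proj ∘ f ∘ κ) x :=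
      (hpd' _).comp x ((hf _).1.comp x hκd)
    refine hd.hasMFDerivAt.congr_mfderiv (ContinuousLinearMap.ext fun w => ?_)
    obtain ⟨v, hv⟩ := exists_mulInvariantVectorField_eq (κ x)
      (mfderiv 𝓘(ℝ, 𝔨) 𝓘(ℝ, 𝔨 × 𝔭) κ x w)
    obtain ⟨Y, rfl⟩ := H.ι.surjective v
    have e1 := mfderiv_comp_apply x (hpd (κ x)) hκd w
    rw [hconst, ← hv, H.mfderiv_proj_mulInvariantVectorField] at e1
    have e2 : Y.2 = 0 :=
      H.ψ.injective ((diffEquiv (H.translation (κ x)) H.origin).injective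
        (e1.symm.trans (by rw [map_zero, map_zero]; rfl)))
    have e3 := mfderiv_comp_apply x (hpd' (f (κ x))) ((hf (κ x)).1.comp x hκd) w
    have e4 := mfderiv_comp_apply x (hf (κ x)).1 hκd w
    rw [← hv, (hf (κ x)).2] at e4
    obtain ⟨Y', hY'⟩ := H'.ι.surjective (Θ (H.ι Y))
    have e5 : Y'.2 = 0 := by
      have h := hΘ Y.1
      rwa [show (Y.1, (0 : 𝔭)) = Y from Prod.ext rfl e2.symm, ← hY', H'.ι.symm_apply_apply] at h
    rw [e4, ← hY'] at e3
    refine e3.trans ((H'.mfderiv_proj_mulInvariantVectorField _ _).trans ?_)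
    rw [e5, map_zero, map_zero]
    rfl
  have hκ0 : κ 0 = 1 := hν1
  have hloc : ∀ᶠ g in 𝓝 (1 : H.G), g ∈ H.K → f g ∈ H'.K := by
    filter_upwards [hνz, hz.eventually (eventually_eq_of_mfderiv_eq_zero hder)] with g hg hg' hgK
    have h1 : H.proj g = H.origin := (H.proj_eq_proj_iff (a := g) (b := 1)).2 (by simpa using hgK)
    rw [h1] at hg
    have h2 : κ (z g) = g := hg
    rw [h2, hκ0, map_one] at hg'
    simpa using (H'.proj_eq_proj_iff).1 hg'.symm
  have : ConnectedSpace H.K := isConnected_iff_connectedSpace.1 H.isConnected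
  let B : Subgroup H.K := (H'.K.comap f).subgroupOf H.K
  have hB : (B : Set H.K) = univ := by
    have ho : IsOpen (B : Set H.K) := by
      refine B.isOpen_of_mem_nhds (g := 1) ?_
      have h := (continuous_subtype_val (p := fun g => g ∈ H.K)).continuousAt (x := 1)
      filter_upwards [h.eventually hloc] with g hg
      exact hg g.2
    exact IsClopen.eq_univ ⟨B.isClosed_of_isOpen ho, ho⟩ ⟨1, B.one_mem⟩
  have : (⟨k, hk⟩ : H.K) ∈ (B : Set H.K) := hB ▸ mem_univ _
  exact this

/-- The diffeomorphism `gK ↦ f(g)K'` induced by an isomorphism `f` which maps `K` to `K'`. -/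
def quotientDiffeo (f : H.G ≃* H'.G) (hf : ContMDiff 𝓘(ℝ, 𝔨 × 𝔭) 𝓘(ℝ, 𝔨 × 𝔭) ∞ f)
    (hf' : ContMDiff 𝓘(ℝ, 𝔨 × 𝔭) 𝓘(ℝ, 𝔨 × 𝔭) ∞ f.symm) (hK : ∀ g, g ∈ H.K ↔ f g ∈ H'.K) :
    H.Space ≃ₘ^∞⟮𝓘(ℝ, 𝔭), 𝓘(ℝ, 𝔭)⟯ H'.Space where
  toEquiv := Quotient.congr f.toEquiv fun a b => by
    rw [QuotientGroup.leftRel_apply, QuotientGroup.leftRel_apply, hK, map_mul, map_inv]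
    rfl
  contMDiff_toFun := H.contMDiff_of_comp_proj (H'.contMDiff_proj.comp hf)
  contMDiff_invFun := H'.contMDiff_of_comp_proj (H.contMDiff_proj.comp hf')

theorem quotientDiffeo_proj (f : H.G ≃* H'.G) (hf : ContMDiff 𝓘(ℝ, 𝔨 × 𝔭) 𝓘(ℝ, 𝔨 × 𝔭) ∞ f)
    (hf' : ContMDiff 𝓘(ℝ, 𝔨 × 𝔭) 𝓘(ℝ, 𝔨 × 𝔭) ∞ f.symm) (hK : ∀ g, g ∈ H.K ↔ f g ∈ H'.K)
    (g : H.G) : quotientDiffeo f hf hf' hK (H.proj g) = H'.proj (f g) := rfl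

/-- An isomorphism between the Lie algebras of two homogeneous spaces which maps `𝔨` to `𝔨'` is
induced by an isomorphism of the groups which maps `K` to `K'`, and hence by a diffeomorphism of the
homogeneous spaces. -/
theorem exists_isomorphism (H H' : HomogeneousSpace.{u} 𝔨 𝔭) (θ : (𝔨 × 𝔭) ≃L[ℝ] (𝔨 × 𝔭))
    (hθ : ∀ X Y, θ (H.bracket X Y) = H'.bracket (θ X) (θ Y))
    (h1 : ∀ Z : 𝔨, (θ (Z, 0)).2 = 0) (h2 : ∀ Z : 𝔨, (θ.symm (Z, 0)).2 = 0) :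
    ∃ (f : H.G ≃* H'.G) (φ : H.Space ≃ₘ^∞⟮𝓘(ℝ, 𝔭), 𝓘(ℝ, 𝔭)⟯ H'.Space),
      ContMDiff 𝓘(ℝ, 𝔨 × 𝔭) 𝓘(ℝ, 𝔨 × 𝔭) ∞ f ∧
      (∀ g, HasLogDerivAt (((H.ι.symm.trans θ).trans H'.ι :
        GroupLieAlgebra 𝓘(ℝ, 𝔨 × 𝔭) H.G ≃L[ℝ] GroupLieAlgebra 𝓘(ℝ, 𝔨 × 𝔭) H'.G) :
        GroupLieAlgebra 𝓘(ℝ, 𝔨 × 𝔭) H.G →L[ℝ] GroupLieAlgebra 𝓘(ℝ, 𝔨 × 𝔭) H'.G) f g) ∧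
      (∀ g, g ∈ H.K ↔ f g ∈ H'.K) ∧ (∀ g, φ (H.proj g) = H'.proj (f g)) ∧
      ∀ X : 𝔭, diffEquiv φ H.origin (H.ψ X) = H'.ψ (θ (0, X)).2 := by
  set Θ := (H.ι.symm.trans θ).trans H'.ι with hΘdef
  have hΘ : ∀ v w, Θ ⁅v, w⁆ = ⁅Θ v, Θ w⁆ := by
    intro v w
    obtain ⟨X, rfl⟩ := H.ι.surjective v
    obtain ⟨Y, rfl⟩ := H.ι.surjective w
    have h := hθ X Y
    rw [bracket_apply, bracket_apply] at h
    simp only [hΘdef, ContinuousLinearEquiv.trans_apply, ContinuousLinearEquiv.symm_apply_apply, h,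
      ContinuousLinearEquiv.apply_symm_apply]
  obtain ⟨f, hf, hf', hlog, hlog'⟩ := exists_mulEquiv_hasLogDerivAt Θ hΘ
  have hK : ∀ g, g ∈ H.K ↔ f g ∈ H'.K := by
    refine fun g => ⟨fun hg => ?_, fun hg => ?_⟩
    · exact map_mem_of_hasLogDerivAt f.toMonoidHom hlog (fun Z => by simp [hΘdef, h1]) hg
    · have := map_mem_of_hasLogDerivAt f.symm.toMonoidHom hlog' (fun Z => by simp [hΘdef, h2]) hg
      simpa using this
  refine ⟨f, quotientDiffeo f hf hf' hK, hf, hlog, hK, quotientDiffeo_proj f hf hf' hK, fun X => ?_⟩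
  set φ := quotientDiffeo f hf hf' hK
  have hφd : MDifferentiableAt 𝓘(ℝ, 𝔭) 𝓘(ℝ, 𝔭) φ H.origin :=
    φ.contMDiff_toFun.mdifferentiableAt (by simp)
  have e1 := mfderiv_comp_apply_of_eq (I := 𝓘(ℝ, 𝔨 × 𝔭)) (I'' := 𝓘(ℝ, 𝔭)) (I' := 𝓘(ℝ, 𝔭))
    (x := (1 : H.G)) (y := H.origin) (g := φ) (f := H.proj) hφd
    (H.contMDiff_proj.mdifferentiableAt (by simp)) rfl (H.ι (0, X))
  have e2 := mfderiv_comp_apply_of_eq (I := 𝓘(ℝ, 𝔨 × 𝔭)) (I'' := 𝓘(ℝ, 𝔭)) (I' := 𝓘(ℝ, 𝔨 × 𝔭))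
    (x := (1 : H.G)) (y := (1 : H'.G)) (g := H'.proj) (f := f)
    (H'.contMDiff_proj.mdifferentiableAt (by simp)) (hlog 1).1 (map_one f) (H.ι (0, X))
  have e3 : mfderiv 𝓘(ℝ, 𝔨 × 𝔭) 𝓘(ℝ, 𝔭) H.proj 1 (H.ι (0, X)) = H.ψ X := H.mfderiv_proj 0 X
  have e4 : mfderiv 𝓘(ℝ, 𝔨 × 𝔭) 𝓘(ℝ, 𝔨 × 𝔭) f 1 (H.ι (0, X)) = H'.ι (θ (0, X)) := by
    refine ((hlog 1).mfderiv_one (map_one f) _).trans ?_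
    exact congrArg (fun X => H'.ι (θ X)) (H.ι.symm_apply_apply (0, X))
  have e5 : mfderiv 𝓘(ℝ, 𝔨 × 𝔭) 𝓘(ℝ, 𝔭) H'.proj 1 (H'.ι (θ (0, X))) = H'.ψ (θ (0, X)).2 :=
    H'.mfderiv_proj _ _
  rw [e3] at e1
  refine e1.symm.trans (Eq.trans e2 (Eq.trans ?_ e5))
  exact congrArg (mfderiv 𝓘(ℝ, 𝔨 × 𝔭) 𝓘(ℝ, 𝔭) H'.proj 1) e4

end HomogeneousSpace

end Quotients

/-! ### Flows of derivations on homogeneous spaces -/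

section Flows

open Filter Topology

variable {𝔨 : Type w} [NormedAddCommGroup 𝔨] [NormedSpace ℝ 𝔨] [FiniteDimensional ℝ 𝔨]
  {𝔭 : Type v} [NormedAddCommGroup 𝔭] [NormedSpace ℝ 𝔭] [FiniteDimensional ℝ 𝔭]

/-- The velocity field at time `0` of a smooth family of maps starting at the identity is smooth. -/
theorem contMDiff_velocity {M : Type*} [TopologicalSpace M] [ChartedSpace 𝔭 M]
    [IsManifold 𝓘(ℝ, 𝔭) ∞ M] {Ψ : ℝ × M → M}
    (hΨ : ContMDiff (𝓘(ℝ, ℝ).prod 𝓘(ℝ, 𝔭)) 𝓘(ℝ, 𝔭) ∞ Ψ) (h0 : ∀ p, Ψ (0, p) = p) :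
    ContMDiff 𝓘(ℝ, 𝔭) 𝓘(ℝ, 𝔭).tangent ∞ (fun p => (⟨p, (mfderiv 𝓘(ℝ, ℝ) 𝓘(ℝ, 𝔭)
      (fun t : ℝ => Ψ (t, p)) 0 (1 : ℝ) : 𝔭)⟩ : TangentBundle 𝓘(ℝ, 𝔭) M)) := by
  have : IsManifold 𝓘(ℝ, 𝔭) 1 M := .of_le (n := ∞) (by simp)
  let s₀ : M → TangentBundle 𝓘(ℝ, 𝔭) M := fun p => Bundle.TotalSpace.mk' 𝔭 p 0
  have hs₀ : ContMDiff 𝓘(ℝ, 𝔭) 𝓘(ℝ, 𝔭).tangent ∞ s₀ := Bundle.contMDiff_zeroSection _ _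
  let s₁ : M → TangentBundle 𝓘(ℝ, ℝ) ℝ := fun _ => Bundle.TotalSpace.mk' ℝ (0 : ℝ) (1 : ℝ)
  have hs₁ : ContMDiff 𝓘(ℝ, 𝔭) 𝓘(ℝ, ℝ).tangent ∞ s₁ := contMDiff_const
  have h1 := (contMDiff_equivTangentBundleProd_symm (n := ∞) (I := 𝓘(ℝ, ℝ)) (M := ℝ)
    (I' := 𝓘(ℝ, 𝔭)) (M' := M)).comp (hs₁.prodMk hs₀)
  have h2 := (hΨ.contMDiff_tangentMap (m := ∞) le_rfl).comp h1
  refine h2.congr fun p => Bundle.TotalSpace.ext (h0 p).symm ?_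
  have e := mfderiv_prod_eq_add_apply (I := 𝓘(ℝ, ℝ)) (I' := 𝓘(ℝ, 𝔭)) (I'' := 𝓘(ℝ, 𝔭))
    (f := Ψ) (p := (0, p)) (v := ((1 : ℝ), (0 : 𝔭))) (hΨ.mdifferentiableAt (by simp))
  refine heq_of_eq (Eq.trans ?_ e.symm)
  have hz : mfderiv 𝓘(ℝ, 𝔭) 𝓘(ℝ, 𝔭) (fun z : M => Ψ (0, z)) p (0 : 𝔭) = 0 := map_zero _
  exact (add_zero _).symm.trans (congrArg _ hz.symm)

/-- A smooth one-parameter group of diffeomorphisms is the flow of its velocity field. -/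
theorem isFlow_velocity {M : Type*} [TopologicalSpace M] [ChartedSpace 𝔭 M]
    [IsManifold 𝓘(ℝ, 𝔭) ∞ M] {φ : ℝ → M ≃ₘ^∞⟮𝓘(ℝ, 𝔭), 𝓘(ℝ, 𝔭)⟯ M}
    (hφ : ContMDiff (𝓘(ℝ, ℝ).prod 𝓘(ℝ, 𝔭)) 𝓘(ℝ, 𝔭) ∞ (fun z : ℝ × M => φ z.1 z.2))
    (h0 : ∀ p, φ 0 p = p) (hadd : ∀ t t' p, φ (t + t') p = φ t (φ t' p)) :
    IsFlow (fun p => (mfderiv 𝓘(ℝ, ℝ) 𝓘(ℝ, 𝔭) (fun t : ℝ => φ t p) 0 (1 : ℝ) : 𝔭)) φ := by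
  refine fun p => ⟨h0 p, fun t => ?_⟩
  have hd : ∀ q t, MDifferentiableAt 𝓘(ℝ, ℝ) 𝓘(ℝ, 𝔭) (fun t : ℝ => φ t q) t := fun q t =>
    (hφ.comp (contMDiff_id.prodMk (contMDiff_const (c := q)))).mdifferentiableAt (by simp)
  refine (hd p t).hasMFDerivAt.congr_mfderiv ?_
  have hsub : HasMFDerivAt 𝓘(ℝ, ℝ) 𝓘(ℝ, ℝ) (fun τ : ℝ => τ - t) t (.id ℝ ℝ) :=
    ((hasFDerivAt_id t).sub_const t).hasMFDerivAt
  have e := mfderiv_comp_apply_of_eq (I := 𝓘(ℝ, ℝ)) (I' := 𝓘(ℝ, ℝ)) (I'' := 𝓘(ℝ, 𝔭)) (x := t)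
    (y := (0 : ℝ)) (g := fun τ : ℝ => φ τ (φ t p)) (f := fun τ : ℝ => τ - t) (hd _ 0)
    hsub.mdifferentiableAt (sub_self t) (1 : ℝ)
  have hfun : ((fun τ : ℝ => φ τ (φ t p)) ∘ fun τ : ℝ => τ - t) = fun τ => φ τ p := by
    funext τ; simp [← hadd]
  rw [hfun, hsub.mfderiv] at e
  exact ContinuousLinearMap.ext_ring (Eq.trans e (one_smul ℝ (_ : 𝔭)).symm)

/-- `e^{t diag(0, A)} = diag(I, e^{tA})`. -/
theorem exp_blockP (A : 𝔭 →L[ℝ] 𝔭) (t : ℝ) (X : 𝔨 × 𝔭) :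
    (NormedSpace.exp (t • blockP 𝔨 A) : 𝔨 × 𝔭 →L[ℝ] 𝔨 × 𝔭) X
      = (X.1, (NormedSpace.exp (t • A) : 𝔭 →L[ℝ] 𝔭) X.2) := by
  set h : ℝ → 𝔨 × 𝔭 := fun t => (NormedSpace.exp (-(t • blockP 𝔨 A)) : 𝔨 × 𝔭 →L[ℝ] 𝔨 × 𝔭)
    (X.1, (NormedSpace.exp (t • A) : 𝔭 →L[ℝ] 𝔭) X.2) with hh
  have hd : ∀ t, HasDerivAt h 0 t := by
    intro t
    have e1 : HasDerivAt (fun t : ℝ => (X.1, (NormedSpace.exp (t • A) : 𝔭 →L[ℝ] 𝔭) X.2))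
        (0, A ((NormedSpace.exp (t • A) : 𝔭 →L[ℝ] 𝔭) X.2)) t := by
      have := (hasDerivAt_exp_smul A t).clm_apply (hasDerivAt_const t X.2)
      exact (hasDerivAt_const t X.1).prodMk (by simpa using this)
    refine ((hasDerivAt_exp_neg_smul (blockP 𝔨 A) t).clm_apply e1).congr_deriv ?_
    simp [blockP]
  have hconst := is_const_of_deriv_eq_zero (fun t => (hd t).differentiableAt)
    (fun t => (hd t).deriv) t 0
  simp only [hh, zero_smul, neg_zero, NormedSpace.exp_zero] at hconst
  have e := congrArg (NormedSpace.exp (t • blockP 𝔨 A) : 𝔨 × 𝔭 →L[ℝ] 𝔨 × 𝔭) hconst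
  rw [exp_comp_exp_neg] at e
  exact e.symm

/-- The bracket of `𝔤` as a continuous bilinear map. -/
def HomogeneousSpace.bracketL (H : HomogeneousSpace.{u} 𝔨 𝔭) :
    (𝔨 × 𝔭) →L[ℝ] (𝔨 × 𝔭) →L[ℝ] (𝔨 × 𝔭) :=
  LinearMap.toContinuousLinearMap
    ((LinearMap.toContinuousLinearMap : ((𝔨 × 𝔭) →ₗ[ℝ] (𝔨 × 𝔭)) ≃ₗ[ℝ] _).toLinearMap ∘ₗ H.bracket)

theorem HomogeneousSpace.bracketL_apply (H : HomogeneousSpace.{u} 𝔨 𝔭) (X Y : 𝔨 × 𝔭) :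
    H.bracketL X Y = H.bracket X Y := rfl

/-- A derivation `diag(0, D)` of `𝔤` integrates to a one-parameter group of automorphisms of `G`
which preserve `K`, and so to the flow of a complete vector field on `G/K`. -/
theorem exists_automorphism_flow (H : HomogeneousSpace.{u} 𝔨 𝔭) {D : 𝔭 →L[ℝ] 𝔭}
    (hD : IsDerivation H.bracket
      ((blockP 𝔨 D : (𝔨 × 𝔭) →L[ℝ] (𝔨 × 𝔭)) : (𝔨 × 𝔭) →ₗ[ℝ] (𝔨 × 𝔭))) :
    ∃ (Φ : ℝ → H.G ≃* H.G) (X : ∀ p : H.Space, TangentSpace 𝓘(ℝ, 𝔭) p)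
      (φ : ℝ → H.Space ≃ₘ^∞⟮𝓘(ℝ, 𝔭), 𝓘(ℝ, 𝔭)⟯ H.Space),
      IsOneParameterGroup H (blockP 𝔨 D) Φ ∧ (∀ t, H.K.map (Φ t).toMonoidHom = H.K) ∧
      (∀ t g, φ t (H.proj g) = H.proj (Φ t g)) ∧ IsFlow X φ ∧
      ContMDiff 𝓘(ℝ, 𝔭) 𝓘(ℝ, 𝔭).tangent ∞ (fun p => (⟨p, X p⟩ : TangentBundle 𝓘(ℝ, 𝔭) H.Space)) ∧
      ∀ t (Y : 𝔭), diffEquiv (φ t) H.origin (H.ψ Y)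
        = H.ψ ((NormedSpace.exp (t • D) : 𝔭 →L[ℝ] 𝔭) Y) := by
  have hDL : ∀ X Y, blockP 𝔨 D (H.bracketL X Y)
      = H.bracketL (blockP 𝔨 D X) Y + H.bracketL X (blockP 𝔨 D Y) := hD
  set θ : ℝ → (𝔨 × 𝔭) ≃L[ℝ] (𝔨 × 𝔭) := fun t => expEquiv (t • blockP 𝔨 D) with hθ
  have hθ_apply : ∀ t X, θ t X = (NormedSpace.exp (t • blockP 𝔨 D) : 𝔨 × 𝔭 →L[ℝ] 𝔨 × 𝔭) X :=
    fun _ _ => rfl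
  have hθ_symm : ∀ t X, (θ t).symm X
      = (NormedSpace.exp ((-t) • blockP 𝔨 D) : 𝔨 × 𝔭 →L[ℝ] 𝔨 × 𝔭) X := by
    intro t X
    have h : (-t) • blockP 𝔨 D = -(t • blockP 𝔨 D) :=
      ContinuousLinearMap.ext fun Y => by simp
    rw [h]; rfl
  choose Φ φ hsm hlog hK hφ hψ using fun t => HomogeneousSpace.exists_isomorphism H H (θ t)
    (fun X Y => exp_derivation_apply hDL t X Y)
    (fun Z => by rw [hθ_apply, exp_blockP]; simp)
    (fun Z => by rw [hθ_symm, exp_blockP]; simp)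
  have hadd : ∀ t t' g, Φ (t + t') g = Φ t (Φ t' g) := by
    intro t t'
    refine congrFun (eq_of_hasLogDerivAt (hlog (t + t')) (f₂ := Φ t ∘ Φ t') (a := 1)
      (fun x => ?_) (by simp))
    have h := (hlog t (Φ t' x)).comp (hlog t' x)
    convert h using 1
    ext v
    obtain ⟨X, rfl⟩ := H.ι.surjective v
    simp [hθ_apply, exp_add_smul_apply]
  have hjoint : ContMDiff (𝓘(ℝ, ℝ).prod 𝓘(ℝ, 𝔨 × 𝔭)) 𝓘(ℝ, 𝔨 × 𝔭) ∞
      (fun z : ℝ × H.G => Φ z.1 z.2) :=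
    contMDiff_flow (ι := H.ι) (c := H.bracketL) (D := blockP 𝔨 D)
      (Φ := fun t => (Φ t).toMonoidHom) (fun X Y => rfl) hDL
      (fun t X => by simp [hθ_apply]) hlog hsm hadd
  have hjoint' : ContMDiff (𝓘(ℝ, ℝ).prod 𝓘(ℝ, 𝔭)) 𝓘(ℝ, 𝔭) ∞
      (fun z : ℝ × H.Space => φ z.1 z.2) := by
    refine H.contMDiff_prod_of_comp_proj ?_
    simp only [hφ]
    exact H.contMDiff_proj.comp hjoint
  have hzero : ∀ g, Φ 0 g = g := fun g => (Φ 0).injective (by rw [← hadd, add_zero])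
  have hφ0 : ∀ p, φ 0 p = p := by
    intro p
    obtain ⟨g, rfl⟩ := H.proj_surjective p
    rw [hφ, hzero]
  have hφadd : ∀ t t' p, φ (t + t') p = φ t (φ t' p) := by
    intro t t' p
    obtain ⟨g, rfl⟩ := H.proj_surjective p
    rw [hφ, hφ, hφ, hadd]
  refine ⟨Φ, _, φ, ⟨hsm, hadd, fun t X => ?_⟩, fun t => ?_, hφ,
    isFlow_velocity hjoint' hφ0 hφadd, contMDiff_velocity hjoint' hφ0, fun t Y => ?_⟩
  · refine ((hlog t 1).mfderiv_one (map_one _) _).trans ?_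
    exact congrArg (fun X => H.ι (θ t X)) (H.ι.symm_apply_apply X)
  · ext g
    rw [Subgroup.mem_map]
    constructor
    · rintro ⟨k, hk, rfl⟩
      exact (hK t k).1 hk
    · intro hg
      exact ⟨(Φ t).symm g, (hK t _).2 (by simpa using hg), by simp⟩
  · rw [hψ, hθ_apply, exp_blockP]

end Flows

/-! ### Tensors -/

section Tensors

open Filter Topology

variable {r s : ℕ}

section Pull

variable {U : Type*} [AddCommGroup U] [Module ℝ U] [TopologicalSpace U]
  [IsTopologicalAddGroup U] [ContinuousSMul ℝ U]
  {V : Type*} [AddCommGroup V] [Module ℝ V] [TopologicalSpace V]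
  [IsTopologicalAddGroup V] [ContinuousSMul ℝ V]
  {W : Type*} [AddCommGroup W] [Module ℝ W] [TopologicalSpace W]
  [IsTopologicalAddGroup W] [ContinuousSMul ℝ W]

theorem Tensor.pull_pull (e : U ≃L[ℝ] V) (f : V ≃L[ℝ] W) (T : Tensor r s W) :
    Tensor.pull e (Tensor.pull f T) = Tensor.pull (e.trans f) T := rfl

theorem Tensor.pull_refl (T : Tensor r s V) : Tensor.pull (.refl ℝ V) T = T := rfl

theorem Tensor.pull_symm_pull (e : V ≃L[ℝ] W) (T : Tensor r s W) :
    Tensor.pull e.symm (Tensor.pull e T) = T := by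
  rw [Tensor.pull_pull, ContinuousLinearEquiv.symm_trans_self, Tensor.pull_refl]

theorem Tensor.pull_injective (e : V ≃L[ℝ] W) :
    Injective (Tensor.pull e : Tensor r s W → Tensor r s V) :=
  LeftInverse.injective (g := Tensor.pull e.symm) (Tensor.pull_symm_pull e)

theorem Tensor.pull_smul (e : V ≃L[ℝ] W) (c : ℝ) (T : Tensor r s W) :
    Tensor.pull e (c • T) = c • Tensor.pull e T := rfl

/-- Homotheties act on tensors by scalars. -/
theorem Tensor.pull_homothety (e : V ≃L[ℝ] V) (τ : ℝ) (he : ∀ x, e x = Real.exp τ • x)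
    (T : Tensor r s V) : Tensor.pull e T = Real.exp (-(((s : ℝ) - r) * τ)) • T := by
  ext x ξ
  have he' : ∀ x, e.symm x = Real.exp (-τ) • x := by
    intro x
    rw [ContinuousLinearEquiv.symm_apply_eq, he, smul_smul, ← Real.exp_add]
    simp
  have h1 : ∀ j, (ξ j).comp (e.symm : V →L[ℝ] V) = Real.exp (-τ) • ξ j := by
    intro j; ext v; simp [he']
  rw [Tensor.pull_apply]
  simp only [he, h1]
  rw [MultilinearMap.map_smul_univ, smul_apply, MultilinearMap.map_smul_univ]
  simp only [Finset.prod_const, Finset.card_univ, Fintype.card_fin, smul_apply, smul_eq_mul]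
  rw [← mul_assoc, ← Real.exp_nat_mul, ← Real.exp_nat_mul, ← Real.exp_add]
  congr 2
  ring

end Pull

section Expansion

variable {V : Type*} [AddCommGroup V] [Module ℝ V] {ι : Type*} [Fintype ι] [DecidableEq ι]
  {n : ℕ} {A : Type*} [AddCommGroup A] [Module ℝ A]

/-- Expansion of a multilinear map in a basis. -/
theorem multilinear_eq_sum (b : Module.Basis ι ℝ V) (m : MultilinearMap ℝ (fun _ : Fin n => V) A)
    (x : Fin n → V) : m x = ∑ k : Fin n → ι, (∏ i, b.repr (x i) (k i)) • m (fun i => b (k i)) := by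
  conv_lhs => rw [show x = fun i => ∑ j, b.repr (x i) j • b j from
    funext fun i => (b.sum_repr (x i)).symm]
  rw [MultilinearMap.map_sum]
  exact Finset.sum_congr rfl fun k _ => MultilinearMap.map_smul_univ _ _ _

end Expansion

variable {𝔭 : Type v} [NormedAddCommGroup 𝔭] [NormedSpace ℝ 𝔭]

/-- `θ(cI)` is multiplication by `(s - r)c`, the derivative of `Tensor.pull_homothety`. -/
theorem theta_smul_id (c : ℝ) (γ : Tensor r s 𝔭) :
    theta (c • ContinuousLinearMap.id ℝ 𝔭) γ = (((s : ℝ) - r) * c) • γ := by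
  ext x ξ
  rw [theta_smul]
  simp [theta_apply]
  ring

variable [FiniteDimensional ℝ 𝔭]

theorem expEquiv_symm (A : 𝔭 →L[ℝ] 𝔭) : (expEquiv A).symm = expEquiv (-A) := by
  ext x
  change (NormedSpace.exp (-A) : 𝔭 →L[ℝ] 𝔭) x = (NormedSpace.exp (-A) : 𝔭 →L[ℝ] 𝔭) x
  rfl

theorem act_expEquiv (A : 𝔭 →L[ℝ] 𝔭) (t : ℝ) (γ : Tensor r s 𝔭) :
    Tensor.act (expEquiv (t • A)) γ = Tensor.pull (expEquiv ((-t) • A)) γ := by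
  rw [Tensor.act, expEquiv_symm, neg_smul]

/-- The derivative of `e^{tA} · γ`. -/
theorem hasDerivAt_act_exp_smul (A : 𝔭 →L[ℝ] 𝔭) (γ : Tensor r s 𝔭) (t : ℝ)
    (x : Fin r → 𝔭) (ξ : Fin s → 𝔭 →L[ℝ] ℝ) :
    HasDerivAt (fun τ : ℝ => Tensor.act (expEquiv (τ • A)) γ x ξ)
      (Tensor.act (expEquiv (t • A)) (theta A γ) x ξ) t := by
  have h : ∀ τ : ℝ, Tensor.act (expEquiv (τ • A)) γ
      = Tensor.act (expEquiv (t • A)) (Tensor.act (expEquiv ((τ - t) • A)) γ) := by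
    intro τ
    rw [act_expEquiv, act_expEquiv, act_expEquiv, Tensor.pull_pull]
    congr 1
    ext y
    have e := exp_add_smul_apply A (-(τ - t)) (-t) y
    rw [show -(τ - t) + -t = -τ by ring] at e
    exact e
  have h1 := hasDerivAt_act_exp A γ (fun i => (expEquiv (t • A)).symm (x i))
    (fun j => (ξ j).comp ((expEquiv (t • A)).symm.symm : 𝔭 →L[ℝ] 𝔭))
  rw [← sub_self t] at h1
  exact (h1.comp_sub_const t t).congr_of_eventuallyEq
    (Eventually.of_forall fun τ => congrArg (fun T : Tensor r s 𝔭 => T x ξ) (h τ))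

end Tensors

/-! ### Pull-back of tensor fields -/

section Pullback

open Filter Topology

variable {r s : ℕ} {𝔭 : Type v} [NormedAddCommGroup 𝔭] [NormedSpace ℝ 𝔭]
  {M : Type*} [TopologicalSpace M] [ChartedSpace 𝔭 M] [IsManifold 𝓘(ℝ, 𝔭) ∞ M]
  {N : Type*} [TopologicalSpace N] [ChartedSpace 𝔭 N] [IsManifold 𝓘(ℝ, 𝔭) ∞ N]
  {L : Type*} [TopologicalSpace L] [ChartedSpace 𝔭 L] [IsManifold 𝓘(ℝ, 𝔭) ∞ L]

theorem diffEquiv_trans (φ : M ≃ₘ^∞⟮𝓘(ℝ, 𝔭), 𝓘(ℝ, 𝔭)⟯ N) (χ : N ≃ₘ^∞⟮𝓘(ℝ, 𝔭), 𝓘(ℝ, 𝔭)⟯ L)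
    (p : M) : diffEquiv (φ.trans χ) p = (diffEquiv φ p).trans (diffEquiv χ (φ p)) := by
  ext x
  exact mfderiv_comp_apply p (χ.contMDiff_toFun.mdifferentiableAt (by simp))
    (φ.contMDiff_toFun.mdifferentiableAt (by simp)) x

theorem TensorField.pullback_pullback (φ : M ≃ₘ^∞⟮𝓘(ℝ, 𝔭), 𝓘(ℝ, 𝔭)⟯ N)
    (χ : N ≃ₘ^∞⟮𝓘(ℝ, 𝔭), 𝓘(ℝ, 𝔭)⟯ L) (T : TensorField 𝔭 r s L) :
    (T.pullback χ).pullback φ = T.pullback (φ.trans χ) := by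
  funext p
  change Tensor.pull (diffEquiv φ p) (Tensor.pull (diffEquiv χ (φ p)) (T (χ (φ p))))
    = Tensor.pull (diffEquiv (φ.trans χ) p) (T (χ (φ p)))
  rw [diffEquiv_trans, Tensor.pull_pull]
  rfl

theorem TensorField.IsSmooth.const_smul {T : TensorField 𝔭 r s M} (hT : T.IsSmooth) (c : ℝ) :
    TensorField.IsSmooth (c • T) := fun p₀ x ξ => by
  exact ContMDiffAt.comp (g := fun y : ℝ => c * y) p₀
    (contDiff_const.mul contDiff_id).contMDiff.contMDiffAt (hT p₀ x ξ)

variable [FiniteDimensional ℝ 𝔭]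

/-- The components of the pull-back are polynomials in those of the tensor field, the Jacobian of `φ`
and its inverse. -/
theorem TensorField.IsSmooth.pullback {T : TensorField 𝔭 r s N} (hT : T.IsSmooth)
    (φ : M ≃ₘ^∞⟮𝓘(ℝ, 𝔭), 𝓘(ℝ, 𝔭)⟯ N) : (T.pullback φ).IsSmooth := by
  intro p₀ x ξ
  have : CompleteSpace 𝔭 := FiniteDimensional.complete ℝ 𝔭
  set E₁ := trivializationAt 𝔭 (TangentSpace 𝓘(ℝ, 𝔭)) p₀ with hE₁
  set E₂ := trivializationAt 𝔭 (TangentSpace 𝓘(ℝ, 𝔭)) (φ p₀) with hE₂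
  have hφ : ContMDiffAt 𝓘(ℝ, 𝔭) 𝓘(ℝ, 𝔭) ∞ φ p₀ := φ.contMDiff_toFun.contMDiffAt
  -- the Jacobian of `φ` in the coordinate frames
  set A : M → 𝔭 →L[ℝ] 𝔭 := fun p => E₂.continuousLinearMapAt ℝ (φ p) ∘L
    (diffEquiv φ p : TangentSpace 𝓘(ℝ, 𝔭) p →L[ℝ] TangentSpace 𝓘(ℝ, 𝔭) (φ p)) ∘L E₁.symmL ℝ p with hA
  have hAs : ContMDiffAt 𝓘(ℝ, 𝔭) 𝓘(ℝ, 𝔭 →L[ℝ] 𝔭) ∞ A p₀ :=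
    ContMDiffAt.mfderiv_const (m := ∞) hφ (by simp)
  have hb₁ : ∀ᶠ p in 𝓝 p₀, p ∈ E₁.baseSet :=
    E₁.open_baseSet.mem_nhds (FiberBundle.mem_baseSet_trivializationAt' p₀)
  have hb₂ : ∀ᶠ p in 𝓝 p₀, φ p ∈ E₂.baseSet :=
    hφ.continuousAt.eventually_mem
      (E₂.open_baseSet.mem_nhds (FiberBundle.mem_baseSet_trivializationAt' (φ p₀)))
  let e : ∀ p, p ∈ E₁.baseSet → φ p ∈ E₂.baseSet → 𝔭 ≃L[ℝ] 𝔭 := fun p h₁ h₂ =>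
    ((E₁.continuousLinearEquivAt ℝ p h₁).symm.trans (diffEquiv φ p)).trans
      (E₂.continuousLinearEquivAt ℝ (φ p) h₂)
  have hAe : ∀ p h₁ h₂, A p = (e p h₁ h₂ : 𝔭 →L[ℝ] 𝔭) := by
    intro p h₁ h₂
    ext v
    simp only [hA, e, ContinuousLinearMap.comp_apply, ContinuousLinearEquiv.coe_coe,
      ContinuousLinearEquiv.trans_apply, Bundle.Trivialization.symm_continuousLinearEquivAt_eq,
      Bundle.Trivialization.coe_continuousLinearEquivAt_eq]
  have hAi : ContMDiffAt 𝓘(ℝ, 𝔭) 𝓘(ℝ, 𝔭 →L[ℝ] 𝔭) ∞ (fun p => (A p).inverse) p₀ := by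
    have h : ContDiffAt ℝ ∞ (ContinuousLinearMap.inverse : (𝔭 →L[ℝ] 𝔭) → (𝔭 →L[ℝ] 𝔭)) (A p₀) := by
      rw [hAe p₀ hb₁.self_of_nhds hb₂.self_of_nhds]
      exact contDiffAt_map_inverse _
    exact ContMDiffAt.comp p₀ h.contMDiffAt hAs
  let b := Module.finBasis ℝ 𝔭
  let b' := Module.finBasis ℝ (𝔭 →L[ℝ] ℝ)
  have key : ∀ᶠ p in 𝓝 p₀, T.pullback φ p (fun i => E₁.symmL ℝ p (x i))
      (fun j => (ξ j).comp (E₁.continuousLinearMapAt ℝ p))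
      = ∑ k : Fin r → Fin (Module.finrank ℝ 𝔭),
        ∑ l : Fin s → Fin (Module.finrank ℝ (𝔭 →L[ℝ] ℝ)), (∏ i, b.repr (A p (x i)) (k i)) *
        ((∏ j, b'.repr ((ξ j).comp (A p).inverse) (l j)) * T (φ p) (fun i => E₂.symmL ℝ (φ p) (b (k i)))
          (fun j => (b' (l j)).comp (E₂.continuousLinearMapAt ℝ (φ p)))) := by
    filter_upwards [hb₁, hb₂] with p h₁ h₂
    let L₁ := (E₁.continuousLinearEquivAt ℝ p h₁).symm
    let L₂ := (E₂.continuousLinearEquivAt ℝ (φ p) h₂).symm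
    have e1 : T.pullback φ p (fun i => E₁.symmL ℝ p (x i))
        (fun j => (ξ j).comp (E₁.continuousLinearMapAt ℝ p))
        = Tensor.pull (e p h₁ h₂) (Tensor.pull L₂ (T (φ p))) x ξ := by
      have : (e p h₁ h₂).trans L₂ = L₁.trans (diffEquiv φ p) := by
        ext v
        exact L₂.apply_symm_apply (diffEquiv φ p (L₁ v))
      have hL : ∀ v, E₁.symmL ℝ p v = L₁ v := fun v =>
        (congrFun (E₁.symm_continuousLinearEquivAt_eq h₁) v).symm
      have hL' : E₁.continuousLinearMapAt ℝ p = (L₁.symm : TangentSpace 𝓘(ℝ, 𝔭) p →L[ℝ] 𝔭) :=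
        (E₁.coe_continuousLinearEquivAt_eq' h₁).symm
      rw [Tensor.pull_pull, this, ← Tensor.pull_pull]
      simp only [hL, hL']
      rfl
    rw [e1, Tensor.pull_apply, multilinear_eq_sum b]
    rw [sum_apply]
    refine Finset.sum_congr rfl fun k _ => ?_
    rw [smul_apply, multilinear_eq_sum b', smul_eq_mul, Finset.mul_sum]
    refine Finset.sum_congr rfl fun l _ => ?_
    have hL : ∀ v, E₂.symmL ℝ (φ p) v = L₂ v := fun v =>
      (congrFun (E₂.symm_continuousLinearEquivAt_eq h₂) v).symm
    have hL' : E₂.continuousLinearMapAt ℝ (φ p)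
        = (L₂.symm : TangentSpace 𝓘(ℝ, 𝔭) (φ p) →L[ℝ] 𝔭) :=
      (E₂.coe_continuousLinearEquivAt_eq' h₂).symm
    rw [smul_eq_mul, hAe p h₁ h₂, ContinuousLinearMap.inverse_equiv]
    simp only [hL, hL']
    rfl
  refine ContMDiffAt.congr_of_eventuallyEq ?_ key
  have hsum : ∀ {ι : Type} [Fintype ι] (g : ι → M → ℝ),
      (∀ i, ContMDiffAt 𝓘(ℝ, 𝔭) 𝓘(ℝ, ℝ) ∞ (g i) p₀) →
      ContMDiffAt 𝓘(ℝ, 𝔭) 𝓘(ℝ, ℝ) ∞ (fun p => ∑ i, g i p) p₀ :=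
    fun g hg => contMDiffAt_finsetSum fun i _ => hg i
  have hprod : ∀ {ι : Type} [Fintype ι] (g : ι → M → ℝ),
      (∀ i, ContMDiffAt 𝓘(ℝ, 𝔭) 𝓘(ℝ, ℝ) ∞ (g i) p₀) →
      ContMDiffAt 𝓘(ℝ, 𝔭) 𝓘(ℝ, ℝ) ∞ (fun p => ∏ i, g i p) p₀ :=
    fun g hg => contMDiffAt_finsetProd fun i _ => hg i
  refine hsum _ fun k => hsum _ fun l => ?_
  refine (hprod _ fun i => ?_).mul ((hprod _ fun j => ?_).mul ?_)
  · have h1 : ContMDiffAt 𝓘(ℝ, 𝔭) 𝓘(ℝ, 𝔭) ∞ (fun p => A p (x i)) p₀ :=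
      hAs.clm_apply contMDiffAt_const
    exact ContMDiffAt.comp (g := fun y => b.repr y (k i)) p₀
      (LinearMap.toContinuousLinearMap (b.coord (k i))).contMDiff.contMDiffAt h1
  · have h1 : ContMDiffAt 𝓘(ℝ, 𝔭) 𝓘(ℝ, 𝔭 →L[ℝ] ℝ) ∞ (fun p => (ξ j).comp (A p).inverse) p₀ :=
      ContMDiffAt.clm_comp contMDiffAt_const hAi
    exact ContMDiffAt.comp (g := fun y => b'.repr y (l j)) p₀
      (LinearMap.toContinuousLinearMap (b'.coord (l j))).contMDiff.contMDiffAt h1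
  · exact ContMDiffAt.comp (g := fun q => T q (fun i => E₂.symmL ℝ q (b (k i)))
      (fun j => (b' (l j)).comp (E₂.continuousLinearMapAt ℝ q))) p₀ (hT (φ p₀) _ _) hφ

end Pullback

/-! ### Invariant structures and their operators -/

section InvariantTensors

open Filter Topology

variable {𝔨 : Type w} [NormedAddCommGroup 𝔨] [NormedSpace ℝ 𝔨] [FiniteDimensional ℝ 𝔨]
  {𝔭 : Type v} [NormedAddCommGroup 𝔭] [NormedSpace ℝ 𝔭] [FiniteDimensional ℝ 𝔭] {r s : ℕ}

/-- The multiples of a structure modelled on `γ` which arise by scaling the frames by a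
homothety. -/
theorem IsGeometricStructure.exp_smul {M : Type*} [TopologicalSpace M] [ChartedSpace 𝔭 M]
    [IsManifold 𝓘(ℝ, 𝔭) ∞ M] {γ : Tensor r s 𝔭} {δ : TensorField 𝔭 r s M}
    (h : IsGeometricStructure γ δ) (τ : ℝ) :
    IsGeometricStructure γ (Real.exp (((s : ℝ) - r) * τ) • δ) where
  smooth := h.smooth.const_smul _
  frame p := by
    obtain ⟨e, he⟩ := h.frame p
    let k : 𝔭 ≃L[ℝ] 𝔭 := ContinuousLinearEquiv.smulLeft (Units.mk0 (Real.exp τ) (Real.exp_ne_zero τ))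
    refine ⟨k.trans e, ?_⟩
    rw [← Tensor.pull_pull, Pi.smul_apply, Tensor.pull_smul, he,
      Tensor.pull_homothety k τ (fun x => rfl), smul_smul, ← Real.exp_add]
    simp

theorem IsGeometricStructure.pullback {M N : Type*} [TopologicalSpace M] [ChartedSpace 𝔭 M]
    [IsManifold 𝓘(ℝ, 𝔭) ∞ M] [TopologicalSpace N] [ChartedSpace 𝔭 N] [IsManifold 𝓘(ℝ, 𝔭) ∞ N]
    {γ : Tensor r s 𝔭} {δ : TensorField 𝔭 r s N}
    (h : IsGeometricStructure γ δ) (φ : M ≃ₘ^∞⟮𝓘(ℝ, 𝔭), 𝓘(ℝ, 𝔭)⟯ N) :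
    IsGeometricStructure γ (δ.pullback φ) where
  smooth := h.smooth.pullback φ
  frame p := by
    obtain ⟨e, he⟩ := h.frame (φ p)
    refine ⟨e.trans (diffEquiv φ p).symm, ?_⟩
    change Tensor.pull _ (Tensor.pull _ _) = _
    rw [Tensor.pull_pull, ← he]
    congr 1
    ext x
    simp

namespace HomogeneousSpace

variable (H : HomogeneousSpace.{u} 𝔨 𝔭)

theorem proj_one : H.proj 1 = H.origin := rfl

/-- At every point of `G/K` there is a frame in which all invariant tensor fields have the same
components as at the origin: the translate of the frame at the origin. -/
theorem exists_frame (r s : ℕ) (p : H.Space) : ∃ e : 𝔭 ≃L[ℝ] TangentSpace 𝓘(ℝ, 𝔭) p,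
    ∀ T : TensorField 𝔭 r s H.Space, H.IsInvariant T → Tensor.pull e (T p) = H.atOrigin T := by
  obtain ⟨g, rfl⟩ := H.proj_surjective p
  rw [H.proj_eq_smul]
  refine ⟨H.ψ.trans (diffEquiv (H.translation g) H.origin), fun T hT => ?_⟩
  have h := congrFun (hT g) H.origin
  rw [atOrigin, ← h]
  rfl

variable {H} {T T' : TensorField 𝔭 r s H.Space}

/-- An invariant tensor field is determined by its value at the origin. -/
theorem IsInvariant.ext (hT : H.IsInvariant T) (hT' : H.IsInvariant T')
    (h : H.atOrigin T = H.atOrigin T') : T = T' := by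
  funext p
  obtain ⟨e, he⟩ := H.exists_frame r s p
  exact Tensor.pull_injective e ((he T hT).trans (h.trans (he T' hT').symm))

theorem IsInvariant.const_smul (hT : H.IsInvariant T) (c : ℝ) : H.IsInvariant (c • T) :=
  fun g => congrArg (c • ·) (hT g)

theorem IsInvariant.sub (hT : H.IsInvariant T) (hT' : H.IsInvariant T') :
    H.IsInvariant (T - T') := fun g => congrArg₂ (· - ·) (hT g) (hT' g)

theorem atOrigin_smul (c : ℝ) : H.atOrigin (c • T) = c • H.atOrigin T := rfl

theorem atOrigin_sub : H.atOrigin (T - T') = H.atOrigin T - H.atOrigin T' := rfl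

theorem IsInvariantStructure.isGeometricStructure {γ : Tensor r s 𝔭}
    (h : H.IsInvariantStructure γ T) : IsGeometricStructure γ T where
  smooth := h.smooth
  frame p := by
    obtain ⟨e, he⟩ := H.exists_frame r s p
    exact ⟨e, (he T h.invariant).trans h.atOrigin_eq⟩

section Morphisms

variable {H' : HomogeneousSpace.{u} 𝔨 𝔭} {f : H.G ≃* H'.G}
  {φ : H.Space ≃ₘ^∞⟮𝓘(ℝ, 𝔭), 𝓘(ℝ, 𝔭)⟯ H'.Space} {S : TensorField 𝔭 r s H'.Space}

/-- Pull-back by a diffeomorphism covering a homomorphism `f` preserves invariance, since the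
diffeomorphism intertwines the translations by `g` and `f g`. -/
theorem IsInvariant.pullback (hS : H'.IsInvariant S) (hφ : ∀ g, φ (H.proj g) = H'.proj (f g)) :
    H.IsInvariant (S.pullback φ) := by
  intro g
  have h : (H.translation g).trans φ = φ.trans (H'.translation (f g)) := by
    refine Diffeomorph.ext fun p => ?_
    obtain ⟨a, rfl⟩ := H.proj_surjective p
    change φ (g • H.proj a) = f g • φ (H.proj a)
    rw [← H.proj_mul, hφ, hφ, map_mul, H'.proj_mul]
  rw [TensorField.pullback_pullback, h, ← TensorField.pullback_pullback, hS]

/-- Transport along an equality `q = o` of points; it is stated with a variable point `q`, so that the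
equality can be eliminated although the tangent space depends on `q`. -/
theorem pull_eq_of_eq {q : H'.Space} (hq : q = H'.origin) (e : 𝔭 ≃L[ℝ] TangentSpace 𝓘(ℝ, 𝔭) q)
    (A : 𝔭 ≃L[ℝ] 𝔭) (h : ∀ X, (e X : 𝔭) = H'.ψ (A X)) :
    Tensor.pull e (S q) = Tensor.pull A (H'.atOrigin S) := by
  subst hq
  rw [atOrigin, Tensor.pull_pull]
  congr 1
  ext X
  exact h X

/-- If `φ` maps the origin to the origin with differential `A`, pull-back by `φ` acts on values at the
origin as pull-back by `A`. -/
theorem atOrigin_pullback (hφ : ∀ g, φ (H.proj g) = H'.proj (f g)) (A : 𝔭 ≃L[ℝ] 𝔭)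
    (hA : ∀ X, (diffEquiv φ H.origin (H.ψ X) : 𝔭) = H'.ψ (A X)) :
    H.atOrigin (S.pullback φ) = Tensor.pull A (H'.atOrigin S) := by
  refine pull_eq_of_eq (q := φ H.origin) ?_ (H.ψ.trans (diffEquiv φ H.origin)) A hA
  rw [← H.proj_one, hφ, map_one, proj_one]

end Morphisms

/-- The homogeneous space `G/K` with the identification `𝔤 = 𝔨 ⊕ 𝔭` rescaled by `e^τ` on `𝔭`. -/
def rescale (H : HomogeneousSpace.{u} 𝔨 𝔭) (τ : ℝ) : HomogeneousSpace.{u} 𝔨 𝔭 :=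
  let k : 𝔭 ≃L[ℝ] 𝔭 := ContinuousLinearEquiv.smulLeft (Units.mk0 (Real.exp τ) (Real.exp_ne_zero τ))
  have hk0 : ∀ Z : 𝔨, ((ContinuousLinearEquiv.refl ℝ 𝔨).prodCongr k).trans H.ι (Z, 0)
      = H.ι (Z, 0) := fun Z => by simp
  have hsymm : ∀ v, (((ContinuousLinearEquiv.refl ℝ 𝔨).prodCongr k).trans H.ι).symm v
      = ((H.ι.symm v).1, k.symm (H.ι.symm v).2) := fun v => rfl
  have hlie : ∀ (Z : 𝔨) (X : 𝔭), ⁅H.ι (Z, 0), H.ι (0, k X)⁆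
      = Real.exp τ • ⁅H.ι (Z, 0), H.ι (0, X)⁆ := fun Z X => by
    have h : (0, k X) = Real.exp τ • ((0 : 𝔨), X) := by
      rw [Prod.smul_mk, smul_zero]; rfl
    have h2 := (H.bracket (Z, 0)).map_smul (Real.exp τ) (0, X)
    rw [← h, bracket_apply, bracket_apply, ← map_smul] at h2
    exact H.ι.symm.injective h2
  { G := H.G
    K := H.K
    isClosed := H.isClosed
    isConnected := H.isConnected
    smooth_smul := H.smooth_smul
    ι := ((ContinuousLinearEquiv.refl ℝ 𝔨).prodCongr k).trans H.ι
    ψ := k.trans H.ψ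
    mfderiv_proj := fun Z X => H.mfderiv_proj Z (k X)
    bracket_kk := fun Z Z' => by
      rw [hk0, hk0, hsymm, H.bracket_kk, map_zero]
    bracket_kp := fun Z X => by
      rw [hk0, hsymm]
      change (H.ι.symm ⁅H.ι (Z, 0), H.ι (0, k X)⁆).1 = 0
      rw [hlie, map_smul, Prod.smul_fst, H.bracket_kp, smul_zero]
    effective := fun Z h => H.effective Z fun X => by
      have h' := h X
      rw [hk0] at h'
      change ⁅H.ι (Z, 0), H.ι (0, k X)⁆ = 0 at h'
      rw [hlie] at h'
      exact (smul_eq_zero.1 h').resolve_left (Real.exp_ne_zero τ) }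

theorem bracket_rescale (H : HomogeneousSpace.{u} 𝔨 𝔭) (τ : ℝ) :
    (H.rescale τ).bracket = scaleBracket (Real.exp τ) H.bracket := by
  refine LinearMap.ext₂ fun X Y => ?_
  rw [bracket_apply]
  rfl

/-- Rescaling `𝔭` is a homothety for the tensors at the origin. -/
theorem atOrigin_rescale (τ : ℝ) (T : TensorField 𝔭 r s H.Space) :
    (H.rescale τ).atOrigin T = Real.exp (-(((s : ℝ) - r) * τ)) • H.atOrigin T := by
  let k : 𝔭 ≃L[ℝ] 𝔭 := ContinuousLinearEquiv.smulLeft (Units.mk0 (Real.exp τ) (Real.exp_ne_zero τ))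
  rw [← Tensor.pull_homothety k τ (fun x => rfl)]
  rfl

end HomogeneousSpace

open HomogeneousSpace

variable {γ : Tensor r s 𝔭} {𝔮 : Submodule ℝ (𝔭 →L[ℝ] 𝔭)} {F : GeometricFlow.{u} γ} {α : ℝ}
  {H : HomogeneousSpace.{u} 𝔨 𝔭} {Γ : TensorField 𝔭 r s H.Space}

theorem GeometricFlow.isInvariant_q (F : GeometricFlow.{u} γ) (hΓ : H.IsInvariantStructure γ Γ) :
    H.IsInvariant (F.q H.Space Γ) := by
  intro g
  rw [← F.natural _ _ _ _ hΓ.isGeometricStructure, hΓ.invariant g]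

/-- As `𝔮` meets `g_γ` trivially, `A ↦ θ(A) γ` is injective on `𝔮`. -/
theorem IsInvariantComplement.theta_injOn (h𝔮 : IsInvariantComplement γ 𝔮) {Q Q' : 𝔭 →L[ℝ] 𝔭}
    (hQ : Q ∈ 𝔮) (hQ' : Q' ∈ 𝔮) (h : theta Q γ = theta Q' γ) : Q = Q' := by
  have h1 : Q - Q' ∈ stabAlgebra γ := by
    change theta (Q - Q') γ = 0
    have h2 : theta (Q - Q') γ + theta Q' γ = theta Q γ := by rw [← theta_add, sub_add_cancel]
    refine MultilinearMap.ext fun x => MultilinearMap.ext fun ξ => ?_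
    have h3 : theta (Q - Q') γ x ξ + theta Q' γ x ξ = theta Q γ x ξ :=
      congrArg (fun T : Tensor r s 𝔭 => T x ξ) h2
    rw [h] at h3
    exact add_eq_right.1 h3
  exact sub_eq_zero.1 (Submodule.disjoint_def.1 h𝔮.isCompl.disjoint _ h1 (𝔮.sub_mem hQ hQ'))

/-- `q(γ)` is tangent to the orbit of `γ`, hence of the form `θ(A) γ`, and the component of `A` in
`g_γ` does not contribute. -/
theorem GeometricFlow.exists_isOperator (h𝔮 : IsInvariantComplement γ 𝔮)
    (hΓ : H.IsInvariantStructure γ Γ) : ∃ Q, F.IsOperator 𝔮 H Γ Q := by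
  obtain ⟨A, hA⟩ := F.tangent _ _ hΓ.isGeometricStructure H.origin H.ψ hΓ.atOrigin_eq
  have htop : A ∈ stabAlgebra γ ⊔ 𝔮 := by rw [h𝔮.isCompl.sup_eq_top]; trivial
  obtain ⟨A₁, hA₁, A₂, hA₂, rfl⟩ := Submodule.mem_sup.1 htop
  refine ⟨A₂, hA₂, ?_⟩
  have h1 : theta A₁ γ = 0 := hA₁
  rw [theta_add, h1, zero_add] at hA
  exact hA.symm

/-- The operator `Q_μ` depends only on the bracket `μ`: homogeneous spaces with the same bracket
are isomorphic. -/
theorem GeometricFlow.IsOperator.eq_of_bracket_eq (h𝔮 : IsInvariantComplement γ 𝔮)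
    {H' : HomogeneousSpace.{u} 𝔨 𝔭} {Γ' : TensorField 𝔭 r s H'.Space}
    (hΓ : H.IsInvariantStructure γ Γ) (hΓ' : H'.IsInvariantStructure γ Γ')
    (hb : H.bracket = H'.bracket) {Q Q' : 𝔭 →L[ℝ] 𝔭} (hQ : F.IsOperator 𝔮 H Γ Q)
    (hQ' : F.IsOperator 𝔮 H' Γ' Q') : Q = Q' := by
  obtain ⟨f, φ, -, -, -, hφ, hψ⟩ := exists_isomorphism H H' (.refl ℝ (𝔨 × 𝔭))
    (fun X Y => by rw [hb]; rfl) (fun Z => rfl) (fun Z => rfl)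
  have hat : ∀ S : TensorField 𝔭 r s H'.Space, H.atOrigin (S.pullback φ) = H'.atOrigin S :=
    fun S => atOrigin_pullback hφ (.refl ℝ 𝔭) hψ
  have h : Γ'.pullback φ = Γ := (hΓ'.invariant.pullback hφ).ext hΓ.invariant
    (by rw [hat, hΓ.atOrigin_eq, hΓ'.atOrigin_eq])
  refine h𝔮.theta_injOn hQ.1 hQ'.1 ?_
  rw [hQ.2, hQ'.2, ← hat, ← F.natural _ _ _ _ hΓ'.isGeometricStructure, h]

/-- The effect of scaling on the structure and on the operator `Q`. -/
theorem GeometricFlow.IsOperator.rescale (hα : F.HasScaling α)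
    (hΓ : H.IsInvariantStructure γ Γ) {Q : 𝔭 →L[ℝ] 𝔭} (hQ : F.IsOperator 𝔮 H Γ Q) (τ : ℝ) :
    F.IsBracketOperator 𝔮 (scaleBracket (Real.exp τ) H.bracket)
      (Real.exp (-(flowConst r s α * τ)) • Q) := by
  have hgeo := hΓ.isGeometricStructure
  have hinv : (H.rescale τ).IsInvariant (Real.exp (((s : ℝ) - r) * τ) • Γ) :=
    hΓ.invariant.const_smul _
  have hat : (H.rescale τ).atOrigin (Real.exp (((s : ℝ) - r) * τ) • Γ) = γ := by
    rw [atOrigin_rescale, HomogeneousSpace.atOrigin_smul, hΓ.atOrigin_eq, smul_smul, ← Real.exp_add]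
    simp
  refine ⟨H.rescale τ, Real.exp (((s : ℝ) - r) * τ) • Γ, bracket_rescale H τ,
    ⟨hgeo.smooth.const_smul _, hinv, hat⟩, 𝔮.smul_mem _ hQ.1, ?_⟩
  have hq := hα H.Space Γ _ (Real.exp_pos (((s : ℝ) - r) * τ)) hgeo (hgeo.exp_smul τ)
  refine Eq.trans ?_ (congrArg (H.rescale τ).atOrigin hq).symm
  rw [atOrigin_rescale, HomogeneousSpace.atOrigin_smul, ← hQ.2, theta_smul, smul_smul,
    ← Real.exp_mul, ← Real.exp_add]
  congr 2
  rw [flowConst]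
  ring

end InvariantTensors

/-! ### The scaling factor and the time change -/

section ScalarFunctions

open Filter Topology

variable {r s : ℕ} {α c t : ℝ}

theorem zero_mem_flowInterval : (0 : ℝ) ∈ flowInterval r s α c := by simp [flowInterval]

theorem isOpen_flowInterval : IsOpen (flowInterval r s α c) :=
  isOpen_lt continuous_const (by fun_prop)

theorem timeChange_zero : timeChange r s α c 0 = 0 := by simp [timeChange]

theorem exp_timeChange (ht : t ∈ flowInterval r s α c) :
    Real.exp (flowConst r s α * c * timeChange r s α c t) = flowConst r s α * c * t + 1 := by
  have ht' : 0 < flowConst r s α * c * t + 1 := ht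
  rw [timeChange]
  split_ifs with h
  · simp [h]
  · rw [mul_div_cancel₀ _ h, Real.exp_log ht']

/-- The time change solves `s' = e^{-acs}`. -/
theorem hasDerivAt_timeChange (ht : t ∈ flowInterval r s α c) :
    HasDerivAt (timeChange r s α c)
      (Real.exp (-(flowConst r s α * c * timeChange r s α c t))) t := by
  have ht' : 0 < flowConst r s α * c * t + 1 := ht
  rw [Real.exp_neg, exp_timeChange ht]
  by_cases h : flowConst r s α * c = 0
  · have : timeChange r s α c = id := by ext t; simp [timeChange, h]
    rw [this, h, zero_mul, zero_add, inv_one]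
    exact hasDerivAt_id t
  · have h1 : HasDerivAt (fun t => flowConst r s α * c * t + 1) (flowConst r s α * c) t := by
      simpa using ((hasDerivAt_id t).const_mul (flowConst r s α * c)).add_const 1
    have h2 := (h1.log ht'.ne').div_const (flowConst r s α * c)
    have h3 : timeChange r s α c
        = fun t => Real.log (flowConst r s α * c * t + 1) / (flowConst r s α * c) := by
      ext t; simp [timeChange, h]
    rw [h3]
    refine h2.congr_deriv ?_
    rw [div_right_comm, div_self h, one_div]

/-- The scaling factor in terms of the time change: `b = e^{(s-r)cs}`. -/
theorem scaleFactor_eq_exp (ht : t ∈ flowInterval r s α c) :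
    scaleFactor r s α c t = Real.exp (((s : ℝ) - r) * (c * timeChange r s α c t)) := by
  have ht' : 0 < flowConst r s α * c * t + 1 := ht
  rw [scaleFactor]
  split_ifs with h
  · rw [timeChange, if_pos (by simp [flowConst, h]), mul_assoc]
  · have h1 : 1 - α ≠ 0 := sub_ne_zero.2 (Ne.symm h)
    rw [← exp_timeChange ht, ← Real.exp_mul, flowConst]
    congr 1
    field_simp

end ScalarFunctions

/-! ### Scaling of brackets -/

section BracketCalculus

open Filter Topology

variable {𝔨 : Type w} [NormedAddCommGroup 𝔨] [NormedSpace ℝ 𝔨]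
  {𝔭 : Type v} [NormedAddCommGroup 𝔭] [NormedSpace ℝ 𝔭]
  {μ : (𝔨 × 𝔭) →ₗ[ℝ] (𝔨 × 𝔭) →ₗ[ℝ] (𝔨 × 𝔭)}

theorem scaleBracket_apply (c : ℝ) (X Y : 𝔨 × 𝔭) : scaleBracket c μ X Y
    = ((μ (X.1, c • X.2) (Y.1, c • Y.2)).1, c⁻¹ • (μ (X.1, c • X.2) (Y.1, c • Y.2)).2) := rfl

theorem deltaBracket_apply (A : (𝔨 × 𝔭) →ₗ[ℝ] (𝔨 × 𝔭)) (X Y : 𝔨 × 𝔭) :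
    deltaBracket μ A X Y = μ (A X) Y + μ X (A Y) - A (μ X Y) := rfl

theorem blockP_apply (A : 𝔭 →L[ℝ] 𝔭) (X : 𝔨 × 𝔭) : blockP 𝔨 A X = (0, A X.2) := rfl

theorem isDerivation_iff {A : (𝔨 × 𝔭) →ₗ[ℝ] (𝔨 × 𝔭)} :
    IsDerivation μ A ↔ ∀ X Y, deltaBracket μ A X Y = 0 := by
  refine forall₂_congr fun X Y => ?_
  rw [deltaBracket_apply, sub_eq_zero, eq_comm]

theorem deltaBracket_blockP_smul_add (a b : ℝ) (A B : 𝔭 →L[ℝ] 𝔭) (X Y : 𝔨 × 𝔭) :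
    deltaBracket μ (blockP 𝔨 (a • A + b • B) : (𝔨 × 𝔭) →L[ℝ] (𝔨 × 𝔭)) X Y
      = a • deltaBracket μ (blockP 𝔨 A : (𝔨 × 𝔭) →L[ℝ] (𝔨 × 𝔭)) X Y
        + b • deltaBracket μ (blockP 𝔨 B : (𝔨 × 𝔭) →L[ℝ] (𝔨 × 𝔭)) X Y := by
  have h : ∀ X : 𝔨 × 𝔭, blockP 𝔨 (a • A + b • B) X = a • blockP 𝔨 A X + b • blockP 𝔨 B X := by
    intro X
    simp [blockP_apply]
  simp only [deltaBracket_apply, ContinuousLinearMap.coe_coe, h, map_add, map_smul,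
    LinearMap.add_apply, LinearMap.smul_apply]
  module

/-- A derivation of the form `diag(0, D)` is also one of the scaled brackets. -/
theorem deltaBracket_scaleBracket_of_isDerivation {D : 𝔭 →L[ℝ] 𝔭}
    (hD : IsDerivation μ ((blockP 𝔨 D : (𝔨 × 𝔭) →L[ℝ] (𝔨 × 𝔭)) : (𝔨 × 𝔭) →ₗ[ℝ] (𝔨 × 𝔭))) (c : ℝ)
    (X Y : 𝔨 × 𝔭) :
    deltaBracket (scaleBracket c μ) (blockP 𝔨 D : (𝔨 × 𝔭) →L[ℝ] (𝔨 × 𝔭)) X Y = 0 := by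
  have h := hD (X.1, c • X.2) (Y.1, c • Y.2)
  simp only [ContinuousLinearMap.coe_coe, blockP_apply, map_smul] at h
  rw [deltaBracket_apply]
  simp only [ContinuousLinearMap.coe_coe, blockP_apply, scaleBracket_apply, map_smul]
  have h1 := congrArg Prod.fst h
  have h2 := congrArg Prod.snd h
  simp only [Prod.fst_add, Prod.snd_add] at h1 h2
  ext
  · simp [← h1]
  · simp [h2]

variable [FiniteDimensional ℝ 𝔨] [FiniteDimensional ℝ 𝔭]

/-- The curve `e^{h(t)} · μ` has derivative `h' δ(diag(0, I))`. -/
theorem hasDerivAt_scaleBracket (H : HomogeneousSpace.{u} 𝔨 𝔭) {h : ℝ → ℝ} {h' t : ℝ}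
    (hh : HasDerivAt h h' t) (X Y : 𝔨 × 𝔭) :
    HasDerivAt (fun τ => scaleBracket (Real.exp (h τ)) H.bracket X Y)
      (h' • deltaBracket (scaleBracket (Real.exp (h t)) H.bracket)
        (blockP 𝔨 (.id ℝ 𝔭) : (𝔨 × 𝔭) →L[ℝ] (𝔨 × 𝔭)) X Y) t := by
  have e1 : ∀ X : 𝔨 × 𝔭, HasDerivAt (fun τ => (X.1, Real.exp (h τ) • X.2))
      (h' • ((0 : 𝔨), Real.exp (h t) • X.2)) t := fun X => by
    have := (hasDerivAt_const t X.1).prodMk (hh.exp.smul_const X.2)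
    refine this.congr_deriv ?_
    rw [Prod.smul_mk, smul_zero, smul_smul, mul_comm]
  have e2 := (H.bracketL.hasFDerivAt.comp_hasDerivAt t (e1 X)).clm_apply (e1 Y)
  have e3 := (hasFDerivAt_fst.comp_hasDerivAt t e2).prodMk
    (hh.neg.exp.smul (hasFDerivAt_snd.comp_hasDerivAt t e2))
  have hfun : (fun τ => scaleBracket (Real.exp (h τ)) H.bracket X Y) = fun τ =>
      ((H.bracketL (X.1, Real.exp (h τ) • X.2) (Y.1, Real.exp (h τ) • Y.2)).1,
        Real.exp (-(h τ)) • (H.bracketL (X.1, Real.exp (h τ) • X.2) (Y.1, Real.exp (h τ) • Y.2)).2) := by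
    funext τ
    rw [scaleBracket_apply, Real.exp_neg]
    rfl
  rw [hfun]
  refine e3.congr_deriv ?_
  rw [deltaBracket_apply]
  simp only [ContinuousLinearMap.coe_coe, blockP_apply, scaleBracket_apply, ← H.bracketL_apply,
    ← Real.exp_neg, comp_apply, map_smul, smul_apply]
  ext
  · simp
  · simp
    module

theorem HomogeneousSpace.bracket_skew (H : HomogeneousSpace.{u} 𝔨 𝔭) (X Y : 𝔨 × 𝔭) :
    H.bracket X Y = - H.bracket Y X := by
  have : CompleteSpace (𝔨 × 𝔭) := FiniteDimensional.complete ℝ (𝔨 × 𝔭)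
  have : LieGroup 𝓘(ℝ, 𝔨 × 𝔭) (minSmoothness ℝ 3) H.G := by
    rw [minSmoothness_of_isRCLikeNormedField]; infer_instance
  rw [H.bracket_apply, H.bracket_apply, ← map_neg, lie_skew]

/-- Scaling does not change the bracket with `𝔨`, as `[𝔨, 𝔨] ⊂ 𝔨` and `[𝔨, 𝔭] ⊂ 𝔭`. -/
theorem HomogeneousSpace.scaleBracket_k (H : HomogeneousSpace.{u} 𝔨 𝔭) {c : ℝ} (hc : c ≠ 0)
    (Z : 𝔨) (X : 𝔨 × 𝔭) : scaleBracket c H.bracket (Z, 0) X = H.bracket (Z, 0) X := by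
  have h : ∀ a : ℝ, H.bracket (Z, 0) (X.1, a • X.2)
      = ((H.bracket (Z, 0) (X.1, 0)).1, a • (H.bracket (Z, 0) (0, X.2)).2) := by
    intro a
    have h1 : (X.1, a • X.2) = (X.1, (0 : 𝔭)) + a • ((0 : 𝔨), X.2) := by simp
    have h2 : (H.bracket (Z, 0) (X.1, 0)).2 = 0 := H.bracket_kk Z X.1
    have h3 : (H.bracket (Z, 0) (0, X.2)).1 = 0 := H.bracket_kp Z X.2
    rw [h1, map_add, map_smul]
    ext <;> simp [h2, h3]
  have h1 := h 1
  rw [one_smul, one_smul] at h1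
  rw [scaleBracket_apply, smul_zero, h c, inv_smul_smul₀ hc]
  exact h1.symm

/-- On `𝔭 × 𝔭`, scaling by `c` multiplies the component in `𝔨` by `c²` and that in `𝔭` by `c`. -/
theorem HomogeneousSpace.scaleBracket_p (H : HomogeneousSpace.{u} 𝔨 𝔭) {c : ℝ} (hc : c ≠ 0)
    (X Y : 𝔭) : scaleBracket c H.bracket (0, X) (0, Y)
      = (c ^ 2 • (H.bracket (0, X) (0, Y)).1, c • (H.bracket (0, X) (0, Y)).2) := by
  have h : ∀ X : 𝔭, ((0 : 𝔨), c • X) = c • (0, X) := fun X => by simp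
  rw [scaleBracket_apply]
  simp only [h, map_smul, LinearMap.smul_apply, Prod.smul_fst, Prod.smul_snd, smul_smul]
  congr 2
  · ring
  · field_simp

/-- The scaled bracket in components. -/
theorem HomogeneousSpace.eq_scaleBracket_iff (H H' : HomogeneousSpace.{u} 𝔨 𝔭) {c : ℝ}
    (hc : 0 < c) : H'.bracket = scaleBracket c H.bracket ↔
      (∀ (Z : 𝔨) (X : 𝔨 × 𝔭), H'.bracket (Z, 0) X = H.bracket (Z, 0) X) ∧
      ∀ X Y : 𝔭, (H'.bracket (0, X) (0, Y)).1 = c ^ 2 • (H.bracket (0, X) (0, Y)).1 ∧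
        (H'.bracket (0, X) (0, Y)).2 = c • (H.bracket (0, X) (0, Y)).2 := by
  constructor
  · intro h
    rw [h]
    exact ⟨H.scaleBracket_k hc.ne', fun X Y => by rw [H.scaleBracket_p hc.ne']; exact ⟨rfl, rfl⟩⟩
  · rintro ⟨h1, h2⟩
    have hsk : ∀ X Y, scaleBracket c H.bracket X Y = - scaleBracket c H.bracket Y X := by
      intro X Y
      rw [scaleBracket_apply, scaleBracket_apply, H.bracket_skew]
      simp
    refine LinearMap.ext₂ fun X Y => ?_
    have hX : X = (X.1, 0) + (0, X.2) := by simp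
    have hY : Y = (Y.1, 0) + (0, Y.2) := by simp
    have hpp : ∀ X Y : 𝔭, H'.bracket (0, X) (0, Y) = scaleBracket c H.bracket (0, X) (0, Y) := by
      intro X Y
      rw [H.scaleBracket_p hc.ne', ← (h2 X Y).1, ← (h2 X Y).2]
    have hk : ∀ Z X, H'.bracket (Z, 0) X = scaleBracket c H.bracket (Z, 0) X := fun Z X => by
      rw [h1, H.scaleBracket_k hc.ne']
    have hpk : ∀ X Z, H'.bracket X (Z, 0) = scaleBracket c H.bracket X (Z, 0) := fun X Z => by
      rw [H'.bracket_skew, hk, hsk X]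
    rw [hX, map_add, map_add, LinearMap.add_apply, LinearMap.add_apply, hk]
    conv_lhs => rw [hY]
    conv_rhs => rw [hY]
    rw [map_add (H'.bracket (0, X.2)), map_add (scaleBracket c H.bracket (0, X.2)), hpp, hpk]

end BracketCalculus

/-! ### Algebraic solitons -/

section Solitons

open Filter Topology HomogeneousSpace

variable {𝔨 : Type w} [NormedAddCommGroup 𝔨] [NormedSpace ℝ 𝔨] [FiniteDimensional ℝ 𝔨]
  {𝔭 : Type v} [NormedAddCommGroup 𝔭] [NormedSpace ℝ 𝔭] [FiniteDimensional ℝ 𝔭] {r s : ℕ}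
  {γ : Tensor r s 𝔭} {𝔮 : Submodule ℝ (𝔭 →L[ℝ] 𝔭)} {F : GeometricFlow.{u} γ} {α : ℝ}
  {H : HomogeneousSpace.{u} 𝔨 𝔭} {Γ : TensorField 𝔭 r s H.Space}

theorem scaleBracket_one (μ : (𝔨 × 𝔭) →ₗ[ℝ] (𝔨 × 𝔭) →ₗ[ℝ] (𝔨 × 𝔭)) : scaleBracket 1 μ = μ := by
  refine LinearMap.ext₂ fun X Y => ?_
  simp [scaleBracket_apply]

/-- For an algebraic soliton the bracket flow only scales the bracket. -/
theorem GeometricFlow.IsOperator.isBracketFlow (hα : F.HasScaling α)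
    (hΓ : H.IsInvariantStructure γ Γ) {c : ℝ} {D : 𝔭 →L[ℝ] 𝔭}
    (hD : IsDerivation H.bracket
      ((blockP 𝔨 D : (𝔨 × 𝔭) →L[ℝ] (𝔨 × 𝔭)) : (𝔨 × 𝔭) →ₗ[ℝ] (𝔨 × 𝔭)))
    (hQ : F.IsOperator 𝔮 H Γ (c • ContinuousLinearMap.id ℝ 𝔭 + D)) :
    F.IsBracketFlow 𝔮 (flowInterval r s α c)
      (fun t => scaleBracket (Real.exp (c * timeChange r s α c t)) H.bracket) := by
  intro t ht
  refine ⟨_, hQ.rescale hα hΓ (c * timeChange r s α c t), fun X Y => ?_⟩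
  refine (hasDerivAt_scaleBracket H ((hasDerivAt_timeChange ht).const_mul c) X Y).congr_deriv ?_
  rw [smul_add, smul_smul, deltaBracket_blockP_smul_add,
    deltaBracket_scaleBracket_of_isDerivation hD, smul_zero, add_zero]
  congr 1
  rw [mul_comm, mul_assoc]

/-- If the bracket flow starts by scaling the bracket, then the scaling factor is differentiable at
`0` unless it has no effect on the bracket. -/
theorem exists_hasDerivAt_scaleBracket {c : ℝ → ℝ} (hc0 : c 0 = 1) (hc : ∀ᶠ t in 𝓝 0, 0 < c t)
    (hd : ∀ X Y, DifferentiableAt ℝ (fun t => scaleBracket (c t) H.bracket X Y) 0) :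
    ∃ c' : ℝ, ∀ X Y, HasDerivAt (fun t => scaleBracket (c t) H.bracket X Y)
      (c' • deltaBracket H.bracket (blockP 𝔨 (.id ℝ 𝔭) : (𝔨 × 𝔭) →L[ℝ] (𝔨 × 𝔭)) X Y) 0 := by
  by_cases hpp : ∀ X Y : 𝔭, H.bracket (0, X) (0, Y) = 0
  · -- the scaled bracket does not depend on `c`, which is then arbitrary
    refine ⟨0, fun X Y => ?_⟩
    rw [zero_smul]
    refine (hasDerivAt_const (0 : ℝ) (H.bracket X Y)).congr_of_eventuallyEq ?_
    filter_upwards [hc] with t ht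
    have h : H.bracket = scaleBracket (c t) H.bracket :=
      (eq_scaleBracket_iff H H ht).2 ⟨fun Z X => rfl, fun X Y => by simp [hpp]⟩
    rw [← h]
  · push Not at hpp
    obtain ⟨X₀, Y₀, h₀⟩ := hpp
    have hev : (fun t => scaleBracket (c t) H.bracket (0, X₀) (0, Y₀)) =ᶠ[𝓝 0] fun t =>
        (c t ^ 2 • (H.bracket (0, X₀) (0, Y₀)).1, c t • (H.bracket (0, X₀) (0, Y₀)).2) := by
      filter_upwards [hc] with t ht
      exact H.scaleBracket_p ht.ne' X₀ Y₀
    have hd₀ := (hd (0, X₀) (0, Y₀)).congr_of_eventuallyEq hev.symm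
    have hcd : DifferentiableAt ℝ c 0 := by
      by_cases h2 : (H.bracket (0, X₀) (0, Y₀)).2 = 0
      · -- only `c²` appears in the component of the bracket in `𝔨`; `c` is its positive square root
        have h1 : (H.bracket (0, X₀) (0, Y₀)).1 ≠ 0 := fun h1 => h₀ (Prod.ext h1 h2)
        obtain ⟨f, hf⟩ := SeparatingDual.exists_eq_one (R := ℝ) h1
        have h3 : DifferentiableAt ℝ (fun t => c t ^ 2) 0 := by
          have := f.differentiableAt.comp (0 : ℝ) hd₀.fst
          simpa [comp_def, hf] using this
        refine (h3.sqrt (by simp [hc0])).congr_of_eventuallyEq ?_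
        filter_upwards [hc] with t ht
        exact (Real.sqrt_sq ht.le).symm
      · obtain ⟨f, hf⟩ := SeparatingDual.exists_eq_one (R := ℝ) h2
        have := f.differentiableAt.comp (0 : ℝ) hd₀.snd
        simpa [comp_def, hf] using this
    have hlog : HasDerivAt (fun t => Real.log (c t)) (deriv c 0) 0 :=
      (hcd.hasDerivAt.log (by rw [hc0]; exact one_ne_zero)).congr_deriv (by rw [hc0, div_one])
    refine ⟨deriv c 0, fun X Y => ?_⟩
    have h := hasDerivAt_scaleBracket H hlog X Y
    rw [hc0, Real.log_one, Real.exp_zero, scaleBracket_one] at h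
    refine h.congr_of_eventuallyEq ?_
    filter_upwards [hc] with t ht
    rw [Real.exp_log ht]

/-- If the bracket flow starts by scaling the bracket, then `H` is an algebraic soliton. -/
theorem GeometricFlow.IsOperator.exists_isDerivation (h𝔮 : IsInvariantComplement γ 𝔮)
    (hΓ : H.IsInvariantStructure γ Γ) {Q : 𝔭 →L[ℝ] 𝔭} (hQ : F.IsOperator 𝔮 H Γ Q) {t₁ t₂ : ℝ}
    {μ : ℝ → (𝔨 × 𝔭) →ₗ[ℝ] (𝔨 × 𝔭) →ₗ[ℝ] (𝔨 × 𝔭)} {c : ℝ → ℝ} (h₁ : t₁ < 0) (h₂ : 0 < t₂)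
    (hflow : F.IsBracketFlow 𝔮 (Ioo t₁ t₂) μ) (hμ0 : μ 0 = H.bracket) (hc0 : c 0 = 1)
    (hμ : ∀ t ∈ Ioo t₁ t₂, 0 < c t ∧ μ t = scaleBracket (c t) H.bracket) :
    ∃ (c : ℝ) (D : 𝔭 →L[ℝ] 𝔭), IsDerivation H.bracket
      ((blockP 𝔨 D : (𝔨 × 𝔭) →L[ℝ] (𝔨 × 𝔭)) : (𝔨 × 𝔭) →ₗ[ℝ] (𝔨 × 𝔭)) ∧
      Q = c • ContinuousLinearMap.id ℝ 𝔭 + D := by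
  have hI : Ioo t₁ t₂ ∈ 𝓝 (0 : ℝ) := Ioo_mem_nhds h₁ h₂
  obtain ⟨Q₀, ⟨H', Γ', hb, hΓ', hQ₀⟩, hder⟩ := hflow 0 ⟨h₁, h₂⟩
  obtain rfl : Q = Q₀ := hQ.eq_of_bracket_eq h𝔮 hΓ hΓ' (hμ0.symm.trans hb.symm) hQ₀
  rw [hμ0] at hder
  have hder' : ∀ X Y, HasDerivAt (fun t => scaleBracket (c t) H.bracket X Y)
      (deltaBracket H.bracket (blockP 𝔨 Q : (𝔨 × 𝔭) →L[ℝ] (𝔨 × 𝔭)) X Y) 0 := fun X Y => by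
    refine (hder X Y).congr_of_eventuallyEq ?_
    filter_upwards [hI] with t ht
    rw [(hμ t ht).2]
  obtain ⟨c', hc'⟩ := exists_hasDerivAt_scaleBracket hc0
    (mem_of_superset hI fun t ht => (hμ t ht).1) fun X Y => (hder' X Y).differentiableAt
  refine ⟨c', (1 : ℝ) • Q + (-c') • ContinuousLinearMap.id ℝ 𝔭, isDerivation_iff.2 fun X Y => ?_, ?_⟩
  · rw [deltaBracket_blockP_smul_add, one_smul, (hder' X Y).unique (hc' X Y), neg_smul,
      add_neg_cancel]
  · rw [one_smul, neg_smul]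
    abel

theorem theta_neg_apply (A : 𝔭 →L[ℝ] 𝔭) (γ : Tensor r s 𝔭) (x : Fin r → 𝔭)
    (ξ : Fin s → 𝔭 →L[ℝ] ℝ) : theta (-A) γ x ξ = -theta A γ x ξ := by
  rw [← neg_one_smul ℝ A, theta_smul]
  exact neg_one_smul ℝ (theta A γ x ξ)

section Flow

variable {Φ : ℝ → H.G ≃* H.G} {φ : ℝ → H.Space ≃ₘ^∞⟮𝓘(ℝ, 𝔭), 𝓘(ℝ, 𝔭)⟯ H.Space}
  {X : ∀ p : H.Space, TangentSpace 𝓘(ℝ, 𝔭) p} {D : 𝔭 →L[ℝ] 𝔭}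

/-- The time is reversed because tensors are pulled back by `φ`, but pushed forward by `e^{tD}`. -/
theorem atOrigin_pullback_flow (hφ : ∀ t g, φ t (H.proj g) = H.proj (Φ t g))
    (hψ : ∀ t (Y : 𝔭), diffEquiv (φ t) H.origin (H.ψ Y)
      = H.ψ ((NormedSpace.exp (t • D) : 𝔭 →L[ℝ] 𝔭) Y)) (T : TensorField 𝔭 r s H.Space) (t : ℝ) :
    H.atOrigin (T.pullback (φ (-t))) = Tensor.act (expEquiv (t • D)) (H.atOrigin T) := by
  rw [act_expEquiv]
  exact atOrigin_pullback (hφ (-t)) (expEquiv ((-t) • D)) (hψ (-t))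

/-- An invariant tensor field is recovered from its value at the origin by the frames of
`exists_frame`. -/
theorem exists_apply_eq_atOrigin (p : H.Space) (x : Fin r → TangentSpace 𝓘(ℝ, 𝔭) p)
    (ξ : Fin s → TangentSpace 𝓘(ℝ, 𝔭) p →L[ℝ] ℝ) :
    ∃ (x' : Fin r → 𝔭) (ξ' : Fin s → 𝔭 →L[ℝ] ℝ), ∀ T : TensorField 𝔭 r s H.Space,
      H.IsInvariant T → T p x ξ = H.atOrigin T x' ξ' := by
  obtain ⟨e, he⟩ := H.exists_frame r s p
  refine ⟨fun i => e.symm (x i), fun j => (ξ j).comp (e : 𝔭 →L[ℝ] TangentSpace 𝓘(ℝ, 𝔭) p),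
    fun T hT => ?_⟩
  rw [← he T hT]
  exact (congrArg (fun T => T x ξ) (Tensor.pull_symm_pull e (T p))).symm

/-- The Lie derivative of an invariant tensor field along the field defined by a derivation. -/
theorem isLieDerivative_of_flow (hφ : ∀ t g, φ t (H.proj g) = H.proj (Φ t g))
    (hψ : ∀ t (Y : 𝔭), diffEquiv (φ t) H.origin (H.ψ Y)
      = H.ψ ((NormedSpace.exp (t • D) : 𝔭 →L[ℝ] 𝔭) Y))
    (hX : ContMDiff 𝓘(ℝ, 𝔭) 𝓘(ℝ, 𝔭).tangent ∞
      (fun p => (⟨p, X p⟩ : TangentBundle 𝓘(ℝ, 𝔭) H.Space)))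
    (hF : IsFlow X φ) (hΓ : H.IsInvariant Γ) {L : TensorField 𝔭 r s H.Space} (hL : H.IsInvariant L)
    (hat : H.atOrigin L = theta (-D) (H.atOrigin Γ)) : IsLieDerivative X Γ L := by
  refine ⟨hX, φ, hF, fun p x ξ => ?_⟩
  obtain ⟨x', ξ', h⟩ := exists_apply_eq_atOrigin p x ξ
  have h1 : ∀ t, Γ.pullback (φ t) p x ξ
      = Tensor.act (expEquiv (t • (-D))) (H.atOrigin Γ) x' ξ' := by
    intro t
    rw [h _ (hΓ.pullback (hφ t)), ← neg_neg t, atOrigin_pullback_flow hφ hψ, neg_smul_neg]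
  simp only [h1]
  rw [h L hL, hat]
  exact hasDerivAt_act_exp (-D) (H.atOrigin Γ) x' ξ'

/-- The value of `q(γ)` at the origin, as `θ(cI) = (s - r)c`. -/
theorem GeometricFlow.IsOperator.atOrigin_q {c : ℝ}
    (hQ : F.IsOperator 𝔮 H Γ (c • ContinuousLinearMap.id ℝ 𝔭 + D)) :
    H.atOrigin (F.q H.Space Γ) = (((s : ℝ) - r) * c) • γ + theta D γ := by
  rw [← hQ.2, theta_add, theta_smul_id]

/-- For an algebraic soliton the geometric flow evolves by scaling and pulling back along the flow
of the derivation. -/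
theorem isSolution_of_flow (hα : F.HasScaling α) (hΓ : H.IsInvariantStructure γ Γ)
    (hφ : ∀ t g, φ t (H.proj g) = H.proj (Φ t g))
    (hψ : ∀ t (Y : 𝔭), diffEquiv (φ t) H.origin (H.ψ Y)
      = H.ψ ((NormedSpace.exp (t • D) : 𝔭 →L[ℝ] 𝔭) Y)) {c : ℝ}
    (hQ : F.IsOperator 𝔮 H Γ (c • ContinuousLinearMap.id ℝ 𝔭 + D)) :
    F.IsSolution (flowInterval r s α c)
      fun t => scaleFactor r s α c t • Γ.pullback (φ (-(timeChange r s α c t))) := by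
  intro t ht
  have hgeo := hΓ.isGeometricStructure.pullback (φ (-(timeChange r s α c t)))
  have hgeo' := hgeo.exp_smul (c * timeChange r s α c t)
  refine ⟨by simp only [scaleFactor_eq_exp ht]; exact hgeo', fun p x ξ => ?_⟩
  obtain ⟨x', ξ', h⟩ := exists_apply_eq_atOrigin p x ξ
  set σ := timeChange r s α c t with hσ
  set k : ℝ := (s : ℝ) - r with hk
  have hΓt : (fun τ => (scaleFactor r s α c τ • Γ.pullback (φ (-(timeChange r s α c τ)))) p x ξ)
      =ᶠ[𝓝 t] fun τ => Real.exp (k * (c * timeChange r s α c τ)) *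
        Tensor.act (expEquiv (timeChange r s α c τ • D)) γ x' ξ' := by
    filter_upwards [isOpen_flowInterval.mem_nhds ht] with τ hτ
    rw [scaleFactor_eq_exp hτ, h _ ((hΓ.invariant.pullback (hφ _)).const_smul _), atOrigin_smul,
      atOrigin_pullback_flow hφ hψ, hΓ.atOrigin_eq]
    rfl
  have hq : F.q H.Space (scaleFactor r s α c t • Γ.pullback (φ (-σ)))
      = (Real.exp (k * (c * σ)) ^ α) • (F.q H.Space Γ).pullback (φ (-σ)) := by
    rw [scaleFactor_eq_exp ht, hα _ _ _ (Real.exp_pos _) hgeo hgeo',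
      F.natural _ _ _ _ hΓ.isGeometricStructure]
  have hqt : F.q H.Space (scaleFactor r s α c t • Γ.pullback (φ (-σ))) p x ξ
      = Real.exp (k * (c * σ)) ^ α * (k * c * Tensor.act (expEquiv (σ • D)) γ x' ξ'
        + Tensor.act (expEquiv (σ • D)) (theta D γ) x' ξ') := by
    rw [hq, h _ (((F.isInvariant_q hΓ).pullback (hφ _)).const_smul _), atOrigin_smul,
      atOrigin_pullback_flow hφ hψ, hQ.atOrigin_q]
    rfl
  have hs := hasDerivAt_timeChange ht
  have hb := ((hs.const_mul c).const_mul k).exp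
  have hact : HasDerivAt (fun τ => Tensor.act (expEquiv (timeChange r s α c τ • D)) γ x' ξ') _ t :=
    HasDerivAt.comp (h₂ := fun τ => Tensor.act (expEquiv (τ • D)) γ x' ξ') t
      (hasDerivAt_act_exp_smul D γ σ x' ξ') hs
  refine ((hb.mul hact).congr_of_eventuallyEq hΓt).congr_deriv ?_
  rw [hqt]
  -- the exponents of `b^α` and `b s'` agree
  have hexp : Real.exp (k * (c * σ)) ^ α
      = Real.exp (k * (c * σ)) * Real.exp (-(flowConst r s α * c * σ)) := by
    rw [← Real.exp_mul, ← Real.exp_add]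
    congr 1
    rw [flowConst]
    ring
  rw [hexp]
  ring

end Flow

end Solitons

end BracketFlow

end

open BracketFlow in
theorem mainTheorem2
    {𝔨 : Type w} [NormedAddCommGroup 𝔨] [NormedSpace ℝ 𝔨] [FiniteDimensional ℝ 𝔨]
    {𝔭 : Type v} [NormedAddCommGroup 𝔭] [NormedSpace ℝ 𝔭] [FiniteDimensional ℝ 𝔭]
    {r s : ℕ} {γ : Tensor r s 𝔭}
    {𝔮 : Submodule ℝ (𝔭 →L[ℝ] 𝔭)} (h𝔮 : IsInvariantComplement γ 𝔮)
    (F : GeometricFlow.{u, v} γ) {α : ℝ} (hα : F.HasScaling α)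
    (H : HomogeneousSpace.{u, v, w} 𝔨 𝔭) (Γ : TensorField 𝔭 r s H.Space)
    (hΓ : H.IsInvariantStructure γ Γ) :
    ∃ Q : 𝔭 →L[ℝ] 𝔭, F.IsOperator 𝔮 H Γ Q ∧ (∀ Q', F.IsOperator 𝔮 H Γ Q' → Q' = Q) ∧
    List.TFAE [
      -- the bracket flow solution starting at `[·,·]` is `μ(t) = c(t) · [·,·]`
      ∃ (t₁ t₂ : ℝ) (μ : ℝ → (𝔨 × 𝔭) →ₗ[ℝ] (𝔨 × 𝔭) →ₗ[ℝ] (𝔨 × 𝔭)) (c : ℝ → ℝ),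
        t₁ < 0 ∧ 0 < t₂ ∧ F.IsBracketFlow 𝔮 (Ioo t₁ t₂) μ ∧ μ 0 = H.bracket ∧ c 0 = 1 ∧
        ∀ t ∈ Ioo t₁ t₂, 0 < c t ∧ μ t = scaleBracket (c t) H.bracket,
      -- the same, in components
      ∃ (t₁ t₂ : ℝ) (μ : ℝ → (𝔨 × 𝔭) →ₗ[ℝ] (𝔨 × 𝔭) →ₗ[ℝ] (𝔨 × 𝔭)) (c : ℝ → ℝ),
        t₁ < 0 ∧ 0 < t₂ ∧ F.IsBracketFlow 𝔮 (Ioo t₁ t₂) μ ∧ μ 0 = H.bracket ∧ c 0 = 1 ∧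
        ∀ t ∈ Ioo t₁ t₂, 0 < c t ∧
          (∀ (Z : 𝔨) (X : 𝔨 × 𝔭), μ t (Z, 0) X = H.bracket (Z, 0) X) ∧
          ∀ X Y : 𝔭,
            (μ t (0, X) (0, Y)).1 = (c t) ^ 2 • (H.bracket (0, X) (0, Y)).1 ∧
            (μ t (0, X) (0, Y)).2 = c t • (H.bracket (0, X) (0, Y)).2,
      -- the algebraic soliton condition
      ∃ (c : ℝ) (D : 𝔭 →L[ℝ] 𝔭),
        IsDerivation H.bracket ((blockP 𝔨 D : (𝔨 × 𝔭) →L[ℝ] (𝔨 × 𝔭)) : (𝔨 × 𝔭) →ₗ[ℝ] (𝔨 × 𝔭)) ∧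
        Q = c • ContinuousLinearMap.id ℝ 𝔭 + D] ∧
    ∀ (c : ℝ) (D : 𝔭 →L[ℝ] 𝔭),
      IsDerivation H.bracket ((blockP 𝔨 D : (𝔨 × 𝔭) →L[ℝ] (𝔨 × 𝔭)) : (𝔨 × 𝔭) →ₗ[ℝ] (𝔨 × 𝔭)) →
      Q = c • ContinuousLinearMap.id ℝ 𝔭 + D →
      -- the explicit bracket flow solution
      F.IsBracketFlow 𝔮 (flowInterval r s α c)
        (fun t => scaleBracket (Real.exp (c * timeChange r s α c t)) H.bracket) ∧
      -- the explicit geometric flow solution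
      (∃ Γt : ℝ → TensorField 𝔭 r s H.Space, Γt 0 = Γ ∧
        F.IsSolution (flowInterval r s α c) Γt ∧
        ∀ t ∈ flowInterval r s α c, H.IsInvariant (Γt t) ∧
          H.atOrigin (Γt t) = scaleFactor r s α c t •
            Tensor.act (expEquiv (timeChange r s α c t • D)) γ) ∧
      -- the soliton equation
      (∃ (Φ : ℝ → H.G ≃* H.G) (X : ∀ p : H.Space, TangentSpace 𝓘(ℝ, 𝔭) p)
          (L : TensorField 𝔭 r s H.Space),
        IsOneParameterGroup H (blockP 𝔨 D) Φ ∧ IsAutomorphismField H Φ X ∧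
        IsLieDerivative X Γ L ∧
        ∀ p, F.q H.Space Γ p = (((s : ℝ) - r) * c) • Γ p - L p) ∧
      F.IsSoliton Γ := by
  obtain ⟨Q, hQ⟩ := GeometricFlow.exists_isOperator (F := F) h𝔮 hΓ
  refine ⟨Q, hQ, fun Q' hQ' => h𝔮.theta_injOn hQ'.1 hQ.1 (hQ'.2.trans hQ.2.symm), ?_, ?_⟩
  · -- along a bracket flow the brackets are skew, so that the components determine them
    have hiff : ∀ {t₁ t₂ : ℝ} {μ : ℝ → (𝔨 × 𝔭) →ₗ[ℝ] (𝔨 × 𝔭) →ₗ[ℝ] (𝔨 × 𝔭)},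
        F.IsBracketFlow 𝔮 (Ioo t₁ t₂) μ → ∀ t ∈ Ioo t₁ t₂, ∀ {c : ℝ}, 0 < c →
        (μ t = scaleBracket c H.bracket ↔
          (∀ (Z : 𝔨) (X : 𝔨 × 𝔭), μ t (Z, 0) X = H.bracket (Z, 0) X) ∧
          ∀ X Y : 𝔭, (μ t (0, X) (0, Y)).1 = c ^ 2 • (H.bracket (0, X) (0, Y)).1 ∧
            (μ t (0, X) (0, Y)).2 = c • (H.bracket (0, X) (0, Y)).2) := by
      intro t₁ t₂ μ hμ t ht c hc
      obtain ⟨-, ⟨H', -, hb, -⟩, -⟩ := hμ t ht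
      rw [← hb]
      exact H.eq_scaleBracket_iff H' hc
    tfae_have 1 → 2 := by
      rintro ⟨t₁, t₂, μ, c, h₁, h₂, hμ, hμ0, hc0, h⟩
      exact ⟨t₁, t₂, μ, c, h₁, h₂, hμ, hμ0, hc0, fun t ht =>
        ⟨(h t ht).1, (hiff hμ t ht (h t ht).1).1 (h t ht).2⟩⟩
    tfae_have 2 → 1 := by
      rintro ⟨t₁, t₂, μ, c, h₁, h₂, hμ, hμ0, hc0, h⟩
      exact ⟨t₁, t₂, μ, c, h₁, h₂, hμ, hμ0, hc0, fun t ht =>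
        ⟨(h t ht).1, (hiff hμ t ht (h t ht).1).2 (h t ht).2⟩⟩
    tfae_have 1 → 3 := by
      rintro ⟨t₁, t₂, μ, c, h₁, h₂, hμ, hμ0, hc0, h⟩
      exact hQ.exists_isDerivation h𝔮 hΓ h₁ h₂ hμ hμ0 hc0 h
    tfae_have 3 → 1 := by
      rintro ⟨c, D, hD, rfl⟩
      obtain ⟨ε, hε, hJ⟩ := Metric.isOpen_iff.1 (isOpen_flowInterval (r := r) (s := s) (α := α)
        (c := c)) 0 zero_mem_flowInterval
      rw [Real.ball_eq_Ioo, zero_sub, zero_add] at hJ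
      refine ⟨-ε, ε, fun t => scaleBracket (Real.exp (c * timeChange r s α c t)) H.bracket,
        fun t => Real.exp (c * timeChange r s α c t), neg_lt_zero.2 hε, hε,
        fun t ht => hQ.isBracketFlow hα hΓ hD t (hJ ht), ?_, ?_, fun t _ => ⟨Real.exp_pos _, rfl⟩⟩
      · simp [timeChange_zero, scaleBracket_one]
      · simp [timeChange_zero]
    tfae_finish
  · rintro c D hD rfl
    obtain ⟨Φ, X, φ, hΦ, hK, hφ, hflow, hX, hψ⟩ := exists_automorphism_flow H hD
    -- the field of the opposite derivation enters the soliton equation with the opposite sign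
    have hD' : IsDerivation H.bracket
        ((blockP 𝔨 (-D) : (𝔨 × 𝔭) →L[ℝ] (𝔨 × 𝔭)) : (𝔨 × 𝔭) →ₗ[ℝ] (𝔨 × 𝔭)) := by
      rw [isDerivation_iff] at hD ⊢
      intro X Y
      have h := deltaBracket_blockP_smul_add (μ := H.bracket) (-1) 0 D 0 X Y
      simpa [hD] using h
    obtain ⟨Φ', X', φ', -, -, hφ', hflow', hX', hψ'⟩ := exists_automorphism_flow H hD'
    have hq := hQ.atOrigin_q
    have hinv := F.isInvariant_q hΓ
    have hk := hΓ.invariant.const_smul (((s : ℝ) - r) * c)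
    have hat := hΓ.atOrigin_eq
    refine ⟨hQ.isBracketFlow hα hΓ hD, ⟨_, ?_, isSolution_of_flow hα hΓ hφ hψ hQ, fun t ht => ?_⟩,
      ⟨Φ, X, (((s : ℝ) - r) * c) • Γ - F.q H.Space Γ, hΦ, ⟨hK, φ, hφ, hflow⟩,
        isLieDerivative_of_flow hφ hψ hX hflow hΓ.invariant (hk.sub hinv) ?_, fun p => ?_⟩,
      ((s : ℝ) - r) * c, X', F.q H.Space Γ - (((s : ℝ) - r) * c) • Γ,
        isLieDerivative_of_flow hφ' hψ' hX' hflow' hΓ.invariant (hinv.sub hk) ?_, fun p => ?_⟩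
    · refine HomogeneousSpace.IsInvariant.ext ((hΓ.invariant.pullback (hφ _)).const_smul _)
        hΓ.invariant ?_
      rw [HomogeneousSpace.atOrigin_smul, atOrigin_pullback_flow hφ hψ,
        scaleFactor_eq_exp zero_mem_flowInterval, timeChange_zero]
      have h : expEquiv ((0 : ℝ) • D) = .refl ℝ 𝔭 := by ext; simp [expEquiv]
      rw [mul_zero, mul_zero, Real.exp_zero, h]
      exact one_smul ℝ (H.atOrigin Γ)
    · exact ⟨(hΓ.invariant.pullback (hφ _)).const_smul _, by
        rw [HomogeneousSpace.atOrigin_smul, atOrigin_pullback_flow hφ hψ, hat]⟩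
    · rw [HomogeneousSpace.atOrigin_sub, HomogeneousSpace.atOrigin_smul, hq, hat]
      refine MultilinearMap.ext fun x => MultilinearMap.ext fun ξ => ?_
      rw [theta_neg_apply]
      exact sub_add_cancel_left _ _
    · exact MultilinearMap.ext fun x => MultilinearMap.ext fun ξ => (sub_sub_cancel _ _).symm
    · rw [HomogeneousSpace.atOrigin_sub, HomogeneousSpace.atOrigin_smul, hq, hat, neg_neg]
      exact MultilinearMap.ext fun x => MultilinearMap.ext fun ξ => add_sub_cancel_left _ _
    · exact MultilinearMap.ext fun x => MultilinearMap.ext fun ξ => (add_sub_cancel _ _).symm
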